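/- Let $q\in\mathbb C^\times$ not be a root of unity, and fix $q^{1/3}$ and a cube root $q^{1/9}$ of it; all fractional powers of $q$ below are powers of these. **Universal characters.** Define $p_k$ ($k\in\mathbb Z$) by $\sum_k p_k(\boldsymbol x)z^k=\exp\bigl(\sum_{n\ge1}x_nz^n\bigr)$. For sequences of integers $\lambda=(\lambda_1,\dots,\lambda_l)$, $\mu=(\mu_1,\dots,\mu_{l'})$ let $S_{[\lambda,\mu]}(\boldsymbol x,\boldsymbol y)$ be the determinant of the $(l+l')\times(l+l')$ matrix whose $(i,j)$ entry is $p_{\mu_{l'-i+1}+i-j}(\boldsymbol y)$ for $1\le i\le l'$ and $p_{\lambda_{i-l'}-i+j}(\boldsymbol x)$ for $l'+1\le i\le l+l'$. Let $R_{[\lambda,\mu]}(a,b)=S_{[\lambda,\mu]}(\boldsymbol x,\boldsymbol y)$ under $$x_n=\frac{a^{-n}+b^{-n}+(ab)^n}{n(1-q^n)},\qquad y_n=\frac{a^{n}+b^{n}+(ab)^{-n}}{n(1-q^{-n})}.$$ **Three-core partitions.** For $\boldsymbol n=(n_1,n_2,n_3)\in\mathbb Z^3$ put $|\boldsymbol n|=n_1+n_2+n_3$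 and $M(\boldsymbol n)=\bigcup_{j=1}^3(3\mathbb Z_{<n_j}+j)=\{m_1>m_2>\cdots\}$, and let $\lambda(\boldsymbol n)$ be the partition with $m_i-m_{i+1}=\lambda_i-\lambda_{i+1}+1$. Let $\boldsymbol n(i)$ be $\boldsymbol n$ with its first $i$ entries raised by $1$ ($i=0,1,2$). Since $\lambda(\boldsymbol n+(1,1,1))=\lambda(\boldsymbol n)$, the index $i$ of $\lambda(\boldsymbol n(i))$ is read modulo $3$, and so are the indices of $n_i$ and $m_i$. **The equation.** Let $a_0,\dots,a_6$ satisfy $a_0a_1a_2^2a_3^3a_4^2a_5a_6^2=q$, put $c_x=(a_1a_2^2a_4^{-2}a_5^{-1})^{1/3}$, $c_y=(a_5a_4^2a_6^{-2}a_0^{-1})^{1/3}$, $c_z=(a_0a_6^2a_2^{-2}a_1^{-1})^{1/3}$, and let $(C_{ij})$ be the Cartan matrix of type $E_6^{(1)}$ with Dynkin edges $1{-}2,\,2{-}3,\,3{-}4,\,4{-}5,\,3{-}6,\,6{-}0$. The automorphisms $s_0,\dots,s_6$ of $\mathbb C(a_0^{1/3},\dots,a_6^{1/3};f,g)$ are given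 by $s_i(a_j^{1/3})=a_j^{1/3}a_i^{-C_{ij}/3}$, $s_i(f)=f$, $s_i(g)=g$ for $i\ne3$, and $$s_3(f)=f\,\frac{c_xf+a_3^{-1}c_yg+a_3c_z}{a_3^{-1}c_xf+a_3c_yg+c_z},\qquad s_3(g)=g\,\frac{a_3c_xf+c_yg+a_3^{-1}c_z}{a_3^{-1}c_xf+a_3c_yg+c_z}.$$ Let $\ell=(s_2s_4s_6s_0s_1s_5s_3s_2s_4s_6s_3)^2$, where in a product the left factor is applied first; then $\ell(\boldsymbol a)=\overline{\boldsymbol a}=(a_0,a_1,q^{-1}a_2,q^2a_3,q^{-1}a_4,a_5,q^{-1}a_6)$. Put $F(\boldsymbol a;f,g)=\ell(f)$ and $G(\boldsymbol a;f,g)=\ell(g)$. The $q$-Painlevé equation of type $E_6^{(1)}$ is the system $f(\overline{\boldsymbol a})=F(\boldsymbol a;f(\boldsymbol a),g(\boldsymbol a))$, $g(\overline{\boldsymbol a})=G(\boldsymbol a;f(\boldsymbol a),g(\boldsymbol a))$. **Theorem.** For $\boldsymbol m,\boldsymbol n\in\mathbb Z^3$ and $i\in\mathbb Z/3\mathbb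 Z$ let $$\begin{aligned}U_i(a,b)&=R_{[\lambda(\boldsymbol m(i)),\,\lambda(\boldsymbol n(-i))]}(a,b),\\ V_i(a,b)&=R_{[\lambda(\boldsymbol m(i+1)),\,\lambda(\boldsymbol n(-i+1))]}(q^{1/3}a,q^{-2/3}b),\\ W_i(a,b)&=R_{[\lambda(\boldsymbol m(i+2)),\,\lambda(\boldsymbol n(-i+2))]}(q^{-1/3}a,q^{-1/3}b).\end{aligned}$$ (i) For all $i\in\mathbb Z/3\mathbb Z$ and $a,b\in\mathbb C^\times$, with $\ell_1(a,b)=(a,q^{-1}b)$, $\ell_2(a,b)=(q^{-1}a,qb)$, $\ell_3(a,b)=(qa,b)$ acting on functions of $(a,b)$, $$\begin{aligned}ab\,U_i\,\ell_1(U_{i+1})-\tfrac qb\,\ell_1(U_i)\,U_{i+1}&=\gamma_i\bigl(ab-\tfrac qb\bigr)V_{i+2}W_{i+2},\\ \tfrac1b\,V_i\,\ell_2(V_{i+1})-\tfrac1a\,\ell_2(V_i)\,V_{i+1}&=\delta_i\bigl(\tfrac1b-\tfrac1a\bigr)W_{i+2}U_{i+2},\\ \tfrac1a\,W_i\,\ell_3(W_{i+1})-ab\,\ell_3(W_i)\,W_{i+1}&=\epsilon_i\bigl(\tfrac1a-ab\bigr)U_{i+2}V_{i+2},\end{aligned}$$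 where $\gamma_i=q^{n_{-i}-m_{i+1}+(|\boldsymbol m|-|\boldsymbol n|)/3}$, $\delta_i=q^{n_{-i+1}-m_{i+2}+(|\boldsymbol m|-|\boldsymbol n|)/3}$, $\epsilon_i=q^{n_{-i+2}-m_i+(|\boldsymbol m|-|\boldsymbol n|)/3}$. (ii) The pair $f=\dfrac{U_1V_1W_1}{U_3V_3W_3}$, $g=\dfrac{U_2V_2W_2}{U_3V_3W_3}$ consists of well-defined rational functions of $(a,b)$ and is an (algebraic) solution of the $q$-Painlevé equation of type $E_6^{(1)}$ when $$\begin{gathered}a_1=aq^{\frac{|\boldsymbol m|+|\boldsymbol n|}3-m_1-n_3},\quad a_5=aq^{\frac{|\boldsymbol m|+|\boldsymbol n|}3-m_2-n_2},\quad a_0=aq^{\frac{|\boldsymbol m|+|\boldsymbol n|}3-m_3-n_1},\\ a_2=bq^{\frac{|\boldsymbol m|+|\boldsymbol n|-1}3-m_3-n_2},\quad a_4=bq^{\frac{|\boldsymbol m|+|\boldsymbol n|-1}3-m_1-n_1},\quad a_6=bq^{\frac{|\boldsymbol m|+|\boldsymbol n|-1}3-m_2-n_3},\end{gathered}$$ and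 $a_3=q/(ab^2)$, the cube roots $a_i^{1/3}$ being formed by taking arbitrary cube roots of $a$ and $b$ together with the fixed powers of $q^{1/9}$. That is, $\overline{\boldsymbol a}$ corresponds to $(a,q^{-1}b)$, and for all $(a,b)\in(\mathbb C^\times)^2$ outside the zero set of some nonzero polynomial, $U_3V_3W_3$ is nonzero at $(a,b)$ and at $(a,q^{-1}b)$, the rational functions $F$ and $G$ are regular at $(\boldsymbol a;f(a,b),g(a,b))$, and their values there are $f(a,q^{-1}b)$ and $g(a,q^{-1}b)$. -/

import Mathlib

/-! ### Universal characters -/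

namespace QPE6

/-- The elementary Schur polynomial `p_k(x)`, `k ∈ ℤ`, evaluated at a sequence `x = (x₁, x₂, …)`
(the value `x 0` plays no role): the coefficient of `z ^ k` in `exp (∑_{n ≥ 1} x_n z ^ n)`. -/
noncomputable def schurP (x : ℕ → ℂ) (k : ℤ) : ℂ :=
  if 0 ≤ k then
    PowerSeries.coeff k.toNat
      ((PowerSeries.exp ℂ).subst (PowerSeries.mk fun n => if n = 0 then 0 else x n))
  else 0

/-- The universal character `S_{[lam, mu]}(x, y)` of a pair of integer sequences, by the twisted
Jacobi–Trudi formula. Rows, columns and entries of the sequences are numbered from `0`, so the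
`i`-th row is `p_{mu_{l' - 1 - i} + i - j}(y)` for `i < l'` and `p_{lam_{i - l'} - i + j}(x)` for
`l' ≤ i < l' + l`. -/
noncomputable def universalCharacter (lam mu : List ℤ) (x y : ℕ → ℂ) : ℂ :=
  Matrix.det (Matrix.of fun i j : Fin (mu.length + lam.length) =>
    if (i : ℕ) < mu.length then
      schurP y (mu.getD (mu.length - 1 - i) 0 + (i : ℤ) - (j : ℤ))
    else
      schurP x (lam.getD (i - mu.length) 0 - (i : ℤ) + (j : ℤ)))

/-- `R_{[lam, mu]}(a, b)`: the universal character under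
`x_n = (a⁻ⁿ + b⁻ⁿ + (ab)ⁿ) / (n (1 - qⁿ))`, `y_n = (aⁿ + bⁿ + (ab)⁻ⁿ) / (n (1 - q⁻ⁿ))`. -/
noncomputable def R (q : ℂ) (lam mu : List ℤ) (a b : ℂ) : ℂ :=
  universalCharacter lam mu
    (fun n => ((a ^ n)⁻¹ + (b ^ n)⁻¹ + (a * b) ^ n) / (n * (1 - q ^ n)))
    (fun n => (a ^ n + b ^ n + ((a * b) ^ n)⁻¹) / (n * (1 - (q ^ n)⁻¹)))

/-! ### Maya diagrams and 3-core partitions -/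

/-- A Maya diagram: a set of integers containing all `x ≪ 0` and no `x ≫ 0`. -/
def IsMaya (M : Set ℤ) : Prop :=
  (∃ c, ∀ x ≤ c, x ∈ M) ∧ ∃ d, ∀ x, d ≤ x → x ∉ M

theorem IsMaya.finite_beads {M : Set ℤ} (h : IsMaya M) :
    {x | x ∈ M ∧ ∃ y < x, y ∉ M}.Finite := by
  obtain ⟨⟨c, hc⟩, d, hd⟩ := h
  refine (Set.finite_Icc c d).subset ?_
  rintro x ⟨hx, y, hy, hyM⟩
  have h1 : c < y := by
    by_contra hcon
    exact hyM (hc y (by omega))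
  have h2 : x < d := by
    by_contra hcon
    exact hd x (by omega) hx
  exact ⟨by omega, by omega⟩

/-- The partition of a Maya diagram `M = {m₁ > m₂ > …}`, as the decreasing list of its nonzero
parts. The part that belongs to `m_i ∈ M` is the number of integers below `m_i` missing from `M`;
this is the partition with `m_i - m_{i+1} = lam_i - lam_{i+1} + 1`. -/
noncomputable def IsMaya.partition {M : Set ℤ} (h : IsMaya M) : List ℤ :=
  (h.finite_beads.toFinset.sort (· ≥ ·)).map fun x => (({y | y < x ∧ y ∉ M}.ncard : ℕ) : ℤ)

/-- The Maya diagram `M(n) = (3ℤ_{<n₁} + 1) ∪ (3ℤ_{<n₂} + 2) ∪ (3ℤ_{<n₃} + 3)`. The triple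
`n = (n₁, n₂, n₃)` is indexed by `ℤ/3ℤ`. -/
def maya (n : ZMod 3 → ℤ) : Set ℤ :=
  {x | (∃ k < n 1, x = 3 * k + 1) ∨ (∃ k < n 2, x = 3 * k + 2) ∨ (∃ k < n 3, x = 3 * k + 3)}

theorem isMaya_maya (n : ZMod 3 → ℤ) : IsMaya (maya n) := by
  constructor
  · refine ⟨3 * min (n 1) (min (n 2) (n 3)), fun x hx => ?_⟩
    have h1 : min (n 1) (min (n 2) (n 3)) ≤ n 1 := min_le_left _ _
    have h2 : min (n 1) (min (n 2) (n 3)) ≤ n 2 := (min_le_right _ _).trans (min_le_left _ _)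
    have h3 : min (n 1) (min (n 2) (n 3)) ≤ n 3 := (min_le_right _ _).trans (min_le_right _ _)
    have h : x % 3 = 1 ∨ x % 3 = 2 ∨ x % 3 = 0 := by omega
    rcases h with h | h | h
    · exact Or.inl ⟨x / 3, by omega, by omega⟩
    · exact Or.inr (Or.inl ⟨x / 3, by omega, by omega⟩)
    · exact Or.inr (Or.inr ⟨x / 3 - 1, by omega, by omega⟩)
  · refine ⟨3 * max (n 1) (max (n 2) (n 3)) + 1, fun x hx hxM => ?_⟩
    have h1 : n 1 ≤ max (n 1) (max (n 2) (n 3)) := le_max_left _ _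
    have h2 : n 2 ≤ max (n 1) (max (n 2) (n 3)) := (le_max_left _ _).trans (le_max_right _ _)
    have h3 : n 3 ≤ max (n 1) (max (n 2) (n 3)) := (le_max_right _ _).trans (le_max_right _ _)
    rcases hxM with ⟨k, hk, rfl⟩ | ⟨k, hk, rfl⟩ | ⟨k, hk, rfl⟩ <;> omega

/-- The 3-core partition `λ(n)`. -/
noncomputable def core (n : ZMod 3 → ℤ) : List ℤ := (isMaya_maya n).partition

/-- `n(i)`: the first `i` entries of `(n₁, n₂, n₃)` are raised by one. As `λ(n + (1,1,1)) = λ(n)`,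
the index `i` is taken in `ℤ/3ℤ`, with representatives `0, 1, 2`. -/
def raise (n : ZMod 3 → ℤ) (i : ZMod 3) : ZMod 3 → ℤ := fun j =>
  n j + if (j = 1 ∧ 1 ≤ i.val) ∨ (j = 2 ∧ 2 ≤ i.val) then 1 else 0

/-- `|n| = n₁ + n₂ + n₃`. -/
def size (n : ZMod 3 → ℤ) : ℤ := n 1 + n 2 + n 3

/-! ### The functions of the theorem; `r` stands for `q^{1/3}` -/

/-- `U_i(a, b)`. -/
noncomputable def U (q : ℂ) (m n : ZMod 3 → ℤ) (i : ZMod 3) (a b : ℂ) : ℂ :=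
  R q (core (raise m i)) (core (raise n (-i))) a b

/-- `V_i(a, b)`. -/
noncomputable def V (q r : ℂ) (m n : ZMod 3 → ℤ) (i : ZMod 3) (a b : ℂ) : ℂ :=
  R q (core (raise m (i + 1))) (core (raise n (-i + 1))) (r * a) (r ^ (-2 : ℤ) * b)

/-- `W_i(a, b)`. -/
noncomputable def W (q r : ℂ) (m n : ZMod 3 → ℤ) (i : ZMod 3) (a b : ℂ) : ℂ :=
  R q (core (raise m (i + 2))) (core (raise n (-i + 2))) (r⁻¹ * a) (r⁻¹ * b)

/-- `U_i V_i W_i`. -/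
noncomputable def UVW (q r : ℂ) (m n : ZMod 3 → ℤ) (i : ZMod 3) (a b : ℂ) : ℂ :=
  U q m n i a b * V q r m n i a b * W q r m n i a b

/-- `f = U₁V₁W₁ / (U₃V₃W₃)`. -/
noncomputable def fSol (q r : ℂ) (m n : ZMod 3 → ℤ) (a b : ℂ) : ℂ :=
  UVW q r m n 1 a b / UVW q r m n 3 a b

/-- `g = U₂V₂W₂ / (U₃V₃W₃)`. -/
noncomputable def gSol (q r : ℂ) (m n : ZMod 3 → ℤ) (a b : ℂ) : ℂ :=
  UVW q r m n 2 a b / UVW q r m n 3 a b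

/-- The bilinear form of the `q`-Painlevé equation of type `E₆⁽¹⁾` for functions
`U_i, V_i, W_i` of `(a, b) ∈ (ℂ^×)²`, where the translations act by `ℓ₁(a, b) = (a, q⁻¹ b)`,
`ℓ₂(a, b) = (q⁻¹ a, q b)`, `ℓ₃(a, b) = (q a, b)`. -/
def SolvesBilinear (q : ℂ) (γ δ ε : ZMod 3 → ℂ) (U V W : ZMod 3 → ℂ → ℂ → ℂ) : Prop :=
  ∀ (i : ZMod 3) (a b : ℂ), a ≠ 0 → b ≠ 0 →
    (a * b * U i a b * U (i + 1) a (q⁻¹ * b) - q / b * U i a (q⁻¹ * b) * U (i + 1) a b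
      = γ i * (a * b - q / b) * V (i + 2) a b * W (i + 2) a b) ∧
    (1 / b * V i a b * V (i + 1) (q⁻¹ * a) (q * b) - 1 / a * V i (q⁻¹ * a) (q * b) * V (i + 1) a b
      = δ i * (1 / b - 1 / a) * W (i + 2) a b * U (i + 2) a b) ∧
    (1 / a * W i a b * W (i + 1) (q * a) b - a * b * W i (q * a) b * W (i + 1) a b
      = ε i * (1 / a - a * b) * U (i + 2) a b * V (i + 2) a b)

/-! ### The birational action of the affine Weyl group of type `E₆⁽¹⁾` -/

/-- The Cartan matrix of type `E₆⁽¹⁾`: the Dynkin diagram has the edges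
`1–2, 2–3, 3–4, 4–5, 3–6, 6–0`. -/
def cartan : Matrix (Fin 7) (Fin 7) ℤ :=
  !![ 2,  0,  0,  0,  0,  0, -1;
      0,  2, -1,  0,  0,  0,  0;
      0, -1,  2, -1,  0,  0,  0;
      0,  0, -1,  2, -1,  0, -1;
      0,  0,  0, -1,  2, -1,  0;
      0,  0,  0,  0, -1,  2,  0;
     -1,  0,  0, -1,  0,  0,  2]

/-- Values of the cube roots `α_i = a_i^{1/3}` (`0 ≤ i ≤ 6`) and of `f`, `g`. -/
structure Point (k : Type*) where
  /-- the cube roots of the root variables -/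
  α : Fin 7 → k
  /-- the coordinate `f` -/
  f : k
  /-- the coordinate `g` -/
  g : k

section Action

variable {k : Type*} [Field k]

/-- `c_x = a₁^{1/3} a₂^{2/3} a₄^{-2/3} a₅^{-1/3}`. -/
def cx (α : Fin 7 → k) : k := α 1 * α 2 ^ 2 / (α 4 ^ 2 * α 5)

/-- `c_y = a₅^{1/3} a₄^{2/3} a₆^{-2/3} a₀^{-1/3}`. -/
def cy (α : Fin 7 → k) : k := α 5 * α 4 ^ 2 / (α 6 ^ 2 * α 0)

/-- `c_z = a₀^{1/3} a₆^{2/3} a₂^{-2/3} a₁^{-1/3}`. -/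
def cz (α : Fin 7 → k) : k := α 0 * α 6 ^ 2 / (α 2 ^ 2 * α 1)

/-- The formulas for `s_i(a^{1/3})`, `s_i(f)`, `s_i(g)`, evaluated at a point: one has
`s_i(a_j) = a_j a_i^{-C_{ij}}`, and `f`, `g` are fixed by `s_i` for `i ≠ 3`. -/
def simpleReflection (i : Fin 7) (p : Point k) : Point k where
  α := fun j => p.α j * p.α i ^ (-(cartan i j))
  f := if i = 3 then
      p.f * (cx p.α * p.f + (p.α 3 ^ 3)⁻¹ * cy p.α * p.g + p.α 3 ^ 3 * cz p.α)
        / ((p.α 3 ^ 3)⁻¹ * cx p.α * p.f + p.α 3 ^ 3 * cy p.α * p.g + cz p.α)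
    else p.f
  g := if i = 3 then
      p.g * (p.α 3 ^ 3 * cx p.α * p.f + cy p.α * p.g + (p.α 3 ^ 3)⁻¹ * cz p.α)
        / ((p.α 3 ^ 3)⁻¹ * cx p.α * p.f + p.α 3 ^ 3 * cy p.α * p.g + cz p.α)
    else p.g

/-- The word of the translation `ℓ = (s₂ s₄ s₆ s₀ s₁ s₅ s₃ s₂ s₄ s₆ s₃)²`. -/
def ellWord : List (Fin 7) :=
  [2, 4, 6, 0, 1, 5, 3, 2, 4, 6, 3, 2, 4, 6, 0, 1, 5, 3, 2, 4, 6, 3]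

/-- The formulas for `ℓ(a^{1/3})`, `ℓ(f)`, `ℓ(g)`, evaluated at a point. In a product
`s_{i₁} s_{i₂} ⋯` of automorphisms of the function field the left factor is applied first; this is
the convention for which `ℓ(a) = (a₀, a₁, q⁻¹a₂, q²a₃, q⁻¹a₄, a₅, q⁻¹a₆)`. An expression `E(p)` is
sent by `s_i` to `E(s_i(p))`, hence `s_{i₁} ⋯ s_{i_N}` sends `E(p)` to
`E(s_{i₁}(s_{i₂}(⋯ s_{i_N}(p))))`. -/
def ell (p : Point k) : Point k := ellWord.foldr simpleReflection p

end Action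

/-- Polynomials over `ℂ` in `a₀^{1/3}, …, a₆^{1/3}` and `f, g`. -/
abbrev Poly : Type := MvPolynomial (Fin 7 ⊕ Fin 2) ℂ

/-- The field `ℂ(a^{1/3}; f, g)` of rational functions. -/
abbrev RatFun : Type := FractionRing Poly

/-- The generic point, whose coordinates are the indeterminates. -/
noncomputable def genericPoint : Point RatFun where
  α := fun i => algebraMap Poly RatFun (MvPolynomial.X (Sum.inl i))
  f := algebraMap Poly RatFun (MvPolynomial.X (Sum.inr 0))
  g := algebraMap Poly RatFun (MvPolynomial.X (Sum.inr 1))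

/-- The rational function `F(a; f, g) = ℓ(f)`. -/
noncomputable def F : RatFun := (ell genericPoint).f

/-- The rational function `G(a; f, g) = ℓ(g)`. -/
noncomputable def G : RatFun := (ell genericPoint).g

/-- Value of a polynomial at a complex point. -/
noncomputable def evalAt (p : Point ℂ) (P : Poly) : ℂ :=
  MvPolynomial.eval (Sum.elim p.α ![p.f, p.g]) P

/-- The rational function `E` is regular at the point `p` and its value there is `v`. -/
def HasValueAt (E : RatFun) (p : Point ℂ) (v : ℂ) : Prop :=
  ∃ P Q : Poly, evalAt p Q ≠ 0 ∧ E * algebraMap Poly RatFun Q = algebraMap Poly RatFun P ∧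
    v = evalAt p P / evalAt p Q

/-- The cube roots of `ℓ(a) = (a₀, a₁, q⁻¹a₂, q²a₃, q⁻¹a₄, a₅, q⁻¹a₆)`, where `r = q^{1/3}`. -/
noncomputable def qShift (r : ℂ) (α : Fin 7 → ℂ) : Fin 7 → ℂ :=
  ![α 0, α 1, r⁻¹ * α 2, r ^ 2 * α 3, r⁻¹ * α 4, α 5, r⁻¹ * α 6]

/-- The `q`-Painlevé equation of type `E₆⁽¹⁾`, `f(ℓ(a)) = F(a; f(a), g(a))` and
`g(ℓ(a)) = G(a; f(a), g(a))`, at one point of a parametrized family of root variables. The family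
is `t ↦ α(t) = a(t)^{1/3}`, and `t'` is the parameter value that corresponds to `ℓ(a(t))`. The root
variables have to satisfy `a₀ a₁ a₂² a₃³ a₄² a₅ a₆² = q`, which is imposed on cube roots. -/
def SolvesQPE6At {T : Type*} (r : ℂ) (α : T → Fin 7 → ℂ) (f g : T → ℂ) (t t' : T) : Prop :=
  α t 0 * α t 1 * α t 2 ^ 2 * α t 3 ^ 3 * α t 4 ^ 2 * α t 5 * α t 6 ^ 2 = r ∧
  α t' = qShift r (α t) ∧
  HasValueAt F ⟨α t, f t, g t⟩ (f t') ∧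
  HasValueAt G ⟨α t, f t, g t⟩ (g t')

/-- The specialization of `(a₀, …, a₆)`, written with `r = q^{1/3}`:
`a₁ = a q^{(|m|+|n|)/3 - m₁ - n₃}`, `a₅ = a q^{(|m|+|n|)/3 - m₂ - n₂}`,
`a₀ = a q^{(|m|+|n|)/3 - m₃ - n₁}`, `a₂ = b q^{(|m|+|n|-1)/3 - m₃ - n₂}`,
`a₄ = b q^{(|m|+|n|-1)/3 - m₁ - n₁}`, `a₆ = b q^{(|m|+|n|-1)/3 - m₂ - n₃}`, and
`a₃ = q / (a b²)`. -/
noncomputable def specialize (m n : ZMod 3 → ℤ) (r a b : ℂ) : Fin 7 → ℂ :=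
  ![a * r ^ (size m + size n - 3 * m 3 - 3 * n 1),
    a * r ^ (size m + size n - 3 * m 1 - 3 * n 3),
    b * r ^ (size m + size n - 1 - 3 * m 3 - 3 * n 2),
    r ^ 3 / (a * b ^ 2),
    b * r ^ (size m + size n - 1 - 3 * m 1 - 3 * n 1),
    a * r ^ (size m + size n - 3 * m 2 - 3 * n 2),
    b * r ^ (size m + size n - 1 - 3 * m 2 - 3 * n 3)]

/-- A consistent choice of the cube roots `a_i^{1/3}` of the specialized root variables is obtained
by replacing `q^{1/3}, a, b` with cube roots `s, A, B` of them. -/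
theorem specialize_cube (m n : ZMod 3 → ℤ) (s A B : ℂ) (i : Fin 7) :
    specialize m n s A B i ^ 3 = specialize m n (s ^ 3) (A ^ 3) (B ^ 3) i := by
  have key : ∀ e : ℤ, (s ^ e) ^ 3 = (s ^ 3) ^ e := fun e => by
    rw [← zpow_natCast, ← zpow_mul, mul_comm, zpow_mul, zpow_natCast]
  fin_cases i <;> simp [specialize, mul_pow, div_pow, key] <;> ring

end QPE6

namespace QPE6

/-! ### Elementary Schur polynomials -/

/-! The bilinear equations are instances of one three-term Plücker relation. Replacing `u_j` by `q
u_j` in `x_n = ∑ u_j ^ n / (n (1 - q ^ n))`, and correspondingly in `y_n`, multiplies the generating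
series of `p_k(x)` by `1 - u_j z` and that of `p_k(y)` by `1 - u_j⁻¹ z`. On the rows of the twisted
Jacobi–Trudi determinant both effects are, up to scalars, the same column operation, namely the one
that eliminates an extra row `1, u_j, u_j², …`. So a universal character with one or two shifted
arguments is a determinant with one or two rows of powers adjoined (`tau_shiftBy`,
`tau_shiftBy_shiftBy`). Passing from `n(i)` to `n(i+1)` adds one bead to a Maya diagram, hence one
more row. The Plücker relation for two rows of powers and two bead rows is `tau_bilinear`. The
shifts violate the constraint that the product of the `u_j` is `1`; a rescaling by `q^{1/3}`
restores it, and by homogeneity this produces the powers of `q` in the coefficients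
(`qUC_bilinear`).

For the `q`-Painlevé equation, only `s₃` moves `f` and `g`. When `f`, `g` are ratios of products of
three families of tau functions, three bilinear equations of one family make the numerators and the
denominator of `s₃` factor, and `s₃` merely replaces that family by its translate
(`simpleReflection_three_ratio`). The word of `ℓ` contains `s₃` four times: these translate `U`,
`V`, `W` and again `V`, the last family travelling through `(q⁻¹ a, b)`. This requires three
bilinear equations beyond those of the theorem. The root variables stay monomials, so the hypotheses
at each stage are linear identities between exponents.

All of this needs nonvanishing tau functions. They are Laurent polynomials in `a`, `b`, and none is
identically zero: on the curve `ab = 1` a suitable rescaling has a limit that is a product of two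
Vandermonde-type determinants (`exists_tau_ne_zero`). -/

theorem schurP_of_neg (x : ℕ → ℂ) {k : ℤ} (hk : k < 0) : schurP x k = 0 := by
  simp [schurP, not_le.mpr hk]

theorem hasSubst_schur (x : ℕ → ℂ) :
    PowerSeries.HasSubst (PowerSeries.mk fun n => if n = 0 then 0 else x n) :=
  PowerSeries.HasSubst.of_constantCoeff_zero' (by simp)

theorem schurP_zero (x : ℕ → ℂ) : schurP x 0 = 1 := by
  simp only [schurP, le_refl, if_true, Int.toNat_zero]
  rw [PowerSeries.coeff_subst' (hasSubst_schur x)]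
  rw [finsum_eq_single _ 0]
  · simp
  · intro n hn
    simp [hn]

/-- Coefficient comparison in `P' = (∑ n x_n z ^ (n-1)) P` for the generating series `P`. With `p₀ =
1` this recurrence determines the `p_k`; the identities, the continuity and the Laurent property
below are all derived from it. -/
theorem schurP_succ (x : ℕ → ℂ) (k : ℕ) :
    ((k : ℂ) + 1) * schurP x ((k : ℤ) + 1) =
      ∑ ij ∈ Finset.HasAntidiagonal.antidiagonal k, schurP x ij.1 * (x (ij.2 + 1) * ((ij.2 : ℂ) + 1)) := by
  have h := congrArg (PowerSeries.coeff k)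
    (PowerSeries.derivative_subst (f := PowerSeries.exp ℂ) (hasSubst_schur x))
  rw [PowerSeries.derivative_exp, PowerSeries.coeff_derivative, PowerSeries.coeff_mul] at h
  have h0 : ∀ j : ℕ, schurP x j = PowerSeries.coeff j
      ((PowerSeries.exp ℂ).subst (PowerSeries.mk fun n => if n = 0 then 0 else x n)) := by
    intro j
    simp [schurP]
  have h1 := h0 (k + 1)
  push_cast at h1
  rw [h1, mul_comm, h]
  refine Finset.sum_congr rfl fun ij _ => ?_
  rw [h0, PowerSeries.coeff_derivative]
  simp

/-- The recurrence determines the elementary Schur polynomials. -/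
theorem schurP_unique (x : ℕ → ℂ) (P : ℕ → ℂ) (h0 : P 0 = 1)
    (hP : ∀ k : ℕ, ((k : ℂ) + 1) * P (k + 1) =
      ∑ ij ∈ Finset.HasAntidiagonal.antidiagonal k, P ij.1 * (x (ij.2 + 1) * ((ij.2 : ℂ) + 1))) (k : ℕ) :
    schurP x k = P k := by
  induction k using Nat.strong_induction_on with
  | _ k ih =>
    cases k with
    | zero => simpa [h0] using schurP_zero x
    | succ k =>
      have hk : ((k : ℂ) + 1) ≠ 0 := by exact_mod_cast Nat.succ_ne_zero k
      apply mul_left_cancel₀ hk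
      rw [hP k]
      push_cast
      rw [schurP_succ x k]
      refine Finset.sum_congr rfl fun ij hij => ?_
      rw [ih ij.1 (Nat.lt_succ_of_le (Finset.HasAntidiagonal.antidiagonal.fst_le hij))]

theorem schurP_congr {x y : ℕ → ℂ} (h : ∀ n, n ≠ 0 → x n = y n) : schurP x = schurP y := by
  unfold schurP
  have : (PowerSeries.mk fun n => if n = 0 then 0 else x n)
      = (PowerSeries.mk fun n => if n = 0 then 0 else y n) := by
    ext n
    by_cases hn : n = 0 <;> simp [hn, h]
  rw [this]

/-- Homogeneity. -/
theorem schurP_rescale (x : ℕ → ℂ) (c : ℂ) (k : ℤ) :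
    schurP (fun n => c ^ n * x n) k = c ^ k * schurP x k := by
  rcases lt_or_ge k 0 with hk | hk
  · simp [schurP_of_neg _ hk]
  lift k to ℕ using hk
  rw [zpow_natCast]
  refine schurP_unique _ (fun k => c ^ k * schurP x k) (by simpa using schurP_zero x) (fun k => ?_) k
  have := schurP_succ x k
  push_cast
  rw [mul_left_comm, this, Finset.mul_sum]
  refine Finset.sum_congr rfl fun ij hij => ?_
  rw [← Finset.HasAntidiagonal.mem_antidiagonal.mp hij]
  ring

/-- Multiplication of the generating series by `1 - u z`. -/
theorem schurP_sub_geom (x : ℕ → ℂ) (u : ℂ) (k : ℤ) :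
    schurP (fun n => x n - u ^ n / n) k = schurP x k - u * schurP x (k - 1) := by
  rcases lt_or_ge k 0 with hk | hk
  · rw [schurP_of_neg _ hk, schurP_of_neg _ hk, schurP_of_neg _ (by omega)]
    simp
  lift k to ℕ using hk
  -- Coefficientwise form of `(1 - u z) P · (1 - u z)⁻¹ = P`, with the geometric series for the
  -- inverse.
  have key : ∀ k : ℕ, ∑ ij ∈ Finset.HasAntidiagonal.antidiagonal k,
      (schurP x ij.1 - u * schurP x ((ij.1 : ℤ) - 1)) * u ^ ij.2 = schurP x k := by
    intro k
    induction k with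
    | zero => simp [schurP_of_neg x (show (-1 : ℤ) < 0 by norm_num)]
    | succ k ih =>
      rw [Finset.Nat.sum_antidiagonal_succ']
      have : ∑ p ∈ Finset.HasAntidiagonal.antidiagonal k,
          (schurP x p.1 - u * schurP x ((p.1 : ℤ) - 1)) * u ^ (p.2 + 1) = u * schurP x k := by
        rw [← ih, Finset.mul_sum]
        exact Finset.sum_congr rfl fun _ _ => by ring
      rw [this]
      push_cast
      simp
  refine schurP_unique _ (fun k => schurP x k - u * schurP x ((k : ℤ) - 1)) ?_ (fun k => ?_) k
  · simp [schurP_zero, schurP_of_neg x (show (-1 : ℤ) < 0 by norm_num)]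
  have e1 : ∀ ij : ℕ × ℕ, ((x (ij.2 + 1) - u ^ (ij.2 + 1) / ((ij.2 + 1 : ℕ) : ℂ)) * ((ij.2 : ℂ) + 1))
      = x (ij.2 + 1) * ((ij.2 : ℂ) + 1) - u * u ^ ij.2 := by
    intro ij
    have : ((ij.2 : ℂ) + 1) ≠ 0 := by exact_mod_cast Nat.succ_ne_zero ij.2
    push_cast
    field_simp
    ring
  simp only [e1, mul_sub, Finset.sum_sub_distrib]
  have e2 : ∑ ij ∈ Finset.HasAntidiagonal.antidiagonal k,
      (schurP x ij.1 - u * schurP x ((ij.1 : ℤ) - 1)) * (u * u ^ ij.2) = u * schurP x k := by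
    rw [← key k, Finset.mul_sum]
    exact Finset.sum_congr rfl fun _ _ => by ring
  rw [e2]
  simp only [sub_mul, Finset.sum_sub_distrib]
  rw [← schurP_succ x k]
  -- The index shift by one turns this sum into the recurrence one degree lower.
  have e3 : ∑ ij ∈ Finset.HasAntidiagonal.antidiagonal k,
      u * schurP x ((ij.1 : ℤ) - 1) * (x (ij.2 + 1) * ((ij.2 : ℂ) + 1)) = u * (k * schurP x k) := by
    cases k with
    | zero => simp [schurP_of_neg x (show (-1 : ℤ) < 0 by norm_num)]
    | succ k =>
      rw [Finset.Nat.sum_antidiagonal_succ]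
      push_cast
      rw [schurP_succ x k, Finset.mul_sum]
      simp [schurP_of_neg x (show (-1 : ℤ) < 0 by norm_num), mul_assoc]
  rw [e3]
  push_cast
  simp
  ring

/-! ### Determinants of lists of rows -/

/-- The determinant of the `N × N` matrix whose rows are the entries of a list, each row being
restricted to its first `N` coordinates. -/
noncomputable def rowDet (N : ℕ) (L : List (ℕ → ℂ)) : ℂ :=
  Matrix.det (Matrix.of fun i j : Fin N => L.getD i 0 j)

theorem rowDet_swap {N : ℕ} (A : List (ℕ → ℂ)) (x y : ℕ → ℂ) (C : List (ℕ → ℂ))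
    (hN : A.length + 1 < N) : rowDet N (A ++ x :: y :: C) = -rowDet N (A ++ y :: x :: C) := by
  unfold rowDet
  set p : Fin N := ⟨A.length, by omega⟩ with hp
  set p' : Fin N := ⟨A.length + 1, hN⟩ with hp'
  have hne : p ≠ p' := by
    intro h
    simp [hp, hp'] at h
  have key := Matrix.det_permute (Equiv.swap p p')
    (Matrix.of fun i j : Fin N => (A ++ y :: x :: C).getD i 0 j)
  rw [Equiv.Perm.sign_swap hne] at key
  simp only [Units.val_neg, Units.val_one, Int.cast_neg, Int.cast_one, neg_mul, one_mul] at key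
  rw [← key]
  congr 1
  ext i j
  simp only [Matrix.of_apply, Matrix.submatrix_apply, id]
  by_cases h1 : i = p
  · subst h1
    rw [Equiv.swap_apply_left]
    simp [hp, hp', List.getD_eq_getElem?_getD]
  by_cases h2 : i = p'
  · subst h2
    rw [Equiv.swap_apply_right]
    simp [hp, hp', List.getD_eq_getElem?_getD]
  rw [Equiv.swap_apply_of_ne_of_ne h1 h2]
  have h1' : (i : ℕ) ≠ A.length := fun h => h1 (Fin.ext h)
  have h2' : (i : ℕ) ≠ A.length + 1 := fun h => h2 (Fin.ext h)
  simp only [List.getD_eq_getElem?_getD, List.getElem?_append]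
  split_ifs with h
  · rfl
  · obtain ⟨k, hk⟩ : ∃ k, (i : ℕ) - A.length = k + 2 := ⟨(i : ℕ) - A.length - 2, by omega⟩
    rw [hk]
    simp

theorem rowDet_move {N : ℕ} (A : List (ℕ → ℂ)) (x : ℕ → ℂ) (B C : List (ℕ → ℂ))
    (hN : A.length + B.length < N) :
    rowDet N (A ++ B ++ x :: C) = (-1) ^ B.length * rowDet N (A ++ x :: (B ++ C)) := by
  induction B generalizing A with
  | nil => simp
  | cons y B ih =>
    have h := ih (A ++ [y]) (by simp at hN ⊢; omega)
    simp only [List.append_assoc, List.cons_append, List.nil_append] at h ⊢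
    rw [h, rowDet_swap A y x _ (by simp at hN; omega)]
    simp [pow_succ]

/-- The cofactors do not involve `v`, so the determinant is a linear functional of its first row. -/
theorem rowDet_cons (N : ℕ) (v : ℕ → ℂ) (L : List (ℕ → ℂ)) :
    rowDet (N + 1) (v :: L) = ∑ j : Fin (N + 1), v j * ((-1) ^ (j : ℕ) *
      Matrix.det (Matrix.of fun a b : Fin N => L.getD a 0 (j.succAbove b))) := by
  unfold rowDet
  rw [Matrix.det_succ_row_zero]
  refine Finset.sum_congr rfl fun j _ => ?_
  simp only [Matrix.of_apply, Fin.val_zero, List.getD_cons_zero]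
  rw [mul_comm ((-1 : ℂ) ^ (j : ℕ)), mul_assoc]
  congr 2

theorem rowDet_eq_zero {N : ℕ} (L : List (ℕ → ℂ)) {i j : Fin N} (hij : i ≠ j)
    (h : L.getD i 0 = L.getD j 0) : rowDet N L = 0 :=
  Matrix.det_zero_of_row_eq hij (by ext k; simp only [Matrix.of_apply, h])

/-- The three-term Plücker relation. -/
theorem rowDet_plucker (N : ℕ) (x₁ x₂ x₃ x₄ : ℕ → ℂ) (Z : List (ℕ → ℂ)) :
    rowDet (N + 2) (x₁ :: x₄ :: Z) * rowDet (N + 2) (x₂ :: x₃ :: Z)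
      - rowDet (N + 2) (x₂ :: x₄ :: Z) * rowDet (N + 2) (x₁ :: x₃ :: Z)
      + rowDet (N + 2) (x₃ :: x₄ :: Z) * rowDet (N + 2) (x₁ :: x₂ :: Z) = 0 := by
  set W := x₁ :: x₂ :: x₃ :: Z with hW
  set κ : Fin (N + 2) → ℂ := fun j => (-1) ^ (j : ℕ) *
    Matrix.det (Matrix.of fun a b : Fin (N + 1) => (x₄ :: Z).getD a 0 (j.succAbove b)) with hκ
  have hφ : ∀ v, rowDet (N + 2) (v :: x₄ :: Z) = ∑ j : Fin (N + 2), v j * κ j :=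
    fun v => rowDet_cons (N + 1) v (x₄ :: Z)
  -- With `φ(v)` the determinant of `v, x₄, Z`, row `w` of `M` is `(φ(w), w)`, for `w` in `x₁, x₂,
  -- x₃, Z`. As `φ` is linear with coefficients `κ`, the first column is a combination of the others
  -- and `det M = 0`. Expansion along that column is the claimed relation.
  set M : Matrix (Fin (N + 3)) (Fin (N + 3)) ℂ := Matrix.of fun i j =>
    (Fin.cons (rowDet (N + 2) (W.getD i 0 :: x₄ :: Z)) (fun k : Fin (N + 2) => W.getD i 0 k) :
      Fin (N + 3) → ℂ) j with hM
  have hdet : M.det = 0 := by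
    rw [← Matrix.exists_mulVec_eq_zero_iff]
    refine ⟨Fin.cons 1 (fun k => -κ k), fun h => ?_, ?_⟩
    · have := congrFun h 0
      simp at this
    · ext i
      rw [Matrix.mulVec, dotProduct, Fin.sum_univ_succ]
      simp [hM, hφ]
  rw [Matrix.det_succ_column_zero, Fin.sum_univ_succ, Fin.sum_univ_succ, Fin.sum_univ_succ,
    Finset.sum_eq_zero] at hdet
  · have e0 : (M.submatrix (Fin.succAbove 0) Fin.succ).det = rowDet (N + 2) (x₂ :: x₃ :: Z) := by
      unfold rowDet
      congr 1
    have e1 : (M.submatrix (Fin.succAbove (Fin.succ 0)) Fin.succ).det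
        = rowDet (N + 2) (x₁ :: x₃ :: Z) := by
      unfold rowDet
      congr 1
      ext i j
      refine Fin.cases ?_ (fun i => ?_) i
      · simp [hM, hW]
      · rw [Matrix.submatrix_apply, Fin.succ_succAbove_succ]
        simp [hM, hW]
    have e2 : (M.submatrix (Fin.succAbove (Fin.succ (Fin.succ 0))) Fin.succ).det
        = rowDet (N + 2) (x₁ :: x₂ :: Z) := by
      unfold rowDet
      congr 1
      ext i j
      refine Fin.cases ?_ (fun i => ?_) i
      · rw [Matrix.submatrix_apply, Fin.succ_succAbove_zero]
        simp [hM, hW]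
      refine Fin.cases ?_ (fun i => ?_) i
      · rw [Matrix.submatrix_apply, Fin.succ_succAbove_succ]
        simp [hM, hW]
      · rw [Matrix.submatrix_apply, Fin.succ_succAbove_succ, Fin.succ_succAbove_succ]
        simp [hM, hW]
    have d0 : M 0 0 = rowDet (N + 2) (x₁ :: x₄ :: Z) := rfl
    have d1 : M (Fin.succ 0) 0 = rowDet (N + 2) (x₂ :: x₄ :: Z) := rfl
    have d2 : M (Fin.succ (Fin.succ 0)) 0 = rowDet (N + 2) (x₃ :: x₄ :: Z) := rfl
    rw [e0, e1, e2, d0, d1, d2] at hdet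
    simp only [Fin.val_succ, Fin.val_zero] at hdet
    linear_combination hdet
  · intro i _
    -- For `w` in `Z` the determinant `φ(w)` contains the row `w` twice, so only the first three
    -- terms of the expansion survive.
    have : M i.succ.succ.succ 0 = 0 := by
      simp only [hM, Matrix.of_apply, Fin.cons_zero, hW, Fin.val_succ, List.getD_cons_succ]
      refine rowDet_eq_zero _ (i := 0) (j := i.succ.succ) (fun h => ?_) ?_
      · exact absurd h (Fin.succ_ne_zero _).symm
      · simp
    rw [this]
    simp

/-- Elimination with a row of powers. -/
theorem rowDet_pow_cons (N : ℕ) (v : ℂ) (L : List (ℕ → ℂ)) :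
    rowDet (N + 1) ((fun j => v ^ j) :: L)
      = rowDet N (L.map fun g j => g (j + 1) - v * g j) := by
  -- Subtract from each column `v` times its predecessor. The row of powers becomes `(1, 0, …, 0)`.
  set B : Matrix (Fin (N + 1)) (Fin (N + 1)) ℂ := Matrix.of fun i j =>
    (Fin.cons (((fun j => v ^ j) :: L).getD i 0 0)
      (fun k : Fin N => ((fun j => v ^ j) :: L).getD i 0 (k + 1)
        - v * ((fun j => v ^ j) :: L).getD i 0 k) : Fin (N + 1) → ℂ) j with hB
  have h1 : rowDet (N + 1) ((fun j => v ^ j) :: L) = B.det := by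
    refine Matrix.det_eq_of_forall_col_eq_smul_add_pred (fun _ => v) (fun i => ?_) fun i j => ?_
    · simp [hB]
    · simp [hB]
  rw [h1, Matrix.det_succ_row_zero, Fin.sum_univ_succ, Finset.sum_eq_zero]
  · simp only [Fin.val_zero, pow_zero, one_mul, add_zero]
    have : B 0 0 = 1 := by simp [hB]
    rw [this, one_mul]
    unfold rowDet
    congr 1
    ext i j
    simp only [Matrix.submatrix_apply, hB, Matrix.of_apply, Fin.zero_succAbove, Fin.cons_succ,
      Fin.val_succ, List.getD_cons_succ]
    simp only [List.getD_eq_getElem?_getD, List.getElem?_map]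
    rcases L[(i : ℕ)]? with _ | g <;> simp
  · intro j _
    have : B 0 j.succ = 0 := by
      simp [hB, pow_succ']
    simp [this]

theorem rowDet_smul_row {N : ℕ} (A : List (ℕ → ℂ)) (c : ℂ) (x : ℕ → ℂ) (C : List (ℕ → ℂ))
    (hN : A.length < N) : rowDet N (A ++ (c • x) :: C) = c * rowDet N (A ++ x :: C) := by
  unfold rowDet
  set p : Fin N := ⟨A.length, hN⟩ with hp
  have key := Matrix.det_updateRow_smul (Matrix.of fun i j : Fin N => (A ++ x :: C).getD i 0 j)
    p c (fun j => x j)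
  have h1 : (Matrix.of fun i j : Fin N => (A ++ x :: C).getD i 0 j).updateRow p (fun j => x j)
      = Matrix.of fun i j : Fin N => (A ++ x :: C).getD i 0 j := by
    ext i j
    by_cases h : i = p
    · subst h
      simp [hp, List.getD_eq_getElem?_getD]
    · simp [Matrix.updateRow_ne h]
  have h2 : (Matrix.of fun i j : Fin N => (A ++ x :: C).getD i 0 j).updateRow p
      (c • fun j : Fin N => x j) = Matrix.of fun i j : Fin N => (A ++ (c • x) :: C).getD i 0 j := by
    ext i j
    by_cases h : i = p
    · subst h
      simp [hp, List.getD_eq_getElem?_getD]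
    · have h' : (i : ℕ) ≠ A.length := fun h' => h (Fin.ext h')
      rw [Matrix.updateRow_ne h]
      simp only [Matrix.of_apply, List.getD_eq_getElem?_getD, List.getElem?_append]
      split_ifs with h3
      · rfl
      · obtain ⟨k, hk⟩ : ∃ k, (i : ℕ) - A.length = k + 1 := ⟨(i : ℕ) - A.length - 1, by omega⟩
        rw [hk]
        simp
  rw [h1, h2] at key
  exact key

theorem rowDet_smul_rows {ι : Type*} {N : ℕ} (A : List (ℕ → ℂ)) (P : List ι) (s : ι → ℂ)
    (f : ι → ℕ → ℂ) (C : List (ℕ → ℂ)) (hN : A.length + P.length ≤ N) :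
    rowDet N (A ++ P.map (fun t => s t • f t) ++ C)
      = (P.map s).prod * rowDet N (A ++ P.map f ++ C) := by
  induction P generalizing A with
  | nil => simp
  | cons t P ih =>
    simp only [List.length_cons] at hN
    have h := ih (A ++ [f t]) (by simp; omega)
    simp only [List.map_cons, List.prod_cons, List.append_assoc, List.cons_append,
      List.nil_append] at h ⊢
    rw [rowDet_smul_row A _ _ _ (by omega), h]
    ring

/-! ### Universal characters in terms of bead positions -/

/-- The universal character of a pair of lists of bead positions, with `p_k(x)` and `p_k(y)`
replaced by arbitrary functions `hx k` and `hy k`. -/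
noncomputable def tau (β β' : List ℤ) (hx hy : ℤ → ℂ) : ℂ :=
  rowDet (β'.length + β.length) (β'.reverse.map (fun t (j : ℕ) => hy (t - j)) ++
    β.map (fun t (j : ℕ) => hx (t - ((β'.length + β.length : ℕ) : ℤ) + j)))

/-- Bead lists are decreasing, so a new bead usually lands in the middle, whereas the bilinear
relation wants it at the head. Only this sign is lost. -/
theorem tau_insert_left (B C β' : List ℤ) (b : ℤ) (hx hy : ℤ → ℂ) :
    tau (B ++ b :: C) β' hx hy = (-1) ^ B.length * tau (b :: (B ++ C)) β' hx hy := by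
  have hlen : β'.length + (B ++ b :: C).length = β'.length + (b :: (B ++ C)).length := by
    simp; omega
  simp only [tau, hlen, List.map_append, List.map_cons]
  rw [← List.append_assoc, rowDet_move _ _ _ _ (by simp)]
  simp

/-- The rows of the second list are reversed, so the head of the list is the last of these rows; the
row of `b` still has to pass exactly the rows of `B`. -/
theorem tau_insert_right (β B C : List ℤ) (b : ℤ) (hx hy : ℤ → ℂ) :
    tau β (B ++ b :: C) hx hy = (-1) ^ B.length * tau β (b :: (B ++ C)) hx hy := by
  have hlen : (B ++ b :: C).length + β.length = (b :: (B ++ C)).length + β.length := by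
    simp; omega
  simp only [tau, hlen, List.map_append, List.map_cons, List.reverse_append, List.reverse_cons,
    List.append_assoc, List.cons_append, List.nil_append, List.map_nil]
  have h := rowDet_move (N := (b :: (B ++ C)).length + β.length)
    (C.reverse.map (fun t (j : ℕ) => hy (t - j))) (fun j : ℕ => hy (b - j))
    (B.reverse.map (fun t (j : ℕ) => hy (t - j)))
    (β.map (fun t (j : ℕ) => hx (t - (((b :: (B ++ C)).length + β.length : ℕ) : ℤ) + j)))
    (by simp; omega)
  simp only [List.append_assoc, List.length_map, List.length_reverse] at h
  rw [h, ← mul_assoc, ← mul_pow]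
  simp

/-- Multiplication of the generating series of `h` by `1 - u z`. -/
def shiftBy (u : ℂ) (h : ℤ → ℂ) (k : ℤ) : ℂ := h k - u * h (k - 1)

/-- The indices run in opposite directions in the two kinds of rows. For this reason `1 - v z` on
the `x`-rows and `1 - v⁻¹ z` on the `y`-rows both act as `g ↦ g(j+1) - v g(j)`, except for a factor
`-v⁻¹` per `y`-row and a displacement of the `x`-rows by one. The unaffected prefix `A` leaves room
for another row of powers. -/
theorem rowDet_shiftBy {A : List (ℕ → ℂ)} {N : ℕ} (β β' : List ℤ) (hx hy : ℤ → ℂ) {v : ℂ}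
    (hv : v ≠ 0) (hN : A.length + β'.length ≤ N) (M : ℤ) :
    rowDet N (A ++ (β'.reverse.map (fun t (j : ℕ) => shiftBy v⁻¹ hy (t - j)) ++
      β.map (fun t (j : ℕ) => shiftBy v hx (t - M + j))))
    = (-v⁻¹) ^ β'.length * rowDet N (A ++ (β'.reverse.map (fun t (j : ℕ) => hy (t - j)) ++
      β.map (fun t (j : ℕ) => hx (t - (M + 1) + j))).map fun g j => g (j + 1) - v * g j) := by
  have h := rowDet_smul_rows (N := N) A β'.reverse (fun _ => -v⁻¹)
    (fun t (j : ℕ) => hy (t - (j + 1 : ℕ)) - v * hy (t - j))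
    ((β.map (fun t (j : ℕ) => hx (t - (M + 1) + j))).map fun g j => g (j + 1) - v * g j)
    (by simpa using hN)
  simp only [List.map_const', List.prod_replicate, List.length_reverse] at h
  rw [List.map_append, List.map_map, ← List.append_assoc]
  refine Eq.trans ?_ (h.trans ?_)
  · congr 1
    congr 1
    · congr 1
      refine List.map_congr_left fun t _ => ?_
      ext j
      simp only [shiftBy, Pi.smul_apply, smul_eq_mul]
      have : t - (j : ℤ) - 1 = t - ((j + 1 : ℕ) : ℤ) := by push_cast; ring
      rw [this]
      field_simp
      ring
    · rw [List.map_map]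
      refine List.map_congr_left fun t _ => ?_
      ext j
      simp only [shiftBy, Function.comp]
      congr 2
      · push_cast; ring
      · congr 1; ring
  · simp only [List.append_assoc]
    rfl

/-- The column operation produced by the shift is the one that eliminates a row of powers of `v`;
reading this backwards adjoins that row. -/
theorem tau_shiftBy (β β' : List ℤ) (hx hy : ℤ → ℂ) {v : ℂ} (hv : v ≠ 0) :
    tau β β' (shiftBy v hx) (shiftBy v⁻¹ hy) = (-v⁻¹) ^ β'.length *
      rowDet (β'.length + β.length + 1) ((fun j => v ^ j) ::
        (β'.reverse.map (fun t (j : ℕ) => hy (t - j)) ++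
        β.map (fun t (j : ℕ) => hx (t - (((β'.length + β.length : ℕ) : ℤ) + 1) + j)))) := by
  rw [rowDet_pow_cons]
  exact rowDet_shiftBy (A := []) β β' hx hy hv (by simp) _

/-- Eliminating the powers of `v` sends the row `u ^ j` to `u ^ (j+1) - v u ^ j = (u - v) u ^ j`,
which is the source of the factor `u - v`. -/
theorem tau_shiftBy_shiftBy (β β' : List ℤ) (hx hy : ℤ → ℂ) {u v : ℂ} (hu : u ≠ 0) (hv : v ≠ 0) :
    (u - v) * tau β β' (shiftBy u (shiftBy v hx)) (shiftBy u⁻¹ (shiftBy v⁻¹ hy)) =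
      (-u⁻¹) ^ β'.length * (-v⁻¹) ^ β'.length *
      rowDet (β'.length + β.length + 2) ((fun j => v ^ j) :: (fun j => u ^ j) ::
        (β'.reverse.map (fun t (j : ℕ) => hy (t - j)) ++
        β.map (fun t (j : ℕ) => hx (t - (((β'.length + β.length : ℕ) : ℤ) + 2) + j)))) := by
  rw [tau_shiftBy _ _ _ _ hu, rowDet_pow_cons _ v]
  have h1 := rowDet_shiftBy (A := [fun j => u ^ j]) (N := β'.length + β.length + 1) β β' hx hy hv
    (by simp; omega) (((β'.length + β.length : ℕ) : ℤ) + 1)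
  simp only [List.cons_append, List.nil_append] at h1
  rw [h1, List.map_cons]
  have h2 : (fun j : ℕ => u ^ (j + 1) - v * u ^ j) = (u - v) • fun j : ℕ => u ^ j := by
    ext j
    simp
    ring
  have h3 := rowDet_smul_row (N := β'.length + β.length + 1) [] (u - v) (fun j : ℕ => u ^ j)
    ((β'.reverse.map (fun t (j : ℕ) => hy (t - j)) ++
      β.map (fun t (j : ℕ) => hx (t - (((β'.length + β.length : ℕ) : ℤ) + 2) + j))).map
      fun g j => g (j + 1) - v * g j) (by simp)
  simp only [List.nil_append] at h3
  rw [h2, h3, add_assoc (((β'.length + β.length : ℕ) : ℤ)) 1 1, one_add_one_eq_two]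
  ring

/-- The bilinear relation for four pairs of bead lists that differ by a bead `b` in the first and a
bead `b'` in the second component. -/
theorem tau_bilinear (β β' : List ℤ) (b b' : ℤ) (hx hy : ℤ → ℂ) {u v : ℂ} (hu : u ≠ 0)
    (hv : v ≠ 0) :
    v * tau β (b' :: β') (shiftBy v hx) (shiftBy v⁻¹ hy)
        * tau (b :: β) β' (shiftBy u hx) (shiftBy u⁻¹ hy)
      - u * tau β (b' :: β') (shiftBy u hx) (shiftBy u⁻¹ hy)
        * tau (b :: β) β' (shiftBy v hx) (shiftBy v⁻¹ hy)
      = (v - u) * tau β β' (shiftBy u (shiftBy v hx)) (shiftBy u⁻¹ (shiftBy v⁻¹ hy))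
        * tau (b :: β) (b' :: β') hx hy := by
  set N := β'.length + β.length with hN
  set P := β'.reverse.map (fun t (j : ℕ) => hy (t - j)) with hP
  set Q := β.map (fun t (j : ℕ) => hx (t - ((N : ℤ) + 2) + j)) with hQ
  set y : ℕ → ℂ := fun j => hy (b' - j) with hy'
  set x : ℕ → ℂ := fun j => hx (b - ((N : ℤ) + 2) + j) with hx'
  have hPl : P.length = β'.length := by simp [hP]
  have l1 : (b' :: β').length + β.length = N + 1 := by simp [hN]; omega
  have l2 : β'.length + (b :: β).length = N + 1 := by simp [hN]; omega
  have l3 : (b' :: β').length + (b :: β).length = N + 2 := by simp [hN]; omega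
  have c1 : (((N + 1 : ℕ) : ℤ) + 1) = (N : ℤ) + 2 := by push_cast; ring
  have hU : ∀ w : ℂ, w ≠ 0 → tau β (b' :: β') (shiftBy w hx) (shiftBy w⁻¹ hy) =
      (-w⁻¹) ^ (β'.length + 1) * ((-1) ^ β'.length *
        rowDet (N + 2) ((fun j => w ^ j) :: y :: (P ++ Q))) := by
    intro w hw
    rw [tau_shiftBy _ _ _ _ hw, l1, c1]
    have h := rowDet_move (N := N + 2) [fun j => w ^ j] y P Q (by simp [hPl]; omega)
    rw [hPl] at h
    simp only [List.cons_append, List.nil_append] at h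
    rw [← h]
    simp [hP, hQ, hy']
  have hU' : ∀ w : ℂ, w ≠ 0 → tau (b :: β) β' (shiftBy w hx) (shiftBy w⁻¹ hy) =
      (-w⁻¹) ^ β'.length * ((-1) ^ β'.length *
        rowDet (N + 2) ((fun j => w ^ j) :: x :: (P ++ Q))) := by
    intro w hw
    rw [tau_shiftBy _ _ _ _ hw, l2, c1]
    have h := rowDet_move (N := N + 2) [fun j => w ^ j] x P Q (by simp [hPl]; omega)
    rw [hPl] at h
    simp only [List.cons_append, List.nil_append] at h
    rw [← h]
    simp [hP, hQ, hx']
  have hW : tau (b :: β) (b' :: β') hx hy = rowDet (N + 2) (y :: x :: (P ++ Q)) := by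
    have h1 := rowDet_move (N := N + 2) [] y P (x :: Q) (by simp [hPl]; omega)
    have h2 := rowDet_move (N := N + 2) [y] x P Q (by simp [hPl]; omega)
    rw [hPl] at h1 h2
    simp only [List.cons_append, List.nil_append] at h1 h2
    have h3 : tau (b :: β) (b' :: β') hx hy = rowDet (N + 2) (P ++ y :: x :: Q) := by
      rw [tau, l3]
      simp [hP, hQ, hy', hx']
    rw [h3, h1, h2, ← mul_assoc, ← mul_pow]
    simp
  have hV := tau_shiftBy_shiftBy β β' hx hy hu hv
  -- The six tau functions are now the six determinants obtained by choosing two of the rows `v ^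
  -- j`, `u ^ j`, `y`, `x` in front of the common rows `P ++ Q`.
  have pl := rowDet_plucker N (fun j => v ^ j) (fun j => u ^ j) y x (P ++ Q)
  have sgn : ((-1 : ℂ) ^ β'.length) * (-1) ^ β'.length = 1 := by
    rw [← mul_pow]; simp
  rw [hU v hv, hU u hu, hU' v hv, hU' u hu, hW]
  have hv1 : v * -v⁻¹ = -1 := by field_simp
  have hu1 : u * -u⁻¹ = -1 := by field_simp
  rw [pow_succ, pow_succ]
  set p := rowDet (N + 2) ((fun j => v ^ j) :: y :: (P ++ Q))
  set s := rowDet (N + 2) ((fun j => u ^ j) :: x :: (P ++ Q))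
  set t := rowDet (N + 2) ((fun j => u ^ j) :: y :: (P ++ Q))
  set w := rowDet (N + 2) ((fun j => v ^ j) :: x :: (P ++ Q))
  set σ := (-1 : ℂ) ^ β'.length
  set d := (-v⁻¹) ^ β'.length
  set a := (-u⁻¹) ^ β'.length
  linear_combination (d * a * σ * σ * p * s) * hv1 - (a * d * σ * σ * t * w) * hu1
    + (a * d * (t * w - p * s)) * sgn + a * d * pl
    + rowDet (N + 2) (y :: x :: (P ++ Q)) * hV

/-! ### From partitions to bead positions -/

theorem det_succ_of_last_row {N : ℕ} (E : ℕ → ℕ → ℂ) (h1 : E N N = 1) (h0 : ∀ j < N, E N j = 0) :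
    Matrix.det (Matrix.of fun i j : Fin (N + 1) => E i j)
      = Matrix.det (Matrix.of fun i j : Fin N => E i j) := by
  rw [Matrix.det_succ_row _ (Fin.last N), Fin.sum_univ_castSucc, Finset.sum_eq_zero]
  · have : Matrix.submatrix (Matrix.of fun i j : Fin (N + 1) => E i j) (Fin.last N).succAbove
        (Fin.last N).succAbove = Matrix.of fun i j : Fin N => E i j := by
      ext i j
      simp
    rw [this]
    simp [h1]
  · intro j _
    simp [h0 j j.2]

theorem det_succ_of_first_row {N : ℕ} (E : ℕ → ℕ → ℂ) (h1 : E 0 0 = 1)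
    (h0 : ∀ j, E 0 (j + 1) = 0) :
    Matrix.det (Matrix.of fun i j : Fin (N + 1) => E i j)
      = Matrix.det (Matrix.of fun i j : Fin N => E (i + 1) (j + 1)) := by
  rw [Matrix.det_succ_row_zero, Fin.sum_univ_succ, Finset.sum_eq_zero]
  · have : Matrix.submatrix (Matrix.of fun i j : Fin (N + 1) => E i j) Fin.succ
        (Fin.succAbove 0) = Matrix.of fun i j : Fin N => E (i + 1) (j + 1) := by
      ext i j
      simp
    rw [this]
    simp [h1]
  · intro j _
    simp [h0 j]

/-- The new last row is `p_{j - N}(x)`, that is `(0, …, 0, 1)`. -/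
theorem universalCharacter_append_zero_left (lam mu : List ℤ) (x y : ℕ → ℂ) :
    universalCharacter (lam ++ [0]) mu x y = universalCharacter lam mu x y := by
  have h := det_succ_of_last_row (N := mu.length + lam.length)
    (fun i j => if i < mu.length then schurP y (mu.getD (mu.length - 1 - i) 0 + (i : ℤ) - (j : ℤ))
      else schurP x ((lam ++ [0]).getD (i - mu.length) 0 - (i : ℤ) + (j : ℤ)))
    (by simp [schurP_zero]) (by
      intro j hj
      simp only [not_lt.mpr (Nat.le_add_right mu.length lam.length), if_false]
      apply schurP_of_neg
      simp
      omega)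
  unfold universalCharacter
  have e : mu.length + (lam ++ [0]).length = mu.length + lam.length + 1 := by simp; omega
  rw [e, h]
  congr 1
  ext i j
  simp only [Matrix.of_apply]
  split_ifs with hi
  · rfl
  · rw [List.getD_append _ _ _ _ (by omega)]

/-- Here the new part gives the first row `p_{-j}(y)`, that is `(1, 0, …, 0)`. -/
theorem universalCharacter_append_zero_right (lam mu : List ℤ) (x y : ℕ → ℂ) :
    universalCharacter lam (mu ++ [0]) x y = universalCharacter lam mu x y := by
  have h := det_succ_of_first_row (N := mu.length + lam.length)
    (fun i j => if i < mu.length + 1 then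
      schurP y ((mu ++ [0]).getD (mu.length + 1 - 1 - i) 0 + (i : ℤ) - (j : ℤ))
      else schurP x (lam.getD (i - (mu.length + 1)) 0 - (i : ℤ) + (j : ℤ)))
    (by simp [schurP_zero]) (by
      intro j
      simp only [Nat.zero_lt_succ, if_true]
      apply schurP_of_neg
      simp
      omega)
  unfold universalCharacter
  have e : (mu ++ [0]).length = mu.length + 1 := by simp
  have e' : mu.length + 1 + lam.length = mu.length + lam.length + 1 := by omega
  rw [e, e', h]
  congr 1
  ext i j
  simp only [Matrix.of_apply, Nat.add_lt_add_iff_right]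
  split_ifs with hi
  · rw [List.getD_append _ _ _ _ (by omega)]
    congr 1
    rw [show mu.length + 1 - 1 - ((i : ℕ) + 1) = mu.length - 1 - i by omega]
    push_cast
    ring
  · rw [show (i : ℕ) + 1 - (mu.length + 1) = i - mu.length by omega]
    congr 1
    push_cast
    ring

/-- `β` lists the positions, counted from a cutoff, of the beads of the partition `lam`, with zero
parts allowed. -/
def IsBeadList (lam β : List ℤ) : Prop :=
  ∃ k : ℕ, (lam ++ List.replicate k 0).length = β.length ∧
    ∀ j < β.length, (lam ++ List.replicate k 0).getD j 0 = β.getD j 0 - β.length + j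

theorem universalCharacter_append_zeros (lam mu : List ℤ) (x y : ℕ → ℂ) (k k' : ℕ) :
    universalCharacter (lam ++ List.replicate k 0) (mu ++ List.replicate k' 0) x y
      = universalCharacter lam mu x y := by
  induction k with
  | zero =>
    induction k' with
    | zero => simp
    | succ k' ih =>
      rw [List.replicate_succ', ← List.append_assoc, universalCharacter_append_zero_right, ih]
  | succ k ih =>
    rw [List.replicate_succ', ← List.append_assoc, universalCharacter_append_zero_left, ih]

/-- In terms of bead positions the row number drops out of the entries. Since rows are numbered from
`0` and the parts of `mu` enter in reverse, `l' - 1 - i` replaces `l' - i`, so the beads of `mu`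
appear lowered by one. -/
theorem universalCharacter_eq_tau {lam mu β β' : List ℤ} (h : IsBeadList lam β)
    (h' : IsBeadList mu β') (x y : ℕ → ℂ) :
    universalCharacter lam mu x y = tau β (β'.map (· - 1)) (schurP x) (schurP y) := by
  obtain ⟨k, hl, hk⟩ := h
  obtain ⟨k', hl', hk'⟩ := h'
  rw [← universalCharacter_append_zeros lam mu x y k k']
  unfold universalCharacter tau rowDet
  rw [hl, hl', List.length_map]
  congr 1
  ext i j
  simp only [Matrix.of_apply]
  have hi := i.2
  split_ifs with h
  · rw [hk' _ (by omega), List.getD_eq_getElem β' _ (by omega), List.getD_eq_getElem _ _ (by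
      simp), List.getElem_append_left (by simpa using h), List.getElem_map,
      List.getElem_reverse, List.getElem_map]
    simp only [List.length_map]
    congr 1
    push_cast [Nat.sub_sub, Nat.cast_sub (show 1 + (i : ℕ) ≤ β'.length by omega)]
    ring
  · rw [hk _ (by omega), List.getD_eq_getElem β _ (by omega), List.getD_eq_getElem _ _ (by
      simp), List.getElem_append_right (by simpa using h), List.getElem_map]
    simp only [List.length_map, List.length_reverse]
    congr 1
    push_cast [Nat.cast_sub (show β'.length ≤ (i : ℕ) by omega)]
    ring

theorem finite_beadSet (n : ZMod 3 → ℤ) (c : ℤ) : {t : ℤ | 0 < t ∧ c + t ∈ maya n}.Finite := by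
  obtain ⟨_, d, hd⟩ := isMaya_maya n
  refine (Set.finite_Icc 0 (d - c)).subset ?_
  rintro t ⟨h1, h2⟩
  refine ⟨h1.le, ?_⟩
  by_contra h
  exact hd (c + t) (by omega) h2

/-- The beads of `M(n)` above the cutoff `c`, counted from `c`, as a finite set. -/
noncomputable def beadSet (n : ZMod 3 → ℤ) (c : ℤ) : Finset ℤ := (finite_beadSet n c).toFinset

theorem mem_beadSet {n : ZMod 3 → ℤ} {c t : ℤ} : t ∈ beadSet n c ↔ 0 < t ∧ c + t ∈ maya n := by
  simp [beadSet]

/-- The beads of `M(n)` above the cutoff `c`, counted from `c`, as a decreasing list. -/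
noncomputable def beads (n : ZMod 3 → ℤ) (c : ℤ) : List ℤ := (beadSet n c).sort (· ≥ ·)

theorem sort_eq_append {S A B : Finset ℤ} (hS : ∀ t, t ∈ S ↔ t ∈ A ∨ t ∈ B)
    (hAB : ∀ a ∈ A, ∀ b ∈ B, b < a) :
    S.sort (· ≥ ·) = A.sort (· ≥ ·) ++ B.sort (· ≥ ·) := by
  refine List.Perm.eq_of_pairwise' (r := (· ≥ ·)) (Finset.pairwise_sort _ _) ?_ ?_
  · refine List.pairwise_append.mpr ⟨Finset.pairwise_sort _ _, Finset.pairwise_sort _ _, ?_⟩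
    intro a ha b hb
    exact (hAB a (by simpa using ha) b (by simpa using hb)).le
  · refine (List.perm_ext_iff_of_nodup (Finset.sort_nodup _ _) ?_).mpr ?_
    · refine List.nodup_append.mpr ⟨Finset.sort_nodup _ _, Finset.sort_nodup _ _, ?_⟩
      intro a ha b hb hab
      have := hAB a (by simpa using ha) b (by simpa using hb)
      omega
    · intro t
      simp [hS]

theorem card_filter_lt_sort (S : Finset ℤ) (k : ℕ) (hk : k < (S.sort (· ≥ ·)).length) :
    (S.filter (· < (S.sort (· ≥ ·))[k])).card = S.card - 1 - k := by
  set L := S.sort (· ≥ ·) with hL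
  have hs : L.SortedGT := Finset.sortedGT_sort S
  have hanti : StrictAnti fun i : Fin L.length => L[i] := by
    intro i j hij
    exact List.pairwise_iff_getElem.mp hs.pairwise i j i.2 j.2 hij
  have : S.filter (· < L[k]) = (Finset.Ioi (⟨k, hk⟩ : Fin L.length)).image (fun i => L[i]) := by
    ext s
    simp only [Finset.mem_filter, Finset.mem_image, Finset.mem_Ioi]
    constructor
    · rintro ⟨h1, h2⟩
      have h3 : s ∈ L := by simpa [hL] using h1
      obtain ⟨i, hi, rfl⟩ := List.mem_iff_getElem.mp h3
      exact ⟨⟨i, hi⟩, hanti.lt_iff_gt.mp h2, rfl⟩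
    · rintro ⟨i, hi, rfl⟩
      refine ⟨?_, hanti hi⟩
      exact (Finset.mem_sort _).mp (List.getElem_mem i.2)
  rw [this, Finset.card_image_of_injective _ hanti.injective, Fin.card_Ioi]
  simp [hL]

/-- No hole lies at or below the cutoff, so the count takes place among the `t - 1` integers
strictly between `c` and `c + t`. -/
theorem ncard_holes {n : ZMod 3 → ℤ} {c t : ℤ} (hc : ∀ x ≤ c, x ∈ maya n) (ht : 0 < t) :
    ((({y | y < c + t ∧ y ∉ maya n} : Set ℤ).ncard : ℕ) : ℤ)
      = t - 1 - ((beadSet n c).filter (· < t)).card := by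
  classical
  have h1 : ({y | y < c + t ∧ y ∉ maya n} : Set ℤ)
      = ((Finset.Ioo c (c + t)).filter (· ∉ maya n) : Finset ℤ) := by
    ext y
    simp only [Set.mem_ofPred_eq, Finset.coe_filter, Finset.mem_Ioo]
    constructor
    · rintro ⟨h1, h2⟩
      refine ⟨⟨?_, h1⟩, h2⟩
      by_contra h
      exact h2 (hc y (by omega))
    · rintro ⟨⟨_, h1⟩, h2⟩
      exact ⟨h1, h2⟩
  have h2 : ((beadSet n c).filter (· < t)).card
      = ((Finset.Ioo c (c + t)).filter (· ∈ maya n)).card := by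
    refine Finset.card_bij (fun s _ => c + s) ?_ ?_ ?_
    · intro s hs
      simp only [Finset.mem_filter, mem_beadSet, Finset.mem_Ioo] at hs ⊢
      exact ⟨⟨by omega, by omega⟩, hs.1.2⟩
    · intro a _ b _ h
      exact add_left_cancel h
    · intro y hy
      simp only [Finset.mem_filter, Finset.mem_Ioo] at hy
      exact ⟨y - c, by simp only [Finset.mem_filter, mem_beadSet]; refine ⟨⟨by omega, ?_⟩, by omega⟩;
                       rw [add_sub_cancel]; exact hy.2, by ring⟩
  have h3 := Finset.card_filter_add_card_filter_not (s := Finset.Ioo c (c + t)) (· ∈ maya n)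
  rw [Int.card_Ioo] at h3
  rw [h1, Set.ncard_coe_finset, h2]
  omega

/-- Below the `j`-th bead (from `0`) there are `|β| - 1 - j` beads above the cutoff, which leaves
`(β_j - 1) - (|β| - 1 - j)` holes; this number is the part. -/
theorem isBeadList_core {n : ZMod 3 → ℤ} {c : ℤ} (hc : ∀ x ≤ c, x ∈ maya n) :
    IsBeadList (core n) (beads n c) := by
  classical
  set hole : ℤ → ℤ := fun x => (({y | y < x ∧ y ∉ maya n} : Set ℤ).ncard : ℕ) with hhole
  set F := (isMaya_maya n).finite_beads.toFinset with hF
  have memF : ∀ x, x ∈ F ↔ x ∈ maya n ∧ ∃ y < x, y ∉ maya n := by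
    intro x
    simp [hF]
  -- The beads above the cutoff with no hole below them; they account for the padding by zero parts.
  set G := (beadSet n c).filter (fun t => c + t ∉ F) with hG
  set F' := (beadSet n c).filter (fun t => c + t ∈ F) with hF'
  have hsplit : beads n c = F'.sort (· ≥ ·) ++ G.sort (· ≥ ·) := by
    refine sort_eq_append (fun t => ?_) fun a ha b hb => ?_
    · simp only [hF', hG, Finset.mem_filter]
      tauto
    · simp only [hF', hG, Finset.mem_filter, mem_beadSet, memF] at ha hb
      by_contra hab
      obtain ⟨y, hy, hyM⟩ := ha.2.2
      exact hb.2 ⟨hb.1.2, y, by omega, hyM⟩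
  have hFF : F.sort (· ≥ ·) = (F'.sort (· ≥ ·)).map (c + ·) := by
    refine List.Perm.eq_of_pairwise' (r := (· ≥ ·)) (Finset.pairwise_sort _ _) ?_ ?_
    · refine List.pairwise_map.mpr ((Finset.pairwise_sort _ _).imp ?_)
      intro a b h
      simpa using h
    · refine (List.perm_ext_iff_of_nodup (Finset.sort_nodup _ _)
        ((Finset.sort_nodup _ _).map (add_right_injective c))).mpr ?_
      intro x
      simp only [Finset.mem_sort, List.mem_map, hF', Finset.mem_filter, mem_beadSet]
      constructor
      · intro hx
        refine ⟨x - c, ?_, by ring⟩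
        obtain ⟨h1, y, hy, hyM⟩ := (memF x).mp hx
        rw [add_sub_cancel]
        refine ⟨⟨?_, h1⟩, hx⟩
        by_contra h
        exact hyM (hc y (by omega))
      · rintro ⟨t, ht, rfl⟩
        exact ht.2
  have hcore : core n ++ List.replicate G.card 0 = (beads n c).map (fun t => hole (c + t)) := by
    rw [hsplit, List.map_append]
    congr 1
    · have : core n = (F.sort (· ≥ ·)).map hole := rfl
      rw [this, hFF, List.map_map]
      rfl
    · symm
      rw [List.eq_replicate_iff]
      refine ⟨by simp, ?_⟩
      intro z hz
      obtain ⟨t, ht, rfl⟩ := List.mem_map.mp hz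
      simp only [Finset.mem_sort, hG, Finset.mem_filter, mem_beadSet, memF] at ht
      have : ({y | y < c + t ∧ y ∉ maya n} : Set ℤ) = ∅ := by
        ext y
        simp only [Set.mem_ofPred_eq, Set.mem_empty_iff_false, iff_false, not_and, not_not]
        intro hy
        by_contra h
        exact ht.2 ⟨ht.1.2, y, hy, h⟩
      simp [hhole, this]
  refine ⟨G.card, ?_, ?_⟩
  · rw [hcore, List.length_map]
  · intro j hj
    rw [hcore, List.getD_eq_getElem _ _ (by simpa using hj), List.getElem_map,
      List.getD_eq_getElem _ _ hj]
    have hm : (beads n c)[j] ∈ beadSet n c := (Finset.mem_sort _).mp (List.getElem_mem hj)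
    have e := ncard_holes hc (mem_beadSet.mp hm).1
    have e2 := card_filter_lt_sort (beadSet n c) j hj
    have e3 : (beads n c).length = (beadSet n c).card := by simp [beads]
    change hole _ = _
    rw [hhole]
    simp only
    rw [e]
    change ((beadSet n c).filter (· < (beads n c)[j])).card = _ at e2
    rw [e2, e3]
    omega

theorem beads_insert {n n' : ZMod 3 → ℤ} {c x : ℤ} (hx : 0 < x) (hxn : c + x ∉ maya n)
    (h : maya n' = insert (c + x) (maya n)) :
    ∃ B C, beads n c = B ++ C ∧ beads n' c = B ++ x :: C := by
  classical
  refine ⟨((beadSet n c).filter (x < ·)).sort (· ≥ ·), ((beadSet n c).filter (· < x)).sort (· ≥ ·),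
    sort_eq_append (fun t => ?_) fun a ha b hb => ?_, ?_⟩
  · simp only [Finset.mem_filter, mem_beadSet]
    constructor
    · intro ht
      rcases lt_trichotomy t x with h1 | h1 | h1
      · exact Or.inr ⟨ht, h1⟩
      · subst h1
        exact absurd ht.2 hxn
      · exact Or.inl ⟨ht, h1⟩
    · rintro (h | h) <;> exact h.1
  · simp only [Finset.mem_filter] at ha hb
    omega
  · have hins : x :: ((beadSet n c).filter (· < x)).sort (· ≥ ·)
        = (insert x ((beadSet n c).filter (· < x))).sort (· ≥ ·) := by
      rw [Finset.sort_insert]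
      · intro b hb
        simp only [Finset.mem_filter] at hb
        exact hb.2.le
      · simp
    rw [hins]
    refine sort_eq_append (fun t => ?_) fun a ha b hb => ?_
    · simp only [Finset.mem_filter, Finset.mem_insert, mem_beadSet, h, Set.mem_insert_iff]
      constructor
      · rintro ⟨h1, h2 | h2⟩
        · exact Or.inr (Or.inl (by omega))
        · rcases lt_trichotomy t x with h3 | h3 | h3
          · exact Or.inr (Or.inr ⟨⟨h1, h2⟩, h3⟩)
          · exact Or.inr (Or.inl h3)
          · exact Or.inl ⟨⟨h1, h2⟩, h3⟩
      · rintro (⟨⟨h1, h2⟩, _⟩ | rfl | ⟨⟨h1, h2⟩, _⟩)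
        · exact ⟨h1, Or.inr h2⟩
        · exact ⟨hx, Or.inl rfl⟩
        · exact ⟨h1, Or.inr h2⟩
    · simp only [Finset.mem_filter, Finset.mem_insert] at ha hb
      omega

/-! ### Adding a bead to a 3-core -/

theorem mem_maya_iff {n : ZMod 3 → ℤ} {x : ℤ} :
    x ∈ maya n ↔ (x % 3 = 1 ∧ x < 3 * n 1 + 1) ∨ (x % 3 = 2 ∧ x < 3 * n 2 + 2) ∨
      (x % 3 = 0 ∧ x < 3 * n 3 + 3) := by
  constructor
  · rintro (⟨k, hk, rfl⟩ | ⟨k, hk, rfl⟩ | ⟨k, hk, rfl⟩) <;> omega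
  · rintro (⟨h1, h2⟩ | ⟨h1, h2⟩ | ⟨h1, h2⟩)
    · exact Or.inl ⟨x / 3, by omega, by omega⟩
    · exact Or.inr (Or.inl ⟨x / 3, by omega, by omega⟩)
    · exact Or.inr (Or.inr ⟨x / 3 - 1, by omega, by omega⟩)

theorem card_beadSet {n : ZMod 3 → ℤ} {d : ℤ} (h1 : d ≤ n 1) (h2 : d ≤ n 2) (h3 : d ≤ n 3) :
    ((beadSet n (3 * d)).card : ℤ) = size n - 3 * d := by
  classical
  have e : beadSet n (3 * d) = ((Finset.Ico d (n 1)).image (fun k => 3 * k + 1 - 3 * d) ∪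
      (Finset.Ico d (n 2)).image (fun k => 3 * k + 2 - 3 * d)) ∪
      (Finset.Ico d (n 3)).image (fun k => 3 * k + 3 - 3 * d) := by
    ext t
    simp only [mem_beadSet, mem_maya_iff, Finset.mem_union, Finset.mem_image, Finset.mem_Ico]
    constructor
    · rintro ⟨h0, h | h | h⟩
      · exact Or.inl (Or.inl ⟨(3 * d + t) / 3, by omega, by omega⟩)
      · exact Or.inl (Or.inr ⟨(3 * d + t) / 3, by omega, by omega⟩)
      · exact Or.inr ⟨(3 * d + t) / 3 - 1, by omega, by omega⟩
    · rintro ((⟨k, hk, rfl⟩ | ⟨k, hk, rfl⟩) | ⟨k, hk, rfl⟩) <;> omega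
  have hinj : ∀ j : ℤ, Function.Injective fun k : ℤ => 3 * k + j - 3 * d := by
    intro j a b hab
    simp only at hab
    omega
  rw [e, Finset.card_union_of_disjoint, Finset.card_union_of_disjoint,
    Finset.card_image_of_injective _ (hinj 1), Finset.card_image_of_injective _ (hinj 2),
    Finset.card_image_of_injective _ (hinj 3), Int.card_Ico, Int.card_Ico, Int.card_Ico]
  · unfold size
    omega
  · rw [Finset.disjoint_left]
    intro t ht ht'
    simp only [Finset.mem_image] at ht ht'
    obtain ⟨k, _, rfl⟩ := ht
    obtain ⟨k', _, h⟩ := ht'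
    omega
  · rw [Finset.disjoint_left]
    intro t ht ht'
    simp only [Finset.mem_union, Finset.mem_image] at ht ht'
    obtain ⟨k', _, h⟩ := ht'
    obtain (⟨k, _, rfl⟩ | ⟨k, _, rfl⟩) := ht <;> omega

theorem length_beads {n : ZMod 3 → ℤ} {d : ℤ} (h1 : d ≤ n 1) (h2 : d ≤ n 2) (h3 : d ≤ n 3) :
    ((beads n (3 * d)).length : ℤ) = size n - 3 * d := by
  rw [← card_beadSet h1 h2 h3]
  simp [beads]

theorem isBeadList_core_mul {n : ZMod 3 → ℤ} {d : ℤ} (h1 : d ≤ n 1) (h2 : d ≤ n 2)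
    (h3 : d ≤ n 3) : IsBeadList (core n) (beads n (3 * d)) := by
  refine isBeadList_core fun x hx => ?_
  rw [mem_maya_iff]
  omega

/-- This is the reason for `λ(n + (1,1,1)) = λ(n)`: the Maya diagram is translated by `3`. -/
theorem beads_add_one {n n' : ZMod 3 → ℤ} (h : ∀ j, n' j = n j + 1) (d : ℤ) :
    beads n' (3 * (d + 1)) = beads n (3 * d) := by
  unfold beads
  congr 1
  ext t
  simp only [mem_beadSet, mem_maya_iff, h]
  omega

/-- The beads of `λ(n(i))` and of `λ(n(i+1))`: there is one more in the second list. -/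
theorem exists_beads_step (n : ZMod 3 → ℤ) (i : ZMod 3) :
    ∃ (B C : List ℤ) (x : ℤ), IsBeadList (core (raise n i)) (B ++ C) ∧
      IsBeadList (core (raise n (i + 1))) (B ++ x :: C) ∧
      x - (B ++ C).length = 3 * n (i + 1) - size n + 1 := by
  -- A common cutoff `3 * d` below which all three residue classes are full.
  obtain ⟨d, h1, h2, h3⟩ : ∃ d : ℤ, d ≤ n 1 ∧ d ≤ n 2 ∧ d ≤ n 3 :=
    ⟨min (n 1) (min (n 2) (n 3)), min_le_left _ _, (min_le_right _ _).trans (min_le_left _ _),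
      (min_le_right _ _).trans (min_le_right _ _)⟩
  have a01 : raise n 0 1 = n 1 := by simp [raise]
  have a02 : raise n 0 2 = n 2 := by simp [raise]
  have a03 : raise n 0 3 = n 3 := by simp [raise]
  have a11 : raise n 1 1 = n 1 + 1 := by simp [raise, ZMod.val_one]
  have a12 : raise n 1 2 = n 2 := by simp [raise]; decide
  have a13 : raise n 1 3 = n 3 := by simp [raise]; decide
  have a21 : raise n 2 1 = n 1 + 1 := by simp [raise]; decide
  have a22 : raise n 2 2 = n 2 + 1 := by simp [raise]; decide
  have a23 : raise n 2 3 = n 3 := by simp [raise]; decide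
  have hsize : ∀ i, size (raise n i) = raise n i 1 + raise n i 2 + raise n i 3 := fun i => rfl
  have hs : size n = n 1 + n 2 + n 3 := rfl
  have hi : i = 0 ∨ i = 1 ∨ i = 2 := by
    revert i
    decide
  rcases hi with rfl | rfl | rfl
  · obtain ⟨B, C, hB, hC⟩ := beads_insert (n := raise n 0) (n' := raise n (0 + 1)) (c := 3 * d)
      (x := 3 * n 1 + 1 - 3 * d) (by omega) (by rw [mem_maya_iff, a01, a02, a03]; omega) (by
        ext y
        rw [zero_add, Set.mem_insert_iff, mem_maya_iff, mem_maya_iff, a11, a12, a13, a01, a02, a03]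
        omega)
    refine ⟨B, C, 3 * n 1 + 1 - 3 * d, ?_, ?_, ?_⟩
    · rw [← hB]
      exact isBeadList_core_mul (by omega) (by omega) (by omega)
    · rw [← hC]
      exact isBeadList_core_mul (by rw [zero_add]; omega) (by rw [zero_add]; omega)
        (by rw [zero_add]; omega)
    · rw [← hB, length_beads (by omega) (by omega) (by omega), hsize]
      rw [zero_add]
      omega
  · obtain ⟨B, C, hB, hC⟩ := beads_insert (n := raise n 1) (n' := raise n (1 + 1)) (c := 3 * d)
      (x := 3 * n 2 + 2 - 3 * d) (by omega) (by rw [mem_maya_iff, a11, a12, a13]; omega) (by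
        ext y
        rw [one_add_one_eq_two, Set.mem_insert_iff, mem_maya_iff, mem_maya_iff, a11, a12, a13, a21,
          a22, a23]
        omega)
    rw [one_add_one_eq_two] at *
    refine ⟨B, C, 3 * n 2 + 2 - 3 * d, ?_, ?_, ?_⟩
    · rw [← hB]
      exact isBeadList_core_mul (by omega) (by omega) (by omega)
    · rw [← hC]
      exact isBeadList_core_mul (by omega) (by omega) (by omega)
    · rw [← hB, length_beads (by omega) (by omega) (by omega), hsize]
      omega
  · have e3 : (2 : ZMod 3) + 1 = 3 := by decide
    have e0 : (3 : ZMod 3) = 0 := by decide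
    -- The step from `2` to `3 = 0` wraps around: the bead is added to reach `n + (1,1,1)`, whose
    -- bead list is that of `n` with the cutoff lowered by `3`.
    obtain ⟨B, C, hB, hC⟩ := beads_insert (n := raise n 2) (n' := fun j => n j + 1) (c := 3 * d)
      (x := 3 * n 3 + 3 - 3 * d) (by omega) (by rw [mem_maya_iff, a21, a22, a23]; omega) (by
        ext y
        rw [Set.mem_insert_iff, mem_maya_iff, mem_maya_iff, a21, a22, a23]
        omega)
    refine ⟨B, C, 3 * n 3 + 3 - 3 * d, ?_, ?_, ?_⟩
    · rw [← hB]
      exact isBeadList_core_mul (by omega) (by omega) (by omega)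
    · have h : beads (fun j => n j + 1) (3 * d) = beads (raise n 0) (3 * (d - 1)) := by
        have : raise n 0 = n := by
          ext j
          simp [raise]
        rw [this, ← beads_add_one (n := n) (n' := fun j => n j + 1) (fun _ => rfl)]
        simp
      rw [← hC, h, e3, e0]
      exact isBeadList_core_mul (by omega) (by omega) (by omega)
    · rw [← hB, length_beads (by omega) (by omega) (by omega), hsize, e3]
      omega

/-! ### Homogeneity of universal characters -/

theorem rowDet_mul_columns (N : ℕ) (c : ℂ) (L : List (ℕ → ℂ)) :
    rowDet N (L.map fun g j => c ^ j * g j) = c ^ (∑ j ∈ Finset.range N, j) * rowDet N L := by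
  have h := Matrix.det_mul_row (fun j : Fin N => c ^ (j : ℕ))
    (Matrix.of fun i j : Fin N => L.getD i 0 j)
  have hp : ∏ j : Fin N, c ^ (j : ℕ) = c ^ (∑ j ∈ Finset.range N, j) := by
    rw [Fin.prod_univ_eq_prod_range (fun j => c ^ j), Finset.prod_pow_eq_pow_sum]
  rw [hp] at h
  unfold rowDet
  rw [← h]
  congr 1
  ext i j
  simp only [Matrix.of_apply, List.getD_eq_getElem?_getD, List.getElem?_map]
  rcases L[(i : ℕ)]? with _ | g <;> simp

theorem prod_map_zpow {c : ℂ} (hc : c ≠ 0) (g : ℤ → ℤ) (L : List ℤ) :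
    (L.map fun t => c ^ g t).prod = c ^ (L.map g).sum := by
  induction L with
  | nil => simp
  | cons t L ih => simp [ih, zpow_add₀ hc]

theorem sum_map_neg (L : List ℤ) : (L.map fun t => -t).sum = -L.sum := by
  induction L with
  | nil => simp
  | cons t L ih =>
    simp only [List.map_cons, List.sum_cons, ih]
    ring

/-- The degree of homogeneity of `tau`. -/
def tauDegree (β β' : List ℤ) : ℤ :=
  (β.map fun t => t - ((β'.length + β.length : ℕ) : ℤ)).sum - β'.sum
    + ((∑ j ∈ Finset.range (β'.length + β.length), j : ℕ) : ℤ)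

/-- Because `y` is scaled inversely to `x`, every entry of column `j` acquires `c ^ j` times a
factor depending on its row only. -/
theorem tau_rescale (β β' : List ℤ) (hx hy : ℤ → ℂ) {c : ℂ} (hc : c ≠ 0) :
    tau β β' (fun k => c ^ k * hx k) (fun k => c⁻¹ ^ k * hy k)
      = c ^ tauDegree β β' * tau β β' hx hy := by
  set N := β'.length + β.length with hN
  have e1 : β'.reverse.map (fun t (j : ℕ) => c⁻¹ ^ (t - (j : ℤ)) * hy (t - j))
      = β'.reverse.map (fun t => c ^ (-t) • fun j : ℕ => c ^ j * hy (t - j)) := by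
    refine List.map_congr_left fun t _ => ?_
    ext j
    simp only [Pi.smul_apply, smul_eq_mul]
    rw [← mul_assoc, ← zpow_natCast, ← zpow_add₀ hc, inv_zpow', neg_sub, sub_eq_neg_add]
  have e2 : β.map (fun t (j : ℕ) => c ^ (t - (N : ℤ) + j) * hx (t - (N : ℤ) + j))
      = β.map (fun t => c ^ (t - (N : ℤ)) • fun j : ℕ => c ^ j * hx (t - (N : ℤ) + j)) := by
    refine List.map_congr_left fun t _ => ?_
    ext j
    simp only [Pi.smul_apply, smul_eq_mul]
    rw [← mul_assoc, ← zpow_natCast, ← zpow_add₀ hc]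
  have h1 := rowDet_smul_rows (N := N) [] β'.reverse (fun t => c ^ (-t))
    (fun t (j : ℕ) => c ^ j * hy (t - j))
    (β.map (fun t => c ^ (t - (N : ℤ)) • fun j : ℕ => c ^ j * hx (t - (N : ℤ) + j)))
    (by simp [hN])
  have h2 := rowDet_smul_rows (N := N) (β'.reverse.map (fun t (j : ℕ) => c ^ j * hy (t - j))) β
    (fun t => c ^ (t - (N : ℤ))) (fun t (j : ℕ) => c ^ j * hx (t - (N : ℤ) + j)) [] (by simp [hN])
  have h3 := rowDet_mul_columns N c (β'.reverse.map (fun t (j : ℕ) => hy (t - j)) ++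
    β.map (fun t (j : ℕ) => hx (t - (N : ℤ) + j)))
  rw [List.map_append, List.map_map, List.map_map] at h3
  simp only [List.nil_append, List.append_nil] at h1 h2
  unfold tau
  rw [← hN, e1, e2, h1, h2]
  simp only [Function.comp_def] at h3
  rw [h3, prod_map_zpow hc, prod_map_zpow hc, ← mul_assoc, ← mul_assoc, ← zpow_natCast,
    ← zpow_add₀ hc, ← zpow_add₀ hc]
  congr 2
  have : (β'.reverse.map fun t : ℤ => -t).sum = -β'.sum := by
    rw [List.map_reverse, List.sum_reverse, sum_map_neg]
  rw [this, tauDegree, ← hN]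
  ring

theorem sum_map_sub_const (L : List ℤ) (d : ℤ) : (L.map fun t => t - d).sum = L.sum - L.length * d := by
  induction L with
  | nil => simp
  | cons t L ih =>
    simp only [List.map_cons, List.sum_cons, ih, List.length_cons]
    push_cast
    ring

/-- The difference of degrees of the two factors on the right of the bilinear relation; it becomes
the exponent of `q^{1/3}` in the coefficients. -/
theorem tauDegree_insert (B C B' C' : List ℤ) (b b' : ℤ) :
    tauDegree (B ++ b :: C) (B' ++ b' :: C') = tauDegree (B ++ C) (B' ++ C')
      + (b - (B ++ C).length) - (b' + 1 - (B' ++ C').length) := by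
  unfold tauDegree
  have l : (B' ++ b' :: C').length + (B ++ b :: C).length
      = (B' ++ C').length + (B ++ C).length + 2 := by
    simp; omega
  rw [l, Finset.sum_range_succ, Finset.sum_range_succ, sum_map_sub_const, sum_map_sub_const]
  simp only [List.sum_append, List.sum_cons, List.length_append, List.length_cons]
  push_cast
  ring

/-! ### Universal characters at `x_n = ∑ u_j ^ n / (n (1 - q ^ n))` -/

/-- The power sums `x_n = ∑ u_j ^ n / (n (1 - q ^ n))`. -/
noncomputable def qPowerSum (q : ℂ) (u : Fin 3 → ℂ) (n : ℕ) : ℂ :=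
  (∑ j, u j ^ n) / (n * (1 - q ^ n))

/-- `p_k(x)` for `x_n = ∑ u_j ^ n / (n (1 - q ^ n))`. -/
noncomputable def qComplete (q : ℂ) (u : Fin 3 → ℂ) : ℤ → ℂ := schurP (qPowerSum q u)

/-- The universal character with `x` built from `q, u` and `y` from `q⁻¹, u⁻¹`. -/
noncomputable def qUC (q : ℂ) (lam mu : List ℤ) (u : Fin 3 → ℂ) : ℂ :=
  universalCharacter lam mu (qPowerSum q u) (qPowerSum q⁻¹ u⁻¹)

theorem R_eq_qUC (q : ℂ) (lam mu : List ℤ) (a b : ℂ) :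
    R q lam mu a b = qUC q lam mu ![a⁻¹, b⁻¹, a * b] := by
  unfold R qUC qPowerSum
  congr 1
  · ext n
    simp [Fin.sum_univ_three]
  · ext n
    simp [Fin.sum_univ_three]

/-- The operator `u_j ↦ q u_j`. -/
def qStep (q : ℂ) (j : Fin 3) (u : Fin 3 → ℂ) : Fin 3 → ℂ := Function.update u j (q * u j)

/-- The denominator `1 - q ^ n` is made for this: `u_j ↦ q u_j` changes `x_n` by `-u_j ^ n / n`, the
logarithm of the factor `1 - u_j z`. -/
theorem qComplete_qStep {q : ℂ} (hq : ∀ k : ℕ, 0 < k → q ^ k ≠ 1) (j : Fin 3) (u : Fin 3 → ℂ) :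
    qComplete q (qStep q j u) = shiftBy (u j) (qComplete q u) := by
  ext k
  unfold qComplete shiftBy
  rw [← schurP_sub_geom]
  refine congrFun (schurP_congr fun n hn => ?_) k
  unfold qPowerSum
  have h1 : (1 - q ^ n) ≠ 0 := sub_ne_zero.mpr (hq n (Nat.pos_of_ne_zero hn)).symm
  have h2 : (n : ℂ) ≠ 0 := Nat.cast_ne_zero.mpr hn
  have h3 : ∑ i, qStep q j u i ^ n = ∑ i, u i ^ n - (1 - q ^ n) * u j ^ n := by
    rw [← Finset.add_sum_erase _ _ (Finset.mem_univ j),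
      ← Finset.add_sum_erase _ (fun i => u i ^ n) (Finset.mem_univ j)]
    rw [Finset.sum_congr rfl (g := fun i => u i ^ n)]
    · simp only [qStep, Function.update_self]
      ring
    · intro i hi
      simp [qStep, Function.update_of_ne (Finset.ne_of_mem_erase hi)]
  rw [h3]
  field_simp

theorem qComplete_smul (q c : ℂ) (u : Fin 3 → ℂ) (k : ℤ) :
    qComplete q (c • u) k = c ^ k * qComplete q u k := by
  unfold qComplete
  rw [← schurP_rescale]
  congr 1
  ext n
  simp only [qPowerSum, Pi.smul_apply, smul_eq_mul, mul_pow, ← Finset.mul_sum]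
  ring

theorem qStep_inv (q : ℂ) (j : Fin 3) (u : Fin 3 → ℂ) : (qStep q j u)⁻¹ = qStep q⁻¹ j u⁻¹ := by
  ext i
  by_cases h : i = j
  · subst h
    simp [qStep, mul_comm]
  · simp [qStep, Function.update_of_ne h]

theorem qUC_eq_tau {lam mu β β' : List ℤ} (h : IsBeadList lam β) (h' : IsBeadList mu β') (q : ℂ)
    (u : Fin 3 → ℂ) :
    qUC q lam mu u = tau β (β'.map (· - 1)) (qComplete q u) (qComplete q⁻¹ u⁻¹) :=
  universalCharacter_eq_tau h h' _ _

theorem qUC_smul {lam mu β β' : List ℤ} (h : IsBeadList lam β) (h' : IsBeadList mu β') (q : ℂ)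
    (u : Fin 3 → ℂ) {c : ℂ} (hc : c ≠ 0) :
    qUC q lam mu (c • u) = c ^ tauDegree β (β'.map (· - 1)) * qUC q lam mu u := by
  rw [qUC_eq_tau h h', qUC_eq_tau h h', ← tau_rescale _ _ _ _ hc]
  have e : (c • u)⁻¹ = c⁻¹ • u⁻¹ := by
    ext i
    simp [mul_comm]
  rw [e]
  congr 1
  · ext k
    exact qComplete_smul q c u k
  · ext k
    exact qComplete_smul q⁻¹ c⁻¹ u⁻¹ k

/-- The bilinear relation, with the normalization of homogeneous degrees by powers of `r`. -/
theorem qUC_bilinear {q : ℂ} (hq : ∀ k : ℕ, 0 < k → q ^ k ≠ 1) (m n : ZMod 3 → ℤ) (i i' : ZMod 3)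
    {u : Fin 3 → ℂ} (hu : ∀ j, u j ≠ 0) {j k : Fin 3} (hjk : j ≠ k) {r : ℂ} (hr : r ≠ 0) :
    u k * qUC q (core (raise m i)) (core (raise n (i' + 1))) (qStep q k u)
        * qUC q (core (raise m (i + 1))) (core (raise n i')) (qStep q j u)
      - u j * qUC q (core (raise m i)) (core (raise n (i' + 1))) (qStep q j u)
        * qUC q (core (raise m (i + 1))) (core (raise n i')) (qStep q k u)
      = r ^ (3 * (n (i' + 1) - m (i + 1)) + (size m - size n)) * (u k - u j)
        * qUC q (core (raise m i)) (core (raise n i')) (r⁻¹ • qStep q j (qStep q k u))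
        * qUC q (core (raise m (i + 1))) (core (raise n (i' + 1))) (r • u) := by
  obtain ⟨B, C, x, h1, h2, h3⟩ := exists_beads_step m i
  obtain ⟨B', C', x', h1', h2', h3'⟩ := exists_beads_step n i'
  have hq' : ∀ k : ℕ, 0 < k → q⁻¹ ^ k ≠ 1 := by
    intro k hk h
    rw [inv_pow, inv_eq_one] at h
    exact hq k hk h
  rw [qUC_smul h1 h1' q _ (inv_ne_zero hr), qUC_smul h2 h2' q _ hr]
  have hdeg := tauDegree_insert B C (B'.map (· - 1)) (C'.map (· - 1)) x (x' - 1)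
  simp only [qUC_eq_tau h1 h1', qUC_eq_tau h1 h2', qUC_eq_tau h2 h1', qUC_eq_tau h2 h2',
    List.map_append, List.map_cons]
  rw [hdeg]
  set P := B'.map (· - 1) with hP
  set Q := C'.map (· - 1) with hQ
  have hPQ : (P ++ Q).length = (B' ++ C').length := by simp [hP, hQ]
  simp only [tau_insert_left, tau_insert_right]
  have hkj : qStep q k u j = u j := Function.update_of_ne hjk _ _
  have hkj' : qStep q⁻¹ k u⁻¹ j = (u j)⁻¹ := Function.update_of_ne hjk _ _
  have key := tau_bilinear (B ++ C) (P ++ Q) x (x' - 1) (qComplete q u) (qComplete q⁻¹ u⁻¹)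
    (hu j) (hu k)
  simp only [qStep_inv, qComplete_qStep hq, qComplete_qStep hq', hkj, hkj', Pi.inv_apply]
  -- The rescalings by `r⁻¹` and `r` act on tau functions that differ by the two beads, so the
  -- common degree cancels and the bead positions from `exists_beads_step` remain.
  have hrz : r ^ (3 * (n (i' + 1) - m (i + 1)) + (size m - size n))
      * (r⁻¹ ^ tauDegree (B ++ C) (P ++ Q)
      * r ^ (tauDegree (B ++ C) (P ++ Q) + (x - (B ++ C).length)
        - (x' - 1 + 1 - (P ++ Q).length))) = 1 := by
    rw [inv_zpow', ← zpow_add₀ hr, ← zpow_add₀ hr, hPQ]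
    convert zpow_zero r using 2
    omega
  rw [hPQ] at *
  linear_combination ((-1) ^ B.length * (-1) ^ P.length) * key - ((-1) ^ B.length * (-1) ^ P.length
    * (u k - u j) * tau (B ++ C) (P ++ Q) (shiftBy (u j) (shiftBy (u k) (qComplete q u)))
      (shiftBy (u j)⁻¹ (shiftBy (u k)⁻¹ (qComplete q⁻¹ u⁻¹)))
    * tau (x :: (B ++ C)) ((x' - 1) :: (P ++ Q)) (qComplete q u) (qComplete q⁻¹ u⁻¹)) * hrz

/-! ### The bilinear equations -/

/-- The point `(a⁻¹, b⁻¹, ab)`. -/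
noncomputable def torusPoint (a b : ℂ) : Fin 3 → ℂ := ![a⁻¹, b⁻¹, a * b]

/-- The lattice of universal characters of which `U`, `V`, `W` (`c = 0, 1, 2`) are parts. -/
noncomputable def latticeTau (q : ℂ) (m n : ZMod 3 → ℤ) (c i : ZMod 3) (a b : ℂ) : ℂ :=
  R q (core (raise m (i + c))) (core (raise n (-i + c))) a b

/-- The coefficients of the bilinear equations. -/
noncomputable def bilinearCoeff (r : ℂ) (m n : ZMod 3 → ℤ) (c i : ZMod 3) : ℂ :=
  r ^ (3 * (n (-i + c) - m (i + c + 1)) + (size m - size n))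

/-- The coordinates of a torus point have product `1`. In the applications `q = r ^ 3` and the
product of the `u_j` is `q⁻¹`; then one `q`-step, two steps followed by `r⁻¹`, and multiplication by
`r` all lead to torus points. -/
theorem latticeTau_bilinear {q : ℂ} (hq : ∀ k : ℕ, 0 < k → q ^ k ≠ 1) (m n : ZMod 3 → ℤ)
    (c i : ZMod 3) {u : Fin 3 → ℂ} (hu : ∀ j, u j ≠ 0) (j k : Fin 3) (hjk : j ≠ k) {r : ℂ}
    (hr : r ≠ 0) {a₁ b₁ a₂ b₂ a₃ b₃ a₄ b₄ : ℂ} (h₁ : qStep q k u = torusPoint a₁ b₁)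
    (h₂ : qStep q j u = torusPoint a₂ b₂)
    (h₃ : r⁻¹ • qStep q j (qStep q k u) = torusPoint a₃ b₃) (h₄ : r • u = torusPoint a₄ b₄) :
    u k * latticeTau q m n c i a₁ b₁ * latticeTau q m n c (i + 1) a₂ b₂
      - u j * latticeTau q m n c i a₂ b₂ * latticeTau q m n c (i + 1) a₁ b₁
      = bilinearCoeff r m n c i * (u k - u j) * latticeTau q m n (c + 1) (i + 2) a₃ b₃
        * latticeTau q m n (c + 2) (i + 2) a₄ b₄ := by
  have e1 : ∀ c i : ZMod 3, -i + c - 1 + 1 = -i + c := by decide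
  have e2 : ∀ c i : ZMod 3, i + 1 + c = i + c + 1 := by decide
  have e3 : ∀ c i : ZMod 3, -(i + 1) + c = -i + c - 1 := by decide
  have e4 : ∀ c i : ZMod 3, i + 2 + (c + 1) = i + c := by decide
  have e5 : ∀ c i : ZMod 3, -(i + 2) + (c + 1) = -i + c - 1 := by decide
  have e6 : ∀ c i : ZMod 3, i + 2 + (c + 2) = i + c + 1 := by decide
  have e7 : ∀ c i : ZMod 3, -(i + 2) + (c + 2) = -i + c := by decide
  -- In `ZMod 3` every pair of indices has a unique form `(i + c, -i + c)`. Raising one or the other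
  -- index from `(i + c, -i + c - 1)` gives the entries `i + 1` and `i` of class `c`, raising none
  -- or both gives entry `i + 2` of classes `c + 1` and `c + 2`.
  have h := qUC_bilinear hq m n (i + c) (-i + c - 1) hu hjk hr
  rw [h₃, h₁, h₂, h₄, e1] at h
  simp only [latticeTau, R_eq_qUC, e2, e3, e4, e5, e6, e7, bilinearCoeff]
  exact h

theorem U_eq_latticeTau (q : ℂ) (m n : ZMod 3 → ℤ) (i : ZMod 3) (a b : ℂ) :
    U q m n i a b = latticeTau q m n 0 i a b := by
  simp [U, latticeTau]

theorem V_eq_latticeTau (q r : ℂ) (m n : ZMod 3 → ℤ) (i : ZMod 3) (a b : ℂ) :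
    V q r m n i a b = latticeTau q m n 1 i (r * a) (r ^ (-2 : ℤ) * b) := rfl

theorem W_eq_latticeTau (q r : ℂ) (m n : ZMod 3 → ℤ) (i : ZMod 3) (a b : ℂ) :
    W q r m n i a b = latticeTau q m n 2 i (r⁻¹ * a) (r⁻¹ * b) := rfl

/-- Translation of `U` by `b ↦ q⁻¹ b`. -/
theorem bilinear_U {r : ℂ} (hr : r ≠ 0) (hq : ∀ k : ℕ, 0 < k → (r ^ 3) ^ k ≠ 1)
    (m n : ZMod 3 → ℤ) (i : ZMod 3) {a b : ℂ} (ha : a ≠ 0) (hb : b ≠ 0) :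
    (a * b) * latticeTau (r ^ 3) m n 0 i a b
        * latticeTau (r ^ 3) m n 0 (i + 1) a ((r ^ 3)⁻¹ * b)
      - (r ^ 3 / b) * latticeTau (r ^ 3) m n 0 i a ((r ^ 3)⁻¹ * b)
        * latticeTau (r ^ 3) m n 0 (i + 1) a b
      = bilinearCoeff r m n 0 i * ((a * b) - (r ^ 3 / b))
        * latticeTau (r ^ 3) m n 1 (i + 2) (r * a) (r ^ (-2 : ℤ) * b)
        * latticeTau (r ^ 3) m n 2 (i + 2) (r⁻¹ * a) (r⁻¹ * b) := by
  -- The base point is chosen so that a `q`-step in coordinate `2` leads to the point of `(a, b)`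
  -- and one in coordinate `1` to that of `(a, q⁻¹ b)`.
  have h := latticeTau_bilinear hq m n 0 i (u := ![a⁻¹, b⁻¹, a * b / r ^ 3])
    (by intro j; fin_cases j <;> simp [ha, hb, hr]) 1 2 (by decide) hr
    (a₁ := a) (b₁ := b)
    (a₂ := a) (b₂ := ((r ^ 3)⁻¹ * b))
    (a₃ := r * a) (b₃ := (r ^ (-2 : ℤ) * b))
    (a₄ := r⁻¹ * a) (b₄ := (r⁻¹ * b))
    (by ext j; fin_cases j <;> simp [torusPoint, qStep] <;> field_simp)
    (by ext j; fin_cases j <;> simp [torusPoint, qStep] <;> field_simp)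
    (by ext j; fin_cases j <;> simp [torusPoint, qStep] <;> field_simp)
    (by ext j; fin_cases j <;> simp [torusPoint] <;> field_simp)
  rw [zero_add, zero_add] at h
  simp only [Matrix.cons_val] at h
  field_simp at h ⊢
  linear_combination h

/-- Translation of `V` by `(a, b) ↦ (q⁻¹ a, q b)`. -/
theorem bilinear_V {r : ℂ} (hr : r ≠ 0) (hq : ∀ k : ℕ, 0 < k → (r ^ 3) ^ k ≠ 1)
    (m n : ZMod 3 → ℤ) (i : ZMod 3) {a b : ℂ} (ha : a ≠ 0) (hb : b ≠ 0) :
    (1 / b) * latticeTau (r ^ 3) m n 1 i (r * a) (r ^ (-2 : ℤ) * b)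
        * latticeTau (r ^ 3) m n 1 (i + 1) (r * ((r ^ 3)⁻¹ * a)) (r ^ (-2 : ℤ) * (r ^ 3 * b))
      - (1 / a) * latticeTau (r ^ 3) m n 1 i (r * ((r ^ 3)⁻¹ * a)) (r ^ (-2 : ℤ) * (r ^ 3 * b))
        * latticeTau (r ^ 3) m n 1 (i + 1) (r * a) (r ^ (-2 : ℤ) * b)
      = bilinearCoeff r m n 1 i * ((1 / b) - (1 / a))
        * latticeTau (r ^ 3) m n 2 (i + 2) (r⁻¹ * a) (r⁻¹ * b)
        * latticeTau (r ^ 3) m n 0 (i + 2) a b := by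
  have h := latticeTau_bilinear hq m n 1 i (u := ![r⁻¹ * a⁻¹, r⁻¹ * b⁻¹, r⁻¹ * (a * b)])
    (by intro j; fin_cases j <;> simp [ha, hb, hr]) 0 1 (by decide) hr
    (a₁ := r * a) (b₁ := (r ^ (-2 : ℤ) * b))
    (a₂ := (r * ((r ^ 3)⁻¹ * a))) (b₂ := (r ^ (-2 : ℤ) * (r ^ 3 * b)))
    (a₃ := r⁻¹ * a) (b₃ := (r⁻¹ * b))
    (a₄ := a) (b₄ := b)
    (by ext j; fin_cases j <;> simp [torusPoint, qStep] <;> field_simp)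
    (by ext j; fin_cases j <;> simp [torusPoint, qStep] <;> field_simp)
    (by ext j; fin_cases j <;> simp [torusPoint, qStep] <;> field_simp)
    (by ext j; fin_cases j <;> simp [torusPoint] <;> field_simp)
  rw [show (1 : ZMod 3) + 1 = 2 by decide, show (1 : ZMod 3) + 2 = 0 by decide] at h
  simp only [Matrix.cons_val] at h
  field_simp at h ⊢
  linear_combination h

/-- Translation of `W` by `a ↦ q a`. -/
theorem bilinear_W {r : ℂ} (hr : r ≠ 0) (hq : ∀ k : ℕ, 0 < k → (r ^ 3) ^ k ≠ 1)
    (m n : ZMod 3 → ℤ) (i : ZMod 3) {a b : ℂ} (ha : a ≠ 0) (hb : b ≠ 0) :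
    (1 / a) * latticeTau (r ^ 3) m n 2 i (r⁻¹ * a) (r⁻¹ * b)
        * latticeTau (r ^ 3) m n 2 (i + 1) (r⁻¹ * (r ^ 3 * a)) (r⁻¹ * b)
      - (a * b) * latticeTau (r ^ 3) m n 2 i (r⁻¹ * (r ^ 3 * a)) (r⁻¹ * b)
        * latticeTau (r ^ 3) m n 2 (i + 1) (r⁻¹ * a) (r⁻¹ * b)
      = bilinearCoeff r m n 2 i * ((1 / a) - (a * b))
        * latticeTau (r ^ 3) m n 0 (i + 2) a b
        * latticeTau (r ^ 3) m n 1 (i + 2) (r * a) (r ^ (-2 : ℤ) * b) := by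
  have h := latticeTau_bilinear hq m n 2 i (u := ![r * a⁻¹ / r ^ 3, r * b⁻¹, r * (a * b) / r ^ 3])
    (by intro j; fin_cases j <;> simp [ha, hb, hr]) 2 0 (by decide) hr
    (a₁ := r⁻¹ * a) (b₁ := (r⁻¹ * b))
    (a₂ := (r⁻¹ * (r ^ 3 * a))) (b₂ := (r⁻¹ * b))
    (a₃ := a) (b₃ := b)
    (a₄ := r * a) (b₄ := (r ^ (-2 : ℤ) * b))
    (by ext j; fin_cases j <;> simp [torusPoint, qStep] <;> field_simp)
    (by ext j; fin_cases j <;> simp [torusPoint, qStep] <;> field_simp)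
    (by ext j; fin_cases j <;> simp [torusPoint, qStep] <;> field_simp)
    (by ext j; fin_cases j <;> simp [torusPoint] <;> field_simp)
  rw [show (2 : ZMod 3) + 1 = 0 by decide, show (2 : ZMod 3) + 2 = 1 by decide] at h
  simp only [Matrix.cons_val] at h
  field_simp at h ⊢
  linear_combination h

/-- Translation of `V` by `a ↦ q⁻¹ a`. -/
theorem bilinear_V_fst {r : ℂ} (hr : r ≠ 0) (hq : ∀ k : ℕ, 0 < k → (r ^ 3) ^ k ≠ 1)
    (m n : ZMod 3 → ℤ) (i : ZMod 3) {a b : ℂ} (ha : a ≠ 0) (hb : b ≠ 0) :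
    (a * b) * latticeTau (r ^ 3) m n 1 i (r * a) (r ^ (-2 : ℤ) * b)
        * latticeTau (r ^ 3) m n 1 (i + 1) (r ^ (-2 : ℤ) * a) (r ^ (-2 : ℤ) * b)
      - (r ^ 3 / a) * latticeTau (r ^ 3) m n 1 i (r ^ (-2 : ℤ) * a) (r ^ (-2 : ℤ) * b)
        * latticeTau (r ^ 3) m n 1 (i + 1) (r * a) (r ^ (-2 : ℤ) * b)
      = bilinearCoeff r m n 1 i * ((a * b) - (r ^ 3 / a))
        * latticeTau (r ^ 3) m n 2 (i + 2) (r⁻¹ * a) (r⁻¹ * b)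
        * latticeTau (r ^ 3) m n 0 (i + 2) a ((r ^ 3)⁻¹ * b) := by
  have h := latticeTau_bilinear hq m n 1 i (u := ![r⁻¹ * a⁻¹, r⁻¹ * (r ^ 3 * b⁻¹), r⁻¹ * (a * b / r ^ 3)])
    (by intro j; fin_cases j <;> simp [ha, hb, hr]) 0 2 (by decide) hr
    (a₁ := r * a) (b₁ := (r ^ (-2 : ℤ) * b))
    (a₂ := (r ^ (-2 : ℤ) * a)) (b₂ := (r ^ (-2 : ℤ) * b))
    (a₃ := r⁻¹ * a) (b₃ := (r⁻¹ * b))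
    (a₄ := a) (b₄ := ((r ^ 3)⁻¹ * b))
    (by ext j; fin_cases j <;> simp [torusPoint, qStep] <;> field_simp)
    (by ext j; fin_cases j <;> simp [torusPoint, qStep] <;> field_simp)
    (by ext j; fin_cases j <;> simp [torusPoint, qStep] <;> field_simp)
    (by ext j; fin_cases j <;> simp [torusPoint] <;> field_simp)
  rw [show (1 : ZMod 3) + 1 = 2 by decide, show (1 : ZMod 3) + 2 = 0 by decide] at h
  simp only [Matrix.cons_val] at h
  field_simp at h ⊢
  linear_combination h

/-- Translation of `W` by `b ↦ q⁻¹ b`. -/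
theorem bilinear_W_snd {r : ℂ} (hr : r ≠ 0) (hq : ∀ k : ℕ, 0 < k → (r ^ 3) ^ k ≠ 1)
    (m n : ZMod 3 → ℤ) (i : ZMod 3) {a b : ℂ} (ha : a ≠ 0) (hb : b ≠ 0) :
    (a * b) * latticeTau (r ^ 3) m n 2 i (r⁻¹ * a) (r⁻¹ * b)
        * latticeTau (r ^ 3) m n 2 (i + 1) (r⁻¹ * a) (r⁻¹ * ((r ^ 3)⁻¹ * b))
      - (r ^ 6 / b) * latticeTau (r ^ 3) m n 2 i (r⁻¹ * a) (r⁻¹ * ((r ^ 3)⁻¹ * b))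
        * latticeTau (r ^ 3) m n 2 (i + 1) (r⁻¹ * a) (r⁻¹ * b)
      = bilinearCoeff r m n 2 i * ((a * b) - (r ^ 6 / b))
        * latticeTau (r ^ 3) m n 0 (i + 2) a ((r ^ 3)⁻¹ * b)
        * latticeTau (r ^ 3) m n 1 (i + 2) (r ^ (-2 : ℤ) * a) (r ^ (-2 : ℤ) * b) := by
  have h := latticeTau_bilinear hq m n 2 i (u := ![r * a⁻¹, r * b⁻¹, r * (a * b / r ^ 6)])
    (by intro j; fin_cases j <;> simp [ha, hb, hr]) 1 2 (by decide) hr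
    (a₁ := r⁻¹ * a) (b₁ := (r⁻¹ * b))
    (a₂ := r⁻¹ * a) (b₂ := (r⁻¹ * ((r ^ 3)⁻¹ * b)))
    (a₃ := a) (b₃ := ((r ^ 3)⁻¹ * b))
    (a₄ := (r ^ (-2 : ℤ) * a)) (b₄ := (r ^ (-2 : ℤ) * b))
    (by ext j; fin_cases j <;> simp [torusPoint, qStep] <;> field_simp)
    (by ext j; fin_cases j <;> simp [torusPoint, qStep] <;> field_simp)
    (by ext j; fin_cases j <;> simp [torusPoint, qStep] <;> field_simp)
    (by ext j; fin_cases j <;> simp [torusPoint] <;> field_simp)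
  rw [show (2 : ZMod 3) + 1 = 0 by decide, show (2 : ZMod 3) + 2 = 1 by decide] at h
  simp only [Matrix.cons_val] at h
  field_simp at h ⊢
  linear_combination h

/-- Translation of `V` from `(q⁻¹ a, b)` to `(a, q⁻¹ b)`. -/
theorem bilinear_V_diag {r : ℂ} (hr : r ≠ 0) (hq : ∀ k : ℕ, 0 < k → (r ^ 3) ^ k ≠ 1)
    (m n : ZMod 3 → ℤ) (i : ZMod 3) {a b : ℂ} (ha : a ≠ 0) (hb : b ≠ 0) :
    (1 / a) * latticeTau (r ^ 3) m n 1 i (r ^ (-2 : ℤ) * a) (r ^ (-2 : ℤ) * b)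
        * latticeTau (r ^ 3) m n 1 (i + 1) (r * a) (r ^ (-2 : ℤ) * ((r ^ 3)⁻¹ * b))
      - (r ^ 3 / b) * latticeTau (r ^ 3) m n 1 i (r * a) (r ^ (-2 : ℤ) * ((r ^ 3)⁻¹ * b))
        * latticeTau (r ^ 3) m n 1 (i + 1) (r ^ (-2 : ℤ) * a) (r ^ (-2 : ℤ) * b)
      = bilinearCoeff r m n 1 i * ((1 / a) - (r ^ 3 / b))
        * latticeTau (r ^ 3) m n 2 (i + 2) (r⁻¹ * a) (r⁻¹ * ((r ^ 3)⁻¹ * b))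
        * latticeTau (r ^ 3) m n 0 (i + 2) a ((r ^ 3)⁻¹ * b) := by
  have h := latticeTau_bilinear hq m n 1 i (u := ![r⁻¹ * a⁻¹, r⁻¹ * (r ^ 3 * b⁻¹), r⁻¹ * (a * b / r ^ 3)])
    (by intro j; fin_cases j <;> simp [ha, hb, hr]) 1 0 (by decide) hr
    (a₁ := (r ^ (-2 : ℤ) * a)) (b₁ := (r ^ (-2 : ℤ) * b))
    (a₂ := r * a) (b₂ := (r ^ (-2 : ℤ) * ((r ^ 3)⁻¹ * b)))
    (a₃ := r⁻¹ * a) (b₃ := (r⁻¹ * ((r ^ 3)⁻¹ * b)))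
    (a₄ := a) (b₄ := ((r ^ 3)⁻¹ * b))
    (by ext j; fin_cases j <;> simp [torusPoint, qStep] <;> field_simp)
    (by ext j; fin_cases j <;> simp [torusPoint, qStep] <;> field_simp)
    (by ext j; fin_cases j <;> simp [torusPoint, qStep] <;> field_simp)
    (by ext j; fin_cases j <;> simp [torusPoint] <;> field_simp)
  rw [show (1 : ZMod 3) + 1 = 2 by decide, show (1 : ZMod 3) + 2 = 0 by decide] at h
  simp only [Matrix.cons_val] at h
  field_simp at h ⊢
  linear_combination h

theorem solvesBilinear {r : ℂ} (hr : r ≠ 0) (hq : ∀ k : ℕ, 0 < k → (r ^ 3) ^ k ≠ 1)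
    (m n : ZMod 3 → ℤ) :
    SolvesBilinear (r ^ 3)
      (fun i => r ^ (3 * (n (-i) - m (i + 1)) + (size m - size n)))
      (fun i => r ^ (3 * (n (-i + 1) - m (i + 2)) + (size m - size n)))
      (fun i => r ^ (3 * (n (-i + 2) - m i) + (size m - size n)))
      (U (r ^ 3) m n) (V (r ^ 3) r m n) (W (r ^ 3) r m n) := by
  intro i a b ha hb
  have e1 : i + 1 + 1 = i + 2 := by revert i; decide
  have e2 : i + 2 + 1 = i := by revert i; decide
  have h1 := bilinear_U hr hq m n i ha hb
  have h2 := bilinear_V hr hq m n i ha hb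
  have h3 := bilinear_W hr hq m n i ha hb
  simp only [bilinearCoeff, add_zero, e1, e2] at h1 h2 h3
  simp only [U_eq_latticeTau, V_eq_latticeTau, W_eq_latticeTau]
  exact ⟨h1, h2, h3⟩

/-! ### Universal characters do not vanish identically -/

theorem continuous_schurP {X : ℂ → ℕ → ℂ} (hX : ∀ n, Continuous fun w => X w n) (k : ℤ) :
    Continuous fun w => schurP (X w) k := by
  rcases lt_or_ge k 0 with hk | hk
  · simp only [schurP_of_neg _ hk]
    exact continuous_const
  lift k to ℕ using hk
  induction k using Nat.strong_induction_on with
  | _ k ih =>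
    cases k with
    | zero =>
      simp only [Nat.cast_zero, schurP_zero]
      exact continuous_const
    | succ k =>
      have hk : ((k : ℂ) + 1) ≠ 0 := by exact_mod_cast Nat.succ_ne_zero k
      have e : (fun w => schurP (X w) ((k + 1 : ℕ) : ℤ)) = fun w => ((k : ℂ) + 1)⁻¹ *
          ∑ ij ∈ Finset.HasAntidiagonal.antidiagonal k,
            schurP (X w) ij.1 * (X w (ij.2 + 1) * ((ij.2 : ℂ) + 1)) := by
        ext w
        rw [← schurP_succ, inv_mul_cancel_left₀ hk]
        push_cast
        rfl
      rw [e]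
      refine continuous_const.mul (continuous_finsetSum _ fun ij hij => ?_)
      exact (ih ij.1 (Nat.lt_succ_of_le (Finset.HasAntidiagonal.antidiagonal.fst_le hij))).mul
        ((hX _).mul continuous_const)

/-- At `(1, 0, 0)` a `q`-step is also a rescaling by `q`, so `P(qz) = (1 - z) P(z)` for the
generating series. -/
theorem qComplete_principal_pred {q : ℂ} (hq : ∀ k : ℕ, 0 < k → q ^ k ≠ 1) (k : ℤ) :
    qComplete q ![1, 0, 0] (k - 1) = (1 - q ^ k) * qComplete q ![1, 0, 0] k := by
  have h := congrFun (qComplete_qStep hq 0 ![1, 0, 0]) k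
  have e : qStep q 0 ![1, 0, 0] = q • ![1, 0, 0] := by
    ext j
    fin_cases j <;> simp [qStep]
  rw [e, qComplete_smul] at h
  simp only [shiftBy, Matrix.cons_val_zero, one_mul] at h
  linear_combination h

theorem qComplete_principal_ne_zero {q : ℂ} (hq : ∀ k : ℕ, 0 < k → q ^ k ≠ 1) (k : ℕ) :
    qComplete q ![1, 0, 0] k ≠ 0 := by
  induction k with
  | zero => simp [qComplete, schurP_zero]
  | succ k ih =>
    intro h
    apply ih
    have := qComplete_principal_pred hq ((k : ℤ) + 1)
    push_cast at h
    rw [h] at this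
    simpa using this

theorem qComplete_principal_sub {q : ℂ} (hq0 : q ≠ 0) (hq : ∀ k : ℕ, 0 < k → q ^ k ≠ 1) (M : ℤ)
    (j : ℕ) : qComplete q ![1, 0, 0] (M - j) = qComplete q ![1, 0, 0] M *
      ((∏ t ∈ Finset.range j, -(q ^ t)⁻¹) * ∏ t ∈ Finset.range j, (q ^ M - q ^ t)) := by
  induction j with
  | zero => simp
  | succ j ih =>
    have h := qComplete_principal_pred hq (M - j)
    rw [ih] at h
    rw [Finset.prod_range_succ, Finset.prod_range_succ]
    have e : M - ((j + 1 : ℕ) : ℤ) = M - j - 1 := by push_cast; ring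
    rw [e, h, zpow_sub₀ hq0, zpow_natCast]
    have : q ^ j ≠ 0 := pow_ne_zero _ hq0
    field_simp
    ring

theorem zpow_injective_of_not_root {q : ℂ} (hq0 : q ≠ 0) (hq : ∀ k : ℕ, 0 < k → q ^ k ≠ 1) :
    Function.Injective fun M : ℤ => q ^ M := by
  have key : ∀ M M' : ℤ, M < M' → q ^ M ≠ q ^ M' := by
    intro M M' h e
    obtain ⟨k, hk⟩ := Int.eq_ofNat_of_zero_le (show 0 ≤ M' - M by omega)
    refine hq k (by omega) ?_
    rw [← zpow_natCast, ← hk, zpow_sub₀ hq0, ← e, div_self (zpow_ne_zero _ hq0)]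
  intro M M' h
  rcases lt_trichotomy M M' with h1 | h1 | h1
  · exact absurd h (key _ _ h1)
  · exact h1
  · exact absurd h.symm (key _ _ h1)

/-- After extraction of row and column factors the entries are monic polynomials of degree `j` in `q
^ M_i`. What remains is a Vandermonde determinant, whose nodes are distinct as `q` is not a root of
unity. -/
theorem det_principal_ne_zero {q : ℂ} (hq0 : q ≠ 0) (hq : ∀ k : ℕ, 0 < k → q ^ k ≠ 1) {l : ℕ}
    (M : Fin l → ℤ) (hM : Function.Injective M) (hM0 : ∀ i, 0 ≤ M i) :
    Matrix.det (Matrix.of fun i j : Fin l => qComplete q ![1, 0, 0] (M i - (j : ℕ))) ≠ 0 := by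
  have h1 := Matrix.det_mul_column (fun i => qComplete q ![1, 0, 0] (M i))
    (Matrix.of fun i j : Fin l => (∏ t ∈ Finset.range (j : ℕ), -(q ^ t)⁻¹) *
      ∏ t ∈ Finset.range (j : ℕ), (q ^ M i - q ^ t))
  have h2 := Matrix.det_mul_row (fun j : Fin l => ∏ t ∈ Finset.range (j : ℕ), -(q ^ t)⁻¹)
    (Matrix.of fun i j : Fin l => ∏ t ∈ Finset.range (j : ℕ), (q ^ M i - q ^ t))
  have h3 := Matrix.det_eval_matrixOfPolynomials_eq_det_vandermonde (fun i => q ^ M i)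
    (fun j : Fin l => ∏ t ∈ Finset.range (j : ℕ), (Polynomial.X - Polynomial.C (q ^ t)))
    (by intro j; rw [Polynomial.natDegree_prod_of_monic _ _ fun t _ => Polynomial.monic_X_sub_C _]
        simp only [Polynomial.natDegree_X_sub_C]
        simp)
    (by intro j; exact Polynomial.monic_prod_of_monic _ _ fun t _ => Polynomial.monic_X_sub_C _)
  simp only [Polynomial.eval_prod, Polynomial.eval_sub, Polynomial.eval_X, Polynomial.eval_C] at h3
  simp only [Matrix.of_apply] at h1 h2
  simp only [qComplete_principal_sub hq0 hq]
  rw [h1, h2, ← h3]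
  refine mul_ne_zero (Finset.prod_ne_zero_iff.mpr fun i _ => ?_)
    (mul_ne_zero (Finset.prod_ne_zero_iff.mpr fun j _ => Finset.prod_ne_zero_iff.mpr fun t _ => ?_)
      ?_)
  · obtain ⟨k, hk⟩ := Int.eq_ofNat_of_zero_le (hM0 i)
    rw [hk]
    exact qComplete_principal_ne_zero hq k
  · exact neg_ne_zero.mpr (inv_ne_zero (pow_ne_zero _ hq0))
  · exact Matrix.det_vandermonde_ne_zero_iff.mpr ((zpow_injective_of_not_root hq0 hq).comp hM)

theorem tau_eq_det (β β' : List ℤ) (hx hy : ℤ → ℂ) :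
    tau β β' hx hy = Matrix.det (Matrix.of fun i j : Fin (β'.length + β.length) =>
      if (i : ℕ) < β'.length then hy (β'.reverse.getD i 0 - (j : ℕ))
      else hx (β.getD (i - β'.length) 0 - ((β'.length + β.length : ℕ) : ℤ) + (j : ℕ))) := by
  unfold tau rowDet
  congr 1
  ext i j
  simp only [Matrix.of_apply]
  have hi := i.2
  rw [List.getD_eq_getElem _ _ (by simp)]
  split_ifs with h
  · rw [List.getElem_append_left (by simpa using h), List.getElem_map,
      List.getD_eq_getElem _ _ (by simpa using h)]
  · rw [List.getElem_append_right (by simpa using h), List.getElem_map,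
      List.getD_eq_getElem _ _ (by omega)]
    simp

/-- On the curve `(w, w⁻¹)` the arguments `(w⁻¹, w, 1)` and their inverses become `(1, w², w)` and
`(w², 1, w)` after multiplication by `w`. As `w → 0` both degenerate to the principal
specialization, and suitable powers of `w` on rows and columns make the limit matrix block diagonal,
separating the two partitions. -/
theorem exists_tau_ne_zero {q : ℂ} (hq0 : q ≠ 0) (hq : ∀ k : ℕ, 0 < k → q ^ k ≠ 1)
    {β β' : List ℤ} (hβ : β.Nodup) (hβ0 : ∀ t ∈ β, 0 < t) (hβ' : β'.Nodup)
    (hβ0' : ∀ t ∈ β', 0 ≤ t) :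
    ∃ w : ℂ, w ≠ 0 ∧ tau β β' (qComplete q (torusPoint w w⁻¹))
      (qComplete q⁻¹ (torusPoint w w⁻¹)⁻¹) ≠ 0 := by
  by_contra hcon
  push Not at hcon
  have hq' : ∀ k : ℕ, 0 < k → q⁻¹ ^ k ≠ 1 := by
    intro k hk h
    rw [inv_pow, inv_eq_one] at h
    exact hq k hk h
  set l := β.length with hl
  set l' := β'.length with hl'
  set f : ℂ → ℤ → ℂ := fun w => qComplete q ![1, w ^ 2, w] with hf
  set g : ℂ → ℤ → ℂ := fun w => qComplete q⁻¹ ![w ^ 2, 1, w] with hg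
  -- The rescaled matrix. The powers of `w` left in the off-diagonal blocks have odd exponents,
  -- hence positive ones, so these blocks vanish at `w = 0`.
  set K : ℂ → Matrix (Fin (l' + l)) (Fin (l' + l)) ℂ := fun w => Matrix.of fun i j =>
    if (i : ℕ) < l' then
      (if (j : ℕ) < l' then 1 else w ^ (2 * ((j : ℕ) - l') + 1)) * g w (β'.reverse.getD i 0 - (j : ℕ))
    else (if (j : ℕ) < l' then w ^ (2 * (l' - 1 - (j : ℕ)) + 1) else 1) *
      f w (β.getD (i - l') 0 - ((l' + l : ℕ) : ℤ) + (j : ℕ)) with hK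
  have hcont : Continuous fun w => (K w).det := by
    refine Continuous.matrix_det (continuous_matrix fun i j => ?_)
    have hfc : ∀ k, Continuous fun w => f w k := by
      intro k
      refine continuous_schurP (fun n => ?_) k
      simp only [qPowerSum, Fin.sum_univ_three]
      simp only [Matrix.cons_val]
      fun_prop
    have hgc : ∀ k, Continuous fun w => g w k := by
      intro k
      refine continuous_schurP (fun n => ?_) k
      simp only [qPowerSum, Fin.sum_univ_three]
      simp only [Matrix.cons_val]
      fun_prop
    simp only [hK, Matrix.of_apply]
    by_cases h : (i : ℕ) < l' <;> by_cases h' : (j : ℕ) < l' <;> simp only [h, h', if_true, if_false]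
    · exact continuous_const.mul (hgc _)
    · exact (continuous_pow _).mul (hgc _)
    · exact (continuous_pow _).mul (hfc _)
    · exact continuous_const.mul (hfc _)
  have hzero : ∀ w : ℂ, w ≠ 0 → (K w).det = 0 := by
    intro w hw
    have h := hcon w hw
    have ex : ∀ k, qComplete q (torusPoint w w⁻¹) k = w⁻¹ ^ k * f w k := by
      intro k
      rw [hf, ← qComplete_smul]
      congr 1
      ext j
      fin_cases j <;> simp [torusPoint] <;> field_simp
    have ey : ∀ k, qComplete q⁻¹ (torusPoint w w⁻¹)⁻¹ k = w⁻¹ ^ k * g w k := by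
      intro k
      rw [hg, ← qComplete_smul]
      congr 1
      ext j
      fin_cases j <;> simp [torusPoint] <;> field_simp
    rw [tau_eq_det] at h
    -- Column factors with exponents increasing away from the boundary between the blocks; they
    -- cancel the dependence on `j` in the diagonal blocks and double it in the others.
    set κ : Fin (l' + l) → ℂ := fun j =>
      if (j : ℕ) < l' then w ^ ((l' : ℤ) - 1 - (j : ℕ)) else w ^ (((j : ℕ) : ℤ) - l') with hκ
    set T : Matrix (Fin (l' + l)) (Fin (l' + l)) ℂ := Matrix.of fun i j =>
      if (i : ℕ) < l' then qComplete q⁻¹ (torusPoint w w⁻¹)⁻¹ (β'.reverse.getD i 0 - (j : ℕ))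
      else qComplete q (torusPoint w w⁻¹) (β.getD (i - l') 0 - ((l' + l : ℕ) : ℤ) + (j : ℕ)) with hT
    have h1 := Matrix.det_mul_row κ T
    rw [h, mul_zero] at h1
    have h2 := Matrix.det_mul_column (fun i : Fin (l' + l) =>
      if (i : ℕ) < l' then w ^ (β'.reverse.getD i 0 - l' + 1)
      else w ^ (β.getD (i - l') 0 - ((l' + l : ℕ) : ℤ) + l')) (Matrix.of fun i j => κ j * T i j)
    rw [h1, mul_zero] at h2
    rw [← h2]
    congr 1
    ext i j
    simp only [hK, hκ, hT, Matrix.of_apply, ex, ey]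
    by_cases h : (i : ℕ) < l' <;> by_cases h' : (j : ℕ) < l' <;>
      simp only [h, h', if_true, if_false, ← mul_assoc] <;> congr 1 <;>
      rw [inv_zpow', ← zpow_add₀ hw, ← zpow_add₀ hw]
    · rw [eq_comm]; convert zpow_zero w using 2; ring
    · rw [← zpow_natCast]; congr 1; push_cast [Nat.cast_sub (not_lt.mp h')]; ring
    · rw [← zpow_natCast]; congr 1
      push_cast [Nat.sub_sub, Nat.cast_sub (show 1 + (j : ℕ) ≤ l' by omega)]; ring
    · rw [eq_comm]; convert zpow_zero w using 2; push_cast; ring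
  have hK0 : (K 0).det = 0 := by
    have hc : Filter.Tendsto (fun w => (K w).det) (nhdsWithin 0 {0}ᶜ) (nhds (K 0).det) :=
      (hcont.tendsto 0).mono_left nhdsWithin_le_nhds
    have hc' : Filter.Tendsto (fun w => (K w).det) (nhdsWithin 0 {0}ᶜ) (nhds 0) := by
      refine tendsto_const_nhds.congr' ?_
      filter_upwards [self_mem_nhdsWithin] with w hw
      exact (hzero w hw).symm
    exact tendsto_nhds_unique hc hc'
  have hf0 : f 0 = qComplete q ![1, 0, 0] := by simp [hf]
  have hg0 : g 0 = qComplete q⁻¹ ![1, 0, 0] := by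
    simp only [hg, qComplete]
    congr 1
    ext n
    simp [qPowerSum, Fin.sum_univ_three]
    ring
  set A : Matrix (Fin l') (Fin l') ℂ := Matrix.of fun i j =>
    qComplete q⁻¹ ![1, 0, 0] (β'.reverse.getD i 0 - (j : ℕ)) with hA
  set D : Matrix (Fin l) (Fin l) ℂ := Matrix.of fun i j =>
    qComplete q ![1, 0, 0] (β.getD i 0 - 1 - (j : ℕ)) with hD
  -- In the `x`-block the index grows with the column, so its columns are reversed to match the form
  -- `M i - j`.
  have hblock : (K 0).submatrix finSumFinEquiv finSumFinEquiv
      = Matrix.fromBlocks A 0 0 (D.submatrix id Fin.revPerm) := by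
    ext i j
    rcases i with i | i <;> rcases j with j | j
    · simp [hK, hg0, hA]
    · simp [hK]
    · simp [hK]
    · have hj := j.2
      simp only [hK, hf0, hD, Matrix.submatrix_apply, Matrix.of_apply, finSumFinEquiv_apply_right,
        Fin.val_natAdd, Matrix.fromBlocks_apply₂₂, id, Fin.revPerm_apply, Fin.val_rev]
      simp only [not_lt.mpr (Nat.le_add_right _ _), if_false, one_mul, Nat.add_sub_cancel_left]
      congr 1
      push_cast [Nat.cast_sub (show (j : ℕ) + 1 ≤ l by omega)]
      ring
  have hdet : A.det * (D.submatrix id Fin.revPerm).det = 0 := by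
    rw [← Matrix.det_fromBlocks_zero₂₁ A 0, ← hblock, Matrix.det_submatrix_equiv_self, hK0]
  rw [Matrix.det_permute'] at hdet
  have hAne : A.det ≠ 0 := by
    refine det_principal_ne_zero (inv_ne_zero hq0) hq' (fun i => β'.reverse.getD i 0) ?_ ?_
    · intro i j hij
      simp only at hij
      rw [List.getD_eq_getElem _ _ (by rw [List.length_reverse]; exact i.2),
        List.getD_eq_getElem _ _ (by rw [List.length_reverse]; exact j.2)] at hij
      exact Fin.ext ((List.nodup_reverse.mpr hβ').getElem_inj_iff.mp hij)
    · intro i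
      rw [List.getD_eq_getElem _ _ (by rw [List.length_reverse]; exact i.2)]
      exact hβ0' _ (List.mem_reverse.mp (List.getElem_mem _))
  have hDne : D.det ≠ 0 := by
    refine det_principal_ne_zero hq0 hq (fun i => β.getD i 0 - 1) ?_ ?_
    · intro i j hij
      simp only [sub_left_inj] at hij
      rw [List.getD_eq_getElem _ _ i.2, List.getD_eq_getElem _ _ j.2] at hij
      exact Fin.ext (hβ.getElem_inj_iff.mp hij)
    · intro i
      rw [List.getD_eq_getElem _ _ i.2]
      have := hβ0 _ (List.getElem_mem i.2)
      omega
  refine mul_ne_zero hAne (mul_ne_zero ?_ hDne) hdet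
  simp

theorem exists_R_ne_zero {q : ℂ} (hq0 : q ≠ 0) (hq : ∀ k : ℕ, 0 < k → q ^ k ≠ 1)
    (m n : ZMod 3 → ℤ) : ∃ a b : ℂ, a ≠ 0 ∧ b ≠ 0 ∧ R q (core m) (core n) a b ≠ 0 := by
  have hmin : ∀ n : ZMod 3 → ℤ, ∃ c : ℤ, ∀ x ≤ c, x ∈ maya n := fun n => (isMaya_maya n).1
  obtain ⟨c, hc⟩ := hmin m
  obtain ⟨c', hc'⟩ := hmin n
  have hpos : ∀ (n : ZMod 3 → ℤ) (c : ℤ), ∀ t ∈ beads n c, 0 < t := by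
    intro n c t ht
    exact (mem_beadSet.mp ((Finset.mem_sort _).mp ht)).1
  obtain ⟨w, hw, h⟩ := exists_tau_ne_zero hq0 hq (β := beads m c)
    (β' := (beads n c').map (· - 1)) (Finset.sort_nodup _ _) (hpos m c)
    ((Finset.sort_nodup _ _).map (sub_left_injective)) (by
      intro t ht
      obtain ⟨s, hs, rfl⟩ := List.mem_map.mp ht
      have := hpos n c' s hs
      omega)
  refine ⟨w, w⁻¹, hw, inv_ne_zero hw, ?_⟩
  rw [R_eq_qUC, qUC_eq_tau (isBeadList_core hc) (isBeadList_core hc')]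
  exact h

/-! ### Values of rational functions -/

theorem evalAt_mul (p : Point ℂ) (P Q : Poly) : evalAt p (P * Q) = evalAt p P * evalAt p Q := by
  simp [evalAt]

theorem evalAt_add (p : Point ℂ) (P Q : Poly) : evalAt p (P + Q) = evalAt p P + evalAt p Q := by
  simp [evalAt]

theorem HasValueAt.of_poly (p : Point ℂ) (P : Poly) :
    HasValueAt (algebraMap Poly RatFun P) p (evalAt p P) :=
  ⟨P, 1, by simp [evalAt], by simp, by simp [evalAt]⟩

theorem HasValueAt.one (p : Point ℂ) : HasValueAt 1 p 1 := by
  have := HasValueAt.of_poly p 1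
  simpa [evalAt] using this

theorem HasValueAt.add {E E' : RatFun} {p : Point ℂ} {v v' : ℂ} (h : HasValueAt E p v)
    (h' : HasValueAt E' p v') : HasValueAt (E + E') p (v + v') := by
  obtain ⟨P, Q, hQ, hE, rfl⟩ := h
  obtain ⟨P', Q', hQ', hE', rfl⟩ := h'
  refine ⟨P * Q' + P' * Q, Q * Q', ?_, ?_, ?_⟩
  · rw [evalAt_mul]
    exact mul_ne_zero hQ hQ'
  · simp only [map_mul, map_add, ← hE, ← hE']
    ring
  · simp only [evalAt_add, evalAt_mul]
    field_simp

theorem HasValueAt.mul {E E' : RatFun} {p : Point ℂ} {v v' : ℂ} (h : HasValueAt E p v)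
    (h' : HasValueAt E' p v') : HasValueAt (E * E') p (v * v') := by
  obtain ⟨P, Q, hQ, hE, rfl⟩ := h
  obtain ⟨P', Q', hQ', hE', rfl⟩ := h'
  refine ⟨P * P', Q * Q', ?_, ?_, ?_⟩
  · rw [evalAt_mul]
    exact mul_ne_zero hQ hQ'
  · simp only [map_mul, ← hE, ← hE']
    ring
  · simp only [evalAt_mul]
    field_simp

theorem HasValueAt.inv {E : RatFun} {p : Point ℂ} {v : ℂ} (h : HasValueAt E p v) (hv : v ≠ 0) :
    HasValueAt E⁻¹ p v⁻¹ := by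
  obtain ⟨P, Q, hQ, hE, rfl⟩ := h
  have hP : evalAt p P ≠ 0 := fun h0 => hv (by rw [h0, zero_div])
  -- If `E` were zero, so would be its numerator `P`, which has a nonzero value at `p`.
  have hE0 : E ≠ 0 := by
    rintro rfl
    rw [zero_mul, eq_comm, FaithfulSMul.algebraMap_eq_zero_iff] at hE
    exact hP (by simp [hE, evalAt])
  refine ⟨Q, P, hP, ?_, by rw [inv_div]⟩
  rw [← hE, inv_mul_cancel_left₀ hE0]

theorem HasValueAt.div {E E' : RatFun} {p : Point ℂ} {v v' : ℂ} (h : HasValueAt E p v)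
    (h' : HasValueAt E' p v') (hv' : v' ≠ 0) : HasValueAt (E / E') p (v / v') := by
  rw [div_eq_mul_inv, div_eq_mul_inv]
  exact h.mul (h'.inv hv')

theorem HasValueAt.pow {E : RatFun} {p : Point ℂ} {v : ℂ} (h : HasValueAt E p v) (k : ℕ) :
    HasValueAt (E ^ k) p (v ^ k) := by
  induction k with
  | zero => simpa using HasValueAt.one p
  | succ k ih =>
    rw [pow_succ, pow_succ]
    exact ih.mul h

theorem HasValueAt.zpow {E : RatFun} {p : Point ℂ} {v : ℂ} (h : HasValueAt E p v) (hv : v ≠ 0)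
    (k : ℤ) : HasValueAt (E ^ k) p (v ^ k) := by
  rcases Int.eq_nat_or_neg k with ⟨j, rfl | rfl⟩
  · simpa using h.pow j
  · simpa using (h.pow j).inv (pow_ne_zero _ hv)

/-- Coordinatewise values of a point with rational functions as coordinates. -/
def PointHasValueAt (P : Point RatFun) (p v : Point ℂ) : Prop :=
  (∀ j, HasValueAt (P.α j) p (v.α j)) ∧ HasValueAt P.f p v.f ∧ HasValueAt P.g p v.g

theorem pointHasValueAt_generic (p : Point ℂ) : PointHasValueAt genericPoint p p := by
  refine ⟨fun j => ?_, ?_, ?_⟩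
  · have := HasValueAt.of_poly p (MvPolynomial.X (Sum.inl j))
    simpa [evalAt, genericPoint] using this
  · have := HasValueAt.of_poly p (MvPolynomial.X (Sum.inr 0))
    simpa [evalAt, genericPoint] using this
  · have := HasValueAt.of_poly p (MvPolynomial.X (Sum.inr 1))
    simpa [evalAt, genericPoint] using this

/-- The denominator of `s₃(f)` and `s₃(g)`. -/
def reflectionDenom {k : Type*} [Field k] (p : Point k) : k :=
  (p.α 3 ^ 3)⁻¹ * cx p.α * p.f + p.α 3 ^ 3 * cy p.α * p.g + cz p.α

theorem PointHasValueAt.simpleReflection {P : Point RatFun} {p v : Point ℂ}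
    (h : PointHasValueAt P p v) (hα : ∀ j, v.α j ≠ 0) (i : Fin 7)
    (hden : i = 3 → reflectionDenom v ≠ 0) :
    PointHasValueAt (simpleReflection i P) p (simpleReflection i v) := by
  obtain ⟨h1, h2, h3⟩ := h
  have hcx : HasValueAt (cx P.α) p (cx v.α) :=
    ((h1 1).mul ((h1 2).pow 2)).div (((h1 4).pow 2).mul (h1 5))
      (mul_ne_zero (pow_ne_zero _ (hα 4)) (hα 5))
  have hcy : HasValueAt (cy P.α) p (cy v.α) :=
    ((h1 5).mul ((h1 4).pow 2)).div (((h1 6).pow 2).mul (h1 0))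
      (mul_ne_zero (pow_ne_zero _ (hα 6)) (hα 0))
  have hcz : HasValueAt (cz P.α) p (cz v.α) :=
    ((h1 0).mul ((h1 6).pow 2)).div (((h1 2).pow 2).mul (h1 1))
      (mul_ne_zero (pow_ne_zero _ (hα 2)) (hα 1))
  have h33 := (h1 3).pow 3
  have h33' := h33.inv (pow_ne_zero _ (hα 3))
  have hd := (((h33'.mul hcx).mul h2).add ((h33.mul hcy).mul h3)).add hcz
  refine ⟨fun j => (h1 j).mul ((h1 i).zpow (hα i) _), ?_, ?_⟩
  · by_cases hi : i = 3
    · subst hi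
      exact (h2.mul (((hcx.mul h2).add ((h33'.mul hcy).mul h3)).add (h33.mul hcz))).div hd
        (hden rfl)
    · simpa [QPE6.simpleReflection, hi] using h2
  · by_cases hi : i = 3
    · subst hi
      exact (h3.mul ((((h33.mul hcx).mul h2).add (hcy.mul h3)).add (h33'.mul hcz))).div hd
        (hden rfl)
    · simpa [QPE6.simpleReflection, hi] using h3

theorem simpleReflection_α_ne_zero {v : Point ℂ} (hα : ∀ j, v.α j ≠ 0) (i j : Fin 7) :
    (simpleReflection i v).α j ≠ 0 :=
  mul_ne_zero (hα j) (zpow_ne_zero _ (hα i))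

/-- No denominator vanishes along a word in the simple reflections. -/
def RegularWord : List (Fin 7) → Point ℂ → Prop
  | [], _ => True
  | i :: L, p => RegularWord L p ∧ (i = 3 → reflectionDenom (L.foldr simpleReflection p) ≠ 0)

theorem pointHasValueAt_word {p : Point ℂ} (hα : ∀ j, p.α j ≠ 0) (L : List (Fin 7))
    (hL : RegularWord L p) :
    (∀ j, (L.foldr simpleReflection p).α j ≠ 0) ∧
      PointHasValueAt (L.foldr simpleReflection genericPoint) p (L.foldr simpleReflection p) := by
  induction L with
  | nil => exact ⟨hα, pointHasValueAt_generic p⟩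
  | cons i L ih =>
    obtain ⟨h1, h2⟩ := ih hL.1
    exact ⟨simpleReflection_α_ne_zero h1 i, h2.simpleReflection h1 i hL.2⟩

/-! ### The reflection `s₃` on ratios of tau functions -/

/-- The terms `c_x f`, `c_y g`, `c_z` are `γ_i Q_{i+2} / (U₀ Q₀)` for `i = 2, 0, 1`. The bilinear
equations express each as a difference of two products, and in the sum with weights `κ/h`, `h/κ`,
`1` all but one product of the form `U U X` telescope away. The three linear forms in `s₃` differ by
a cyclic permutation of the weights, so each retains a different `X_j`. -/
theorem simpleReflection_three_ratio {p : Point ℂ} {U X Q γ : ZMod 3 → ℂ} {κ h : ℂ}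
    (hU : ∀ i, U i ≠ 0) (hX : ∀ i, X i ≠ 0) (hQ : ∀ i, Q i ≠ 0) (hκ : κ ≠ 0) (hh : h ≠ 0)
    (hκh : κ ^ 3 - h ^ 3 ≠ 0)
    (eq : ∀ i, κ * U i * X (i + 1) - h * X i * U (i + 1) = γ i * (κ - h) * Q (i + 2))
    (h3 : p.α 3 ^ 3 = h / κ) (hx : cx p.α = γ 2) (hy : cy p.α = γ 0) (hz : cz p.α = γ 1)
    (hf : p.f = U 1 * Q 1 / (U 0 * Q 0)) (hg : p.g = U 2 * Q 2 / (U 0 * Q 0)) :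
    reflectionDenom p ≠ 0 ∧
      (simpleReflection 3 p).f = X 1 * Q 1 / (X 0 * Q 0) ∧
      (simpleReflection 3 p).g = X 2 * Q 2 / (X 0 * Q 0) := by
  have e0 := eq 0
  have e1 := eq 1
  have e2 := eq 2
  rw [show (0 : ZMod 3) + 1 = 1 by decide, show (0 : ZMod 3) + 2 = 2 by decide] at e0
  rw [show (1 : ZMod 3) + 1 = 2 by decide, show (1 : ZMod 3) + 2 = 0 by decide] at e1
  rw [show (2 : ZMod 3) + 1 = 0 by decide, show (2 : ZMod 3) + 2 = 1 by decide] at e2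
  have hd : κ - h ≠ 0 := fun h0 => hκh (by rw [sub_eq_zero.mp h0, sub_self])
  have u0 := hU 0
  have u1 := hU 1
  have u2 := hU 2
  have x0 := hX 0
  have q0 := hQ 0
  have hc : κ * h * (κ - h) * (U 0 * Q 0) ≠ 0 :=
    mul_ne_zero (mul_ne_zero (mul_ne_zero hκ hh) hd) (mul_ne_zero u0 q0)
  have D : (p.α 3 ^ 3)⁻¹ * cx p.α * p.f + p.α 3 ^ 3 * cy p.α * p.g + cz p.α
      = (κ ^ 3 - h ^ 3) * (U 1 * U 2 * X 0) / (κ * h * (κ - h) * (U 0 * Q 0)) := by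
    rw [h3, hx, hy, hz, hf, hg, eq_div_iff hc]
    field_simp
    linear_combination (-h ^ 2 * U 2) * e0 - (h * κ * U 0) * e1 - (κ ^ 2 * U 1) * e2
  have Nf : cx p.α * p.f + (p.α 3 ^ 3)⁻¹ * cy p.α * p.g + p.α 3 ^ 3 * cz p.α
      = (κ ^ 3 - h ^ 3) * (U 0 * U 2 * X 1) / (κ * h * (κ - h) * (U 0 * Q 0)) := by
    rw [h3, hx, hy, hz, hf, hg, eq_div_iff hc]
    field_simp
    linear_combination (-κ ^ 2 * U 2) * e0 - (h ^ 2 * U 0) * e1 - (h * κ * U 1) * e2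
  have Ng : p.α 3 ^ 3 * cx p.α * p.f + cy p.α * p.g + (p.α 3 ^ 3)⁻¹ * cz p.α
      = (κ ^ 3 - h ^ 3) * (U 0 * U 1 * X 2) / (κ * h * (κ - h) * (U 0 * Q 0)) := by
    rw [h3, hx, hy, hz, hf, hg, eq_div_iff hc]
    field_simp
    linear_combination (-h * κ * U 2) * e0 - (κ ^ 2 * U 0) * e1 - (h ^ 2 * U 1) * e2
  have hD : reflectionDenom p ≠ 0 := by
    rw [reflectionDenom, D]
    exact div_ne_zero (mul_ne_zero hκh (mul_ne_zero (mul_ne_zero u1 u2) x0)) hc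
  refine ⟨hD, ?_, ?_⟩
  · simp only [simpleReflection, if_true]
    rw [D, Nf, hf]
    field_simp
  · simp only [simpleReflection, if_true]
    rw [D, Ng, hg]
    field_simp

/-! ### Root variables that are monomials -/

/-- `s_i` on the exponents of monomials. -/
def reflExp (i : Fin 7) (v : Fin 7 → ℤ) : Fin 7 → ℤ := fun j => v j - cartan i j * v i

/-- The monomials `A ^ x_j B ^ y_j s ^ z_j`. -/
noncomputable def monomials (A B s : ℂ) (x y z : Fin 7 → ℤ) : Fin 7 → ℂ :=
  fun j => A ^ x j * B ^ y j * s ^ z j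

theorem simpleReflection_monomials {A B s : ℂ} (hA : A ≠ 0) (hB : B ≠ 0) (hs : s ≠ 0) (i : Fin 7)
    {p : Point ℂ} {x y z : Fin 7 → ℤ} (hp : p.α = monomials A B s x y z) :
    (simpleReflection i p).α = monomials A B s (reflExp i x) (reflExp i y) (reflExp i z) := by
  ext j
  simp only [simpleReflection, hp, monomials, reflExp, mul_zpow, ← zpow_mul]
  rw [sub_eq_add_neg, sub_eq_add_neg, sub_eq_add_neg, zpow_add₀ hA, zpow_add₀ hB, zpow_add₀ hs]
  simp only [mul_neg, mul_comm (cartan i j)]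
  ring

theorem word_monomials {A B s : ℂ} (hA : A ≠ 0) (hB : B ≠ 0) (hs : s ≠ 0) (L : List (Fin 7))
    {p : Point ℂ} {x y z : Fin 7 → ℤ} (hp : p.α = monomials A B s x y z) :
    (L.foldr simpleReflection p).α
      = monomials A B s (L.foldr reflExp x) (L.foldr reflExp y) (L.foldr reflExp z) := by
  induction L with
  | nil => exact hp
  | cons i L ih => exact simpleReflection_monomials hA hB hs i ih

/-- The word of `ℓ` is made of two kinds of blocks, each acting with `s₃` first. Knowing their
linear action on exponents suffices to follow all root variables. -/
theorem reflExp_word_short (v : Fin 7 → ℤ) : ([2, 4, 6, 3] : List (Fin 7)).foldr reflExp v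
    = ![v 0 + v 3 + v 6, v 1 + v 2 + v 3, -v 2 - v 3, v 2 + 2 * v 3 + v 4 + v 6, -v 3 - v 4, v 3 + v 4 + v 5, -v 3 - v 6] := by
  ext j
  fin_cases j <;> simp [reflExp, cartan] <;> ring

theorem reflExp_word_long (v : Fin 7 → ℤ) : ([2, 4, 6, 0, 1, 5, 3] : List (Fin 7)).foldr reflExp v
    = ![v 3 + v 6, v 2 + v 3, -v 1 - v 2 - v 3, v 0 + v 1 + v 2 + 2 * v 3 + v 4 + v 5 + v 6, -v 3 - v 4 - v 5, v 3 + v 4, -v 0 - v 3 - v 6] := by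
  ext j
  fin_cases j <;> simp [reflExp, cartan] <;> ring

theorem cx_monomials {A B s : ℂ} (hA : A ≠ 0) (hB : B ≠ 0) (hs : s ≠ 0) (x y z : Fin 7 → ℤ) :
    cx (monomials A B s x y z) = A ^ (x 1 + 2 * x 2 - 2 * x 4 - x 5)
      * B ^ (y 1 + 2 * y 2 - 2 * y 4 - y 5) * s ^ (z 1 + 2 * z 2 - 2 * z 4 - z 5) := by
  simp only [cx, monomials, zpow_add₀ hA, zpow_add₀ hB, zpow_add₀ hs, zpow_sub₀ hA, zpow_sub₀ hB,
    zpow_sub₀ hs, mul_comm (2 : ℤ), zpow_mul]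
  norm_cast
  field_simp

theorem cy_monomials {A B s : ℂ} (hA : A ≠ 0) (hB : B ≠ 0) (hs : s ≠ 0) (x y z : Fin 7 → ℤ) :
    cy (monomials A B s x y z) = A ^ (x 5 + 2 * x 4 - 2 * x 6 - x 0)
      * B ^ (y 5 + 2 * y 4 - 2 * y 6 - y 0) * s ^ (z 5 + 2 * z 4 - 2 * z 6 - z 0) := by
  simp only [cy, monomials, zpow_add₀ hA, zpow_add₀ hB, zpow_add₀ hs, zpow_sub₀ hA, zpow_sub₀ hB,
    zpow_sub₀ hs, mul_comm (2 : ℤ), zpow_mul]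
  norm_cast
  field_simp

theorem cz_monomials {A B s : ℂ} (hA : A ≠ 0) (hB : B ≠ 0) (hs : s ≠ 0) (x y z : Fin 7 → ℤ) :
    cz (monomials A B s x y z) = A ^ (x 0 + 2 * x 6 - 2 * x 2 - x 1)
      * B ^ (y 0 + 2 * y 6 - 2 * y 2 - y 1) * s ^ (z 0 + 2 * z 6 - 2 * z 2 - z 1) := by
  simp only [cz, monomials, zpow_add₀ hA, zpow_add₀ hB, zpow_add₀ hs, zpow_sub₀ hA, zpow_sub₀ hB,
    zpow_sub₀ hs, mul_comm (2 : ℤ), zpow_mul]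
  norm_cast
  field_simp

/-! ### The translation `ℓ` on ratios of tau functions -/

theorem regularWord_append (L L' : List (Fin 7)) (p : Point ℂ) (h' : RegularWord L' p)
    (h : RegularWord L (L'.foldr simpleReflection p)) : RegularWord (L ++ L') p := by
  induction L with
  | nil => exact h'
  | cons i L ih =>
    change RegularWord (L ++ L') p ∧ (i = 3 → reflectionDenom ((L ++ L').foldr _ p) ≠ 0)
    rw [List.foldr_append]
    exact ⟨ih h.1, h.2⟩

theorem regularWord_short {p : Point ℂ} (h : reflectionDenom p ≠ 0) : RegularWord [2, 4, 6, 3] p :=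
  ⟨⟨⟨⟨trivial, fun _ => h⟩, fun h => absurd h (by decide)⟩, fun h => absurd h (by decide)⟩,
    fun h => absurd h (by decide)⟩

theorem regularWord_long {p : Point ℂ} (h : reflectionDenom p ≠ 0) :
    RegularWord [2, 4, 6, 0, 1, 5, 3] p :=
  ⟨⟨⟨⟨⟨⟨⟨trivial, fun _ => h⟩, fun h => absurd h (by decide)⟩, fun h => absurd h (by decide)⟩,
    fun h => absurd h (by decide)⟩, fun h => absurd h (by decide)⟩,
    fun h => absurd h (by decide)⟩, fun h => absurd h (by decide)⟩

theorem fg_word_short (p : Point ℂ) :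
    (([2, 4, 6, 3] : List (Fin 7)).foldr simpleReflection p).f = (simpleReflection 3 p).f ∧
    (([2, 4, 6, 3] : List (Fin 7)).foldr simpleReflection p).g = (simpleReflection 3 p).g :=
  ⟨rfl, rfl⟩

theorem fg_word_long (p : Point ℂ) :
    (([2, 4, 6, 0, 1, 5, 3] : List (Fin 7)).foldr simpleReflection p).f
      = (simpleReflection 3 p).f ∧
    (([2, 4, 6, 0, 1, 5, 3] : List (Fin 7)).foldr simpleReflection p).g
      = (simpleReflection 3 p).g :=
  ⟨rfl, rfl⟩

/-- The exponents with which a variable occurs in `c_x`, `c_y`, `c_z`. -/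
def coeffExponents (v : Fin 7 → ℤ) : ℤ × ℤ × ℤ :=
  (v 1 + 2 * v 2 - 2 * v 4 - v 5, v 5 + 2 * v 4 - 2 * v 6 - v 0, v 0 + 2 * v 6 - 2 * v 2 - v 1)

/-- The exponent of the bilinear coefficients. -/
def bilinearExponent (m n : ZMod 3 → ℤ) (c i : ZMod 3) : ℤ :=
  3 * (n (-i + c) - m (i + c + 1)) + (size m - size n)

/-- The bilinear coefficients are free of `a` and `b`, so the exponents of `A` and `B` have to
vanish; the factor `3` comes from `r = s ^ 3`. -/
theorem coeffs_of_exponents {A B s : ℂ} (hA : A ≠ 0) (hB : B ≠ 0) (hs : s ≠ 0) {p : Point ℂ}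
    {x y z : Fin 7 → ℤ} (hp : p.α = monomials A B s x y z) {m n : ZMod 3 → ℤ} {c : ZMod 3}
    (hx : coeffExponents x = 0) (hy : coeffExponents y = 0)
    (hz : coeffExponents z = (3 * bilinearExponent m n c 2, 3 * bilinearExponent m n c 0,
      3 * bilinearExponent m n c 1)) :
    cx p.α = bilinearCoeff (s ^ 3) m n c 2 ∧ cy p.α = bilinearCoeff (s ^ 3) m n c 0 ∧
      cz p.α = bilinearCoeff (s ^ 3) m n c 1 := by
  simp only [coeffExponents, Prod.mk.injEq, Prod.mk_eq_zero] at hx hy hz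
  have e : ∀ k : ℤ, (s ^ 3) ^ k = s ^ (3 * k) := by
    intro k
    rw [zpow_mul]
    norm_cast
  rw [hp, cx_monomials hA hB hs, cy_monomials hA hB hs, cz_monomials hA hB hs, hx.1, hx.2.1, hx.2.2,
    hy.1, hy.2.1, hy.2.2, hz.1, hz.2.1, hz.2.2]
  simp only [bilinearCoeff, e, zpow_zero, one_mul]
  exact ⟨rfl, rfl, rfl⟩

/-- The exponents of `q^{1/9}` in the cube roots of the root variables. -/
def specExponents (m n : ZMod 3 → ℤ) : Fin 7 → ℤ :=
  ![size m + size n - 3 * m 3 - 3 * n 1, size m + size n - 3 * m 1 - 3 * n 3,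
    size m + size n - 1 - 3 * m 3 - 3 * n 2, 3, size m + size n - 1 - 3 * m 1 - 3 * n 1,
    size m + size n - 3 * m 2 - 3 * n 2, size m + size n - 1 - 3 * m 2 - 3 * n 3]

theorem specialize_eq_monomials (m n : ZMod 3 → ℤ) (s A B : ℂ) : specialize m n s A B
    = monomials A B s ![1, 1, 0, -1, 0, 1, 0] ![0, 0, 1, -2, 1, 0, 1] (specExponents m n) := by
  ext j
  fin_cases j <;> simp [specialize, monomials, specExponents]
  rw [div_eq_mul_inv, mul_inv, mul_comm]

theorem bilinearExponent_values (m n : ZMod 3 → ℤ) :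
    (bilinearExponent m n 0 0 = 3 * (n 3 - m 1) + (size m - size n) ∧
    bilinearExponent m n 0 1 = 3 * (n 2 - m 2) + (size m - size n) ∧
    bilinearExponent m n 0 2 = 3 * (n 1 - m 3) + (size m - size n)) ∧
    (bilinearExponent m n 1 0 = 3 * (n 1 - m 2) + (size m - size n) ∧
    bilinearExponent m n 1 1 = 3 * (n 3 - m 3) + (size m - size n) ∧
    bilinearExponent m n 1 2 = 3 * (n 2 - m 1) + (size m - size n)) ∧
    (bilinearExponent m n 2 0 = 3 * (n 2 - m 3) + (size m - size n) ∧
    bilinearExponent m n 2 1 = 3 * (n 1 - m 1) + (size m - size n) ∧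
    bilinearExponent m n 2 2 = 3 * (n 3 - m 2) + (size m - size n)) :=
  ⟨⟨rfl, rfl, rfl⟩, ⟨rfl, rfl, rfl⟩, rfl, rfl, rfl⟩

theorem coeffExponents_word_short (v : Fin 7 → ℤ) :
    coeffExponents (([2, 4, 6, 3] : List (Fin 7)).foldr reflExp v)
      = (v 1 - v 2 + v 4 - v 5, v 5 - v 4 + v 6 - v 0, v 0 - v 6 + v 2 - v 1) := by
  rw [reflExp_word_short]
  simp only [coeffExponents, Matrix.cons_val]
  ext <;> simp <;> ring

theorem coeffExponents_word_long (v : Fin 7 → ℤ) :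
    coeffExponents (([2, 4, 6, 0, 1, 5, 3] : List (Fin 7)).foldr reflExp v)
      = (-2 * v 1 - v 2 + v 4 + 2 * v 5, -2 * v 5 - v 4 + v 6 + 2 * v 0,
        -2 * v 0 - v 6 + v 2 + 2 * v 1) := by
  rw [reflExp_word_long]
  simp only [coeffExponents, Matrix.cons_val]
  ext <;> simp <;> ring

theorem cube_monomials {A B s : ℂ} {p : Point ℂ} {x y z : Fin 7 → ℤ}
    (hp : p.α = monomials A B s x y z) {X Y Z : ℤ} (hx : x 3 = X) (hy : y 3 = Y) (hz : z 3 = Z) :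
    p.α 3 ^ 3 = (A ^ 3) ^ X * (B ^ 3) ^ Y * (s ^ 3) ^ Z := by
  have e : ∀ (t : ℂ) (k : ℤ), (t ^ 3) ^ k = (t ^ k) ^ 3 := by
    intro t k
    rw [← zpow_natCast, ← zpow_natCast, ← zpow_mul, ← zpow_mul, mul_comm]
  rw [hp, monomials, hx, hy, hz, e, e, e]
  ring

/-- The conditions on the root variables under which `s₃` acts on the ratios of tau functions of
class `c` that are translated with parameters `κ, h`. -/
def ReflectsClass (r : ℂ) (m n : ZMod 3 → ℤ) (c : ZMod 3) (κ h : ℂ) (p : Point ℂ) : Prop :=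
  (cx p.α = bilinearCoeff r m n c 2 ∧ cy p.α = bilinearCoeff r m n c 0 ∧
    cz p.α = bilinearCoeff r m n c 1) ∧ p.α 3 ^ 3 = h / κ

/-- At the four occurrences of `s₃` the value of `a₃` is `q/(ab²)`, `q/(a²b)`, `q²/(ab²)`, `qa/b`.
These are the ratios `h / κ` of the bilinear equations for `U`, `V`, `W`, `V`, and `c_x`, `c_y`,
`c_z` agree with their coefficients. -/
theorem reflectsClass_along_word {s : ℂ} (hs : s ≠ 0) (m n : ZMod 3 → ℤ) {A B : ℂ} (hA : A ≠ 0)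
    (hB : B ≠ 0) {r a b : ℂ} (hr : r = s ^ 3) (ha : a = A ^ 3) (hb : b = B ^ 3) {p : Point ℂ}
    (hp0 : p.α = specialize m n s A B) {p₁ p₂ p₃ : Point ℂ}
    (hp₁ : p₁ = ([2, 4, 6, 3] : List (Fin 7)).foldr simpleReflection p)
    (hp₂ : p₂ = ([2, 4, 6, 0, 1, 5, 3] : List (Fin 7)).foldr simpleReflection p₁)
    (hp₃ : p₃ = ([2, 4, 6, 3] : List (Fin 7)).foldr simpleReflection p₂) :
    ReflectsClass r m n 0 (a * b) (r ^ 3 / b) p ∧ ReflectsClass r m n 1 (a * b) (r ^ 3 / a) p₁ ∧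
      ReflectsClass r m n 2 (a * b) (r ^ 6 / b) p₂ ∧
      ReflectsClass r m n 1 (1 / a) (r ^ 3 / b) p₃ := by
  have ha0 : a ≠ 0 := ha ▸ pow_ne_zero 3 hA
  have hb0 : b ≠ 0 := hb ▸ pow_ne_zero 3 hB
  rw [specialize_eq_monomials] at hp0
  have hp₁α := word_monomials hA hB hs [2, 4, 6, 3] hp0
  rw [← hp₁] at hp₁α
  have hp₂α := word_monomials hA hB hs [2, 4, 6, 0, 1, 5, 3] hp₁α
  rw [← hp₂] at hp₂α
  have hp₃α := word_monomials hA hB hs [2, 4, 6, 3] hp₂α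
  rw [← hp₃] at hp₃α
  obtain ⟨⟨g00, g01, g02⟩, ⟨g10, g11, g12⟩, g20, g21, g22⟩ := bilinearExponent_values m n
  have hsz : ∀ n : ZMod 3 → ℤ, size n = n 1 + n 2 + n 3 := fun n => rfl
  have c0 := coeffs_of_exponents hA hB hs hp0 (m := m) (n := n) (c := 0)
    (by simp [coeffExponents]) (by simp [coeffExponents])
    (by simp only [coeffExponents, specExponents, Matrix.cons_val, g00, g01, g02, hsz, Prod.mk.injEq]
        refine ⟨?_, ?_, ?_⟩ <;> ring)
  have c1 := coeffs_of_exponents hA hB hs hp₁α (m := m) (n := n) (c := 1)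
    (by rw [coeffExponents_word_short]; simp) (by rw [coeffExponents_word_short]; simp)
    (by rw [coeffExponents_word_short]
        simp only [specExponents, Matrix.cons_val, g10, g11, g12, hsz, Prod.mk.injEq]
        refine ⟨?_, ?_, ?_⟩ <;> ring)
  have c2 := coeffs_of_exponents hA hB hs hp₂α (m := m) (n := n) (c := 2)
    (by rw [coeffExponents_word_long, reflExp_word_short]; simp)
    (by rw [coeffExponents_word_long, reflExp_word_short]; simp)
    (by rw [coeffExponents_word_long, reflExp_word_short]
        simp only [specExponents, Matrix.cons_val, g20, g21, g22, hsz, Prod.mk.injEq]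
        refine ⟨?_, ?_, ?_⟩ <;> ring)
  have c3 := coeffs_of_exponents hA hB hs hp₃α (m := m) (n := n) (c := 1)
    (by rw [coeffExponents_word_short, reflExp_word_long, reflExp_word_short]; simp)
    (by rw [coeffExponents_word_short, reflExp_word_long, reflExp_word_short]; simp)
    (by rw [coeffExponents_word_short, reflExp_word_long, reflExp_word_short]
        simp only [specExponents, Matrix.cons_val, g10, g11, g12, hsz, Prod.mk.injEq]
        refine ⟨?_, ?_, ?_⟩ <;> ring)
  rw [← hr] at c0 c1 c2 c3
  have d0 := cube_monomials hp0 (X := -1) (Y := -2) (Z := 3) (by simp) (by simp)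
    (by simp [specExponents])
  have d1 := cube_monomials hp₁α (X := -2) (Y := -1) (Z := 3) (by rw [reflExp_word_short]; simp)
    (by rw [reflExp_word_short]; simp)
    (by rw [reflExp_word_short]; simp only [specExponents, Matrix.cons_val, hsz]; ring)
  have d2 := cube_monomials hp₂α (X := -1) (Y := -2) (Z := 6)
    (by rw [reflExp_word_long, reflExp_word_short]; simp)
    (by rw [reflExp_word_long, reflExp_word_short]; simp)
    (by rw [reflExp_word_long, reflExp_word_short]
        simp only [specExponents, Matrix.cons_val, hsz]; ring)
  have d3 := cube_monomials hp₃α (X := 1) (Y := -1) (Z := 3)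
    (by rw [reflExp_word_short, reflExp_word_long, reflExp_word_short]; simp)
    (by rw [reflExp_word_short, reflExp_word_long, reflExp_word_short]; simp)
    (by rw [reflExp_word_short, reflExp_word_long, reflExp_word_short]
        simp only [specExponents, Matrix.cons_val, hsz]; ring)
  rw [← hr, ← ha, ← hb] at d0 d1 d2 d3
  refine ⟨⟨c0, ?_⟩, ⟨c1, ?_⟩, ⟨c2, ?_⟩, ⟨c3, ?_⟩⟩
  · rw [d0]
    field_simp
  · rw [d1]
    field_simp
  · rw [d2]
    field_simp
  · rw [d3]
    field_simp

/-- If no tau function on the way vanishes, the rational functions `F` and `G` are regular at the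
point given by the ratios of tau functions, and they translate these by `b ↦ q⁻¹ b`. -/
theorem hasValueAt_ell {s : ℂ} (hs : s ≠ 0) (hq : ∀ k : ℕ, 0 < k → ((s ^ 3) ^ 3) ^ k ≠ 1)
    (m n : ZMod 3 → ℤ) {A B : ℂ} (hA : A ≠ 0) (hB : B ≠ 0) {r q a b : ℂ} (hr : r = s ^ 3)
    (hqr : q = r ^ 3) (ha : a = A ^ 3) (hb : b = B ^ 3)
    {U X V V₁ V₂ W W₁ : ZMod 3 → ℂ}
    (hU : U = fun i => latticeTau q m n 0 i a b)
    (hX : X = fun i => latticeTau q m n 0 i a (q⁻¹ * b))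
    (hV : V = fun i => latticeTau q m n 1 i (r * a) (r ^ (-2 : ℤ) * b))
    (hV₁ : V₁ = fun i => latticeTau q m n 1 i (r * a) (r ^ (-2 : ℤ) * (q⁻¹ * b)))
    (hV₂ : V₂ = fun i => latticeTau q m n 1 i (r ^ (-2 : ℤ) * a) (r ^ (-2 : ℤ) * b))
    (hW : W = fun i => latticeTau q m n 2 i (r⁻¹ * a) (r⁻¹ * b))
    (hW₁ : W₁ = fun i => latticeTau q m n 2 i (r⁻¹ * a) (r⁻¹ * (q⁻¹ * b)))
    (hU0 : ∀ i, U i ≠ 0) (hX0 : ∀ i, X i ≠ 0) (hV0 : ∀ i, V i ≠ 0) (hV₁0 : ∀ i, V₁ i ≠ 0)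
    (hV₂0 : ∀ i, V₂ i ≠ 0) (hW0 : ∀ i, W i ≠ 0) (hW₁0 : ∀ i, W₁ i ≠ 0)
    (h1 : (a * b) ^ 3 - (r ^ 3 / b) ^ 3 ≠ 0) (h2 : (a * b) ^ 3 - (r ^ 3 / a) ^ 3 ≠ 0)
    (h3 : (a * b) ^ 3 - (r ^ 6 / b) ^ 3 ≠ 0) (h4 : (1 / a) ^ 3 - (r ^ 3 / b) ^ 3 ≠ 0) :
    let p : Point ℂ := ⟨specialize m n s A B, U 1 * V 1 * W 1 / (U 0 * V 0 * W 0),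
      U 2 * V 2 * W 2 / (U 0 * V 0 * W 0)⟩
    HasValueAt F p (X 1 * V₁ 1 * W₁ 1 / (X 0 * V₁ 0 * W₁ 0)) ∧
      HasValueAt G p (X 2 * V₁ 2 * W₁ 2 / (X 0 * V₁ 0 * W₁ 0)) := by
  intro p
  have hr0 : r ≠ 0 := hr ▸ pow_ne_zero 3 hs
  have ha0 : a ≠ 0 := ha ▸ pow_ne_zero 3 hA
  have hb0 : b ≠ 0 := hb ▸ pow_ne_zero 3 hB
  rw [← hr] at hq
  subst hqr
  have hpα : p.α = specialize m n s A B := rfl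
  have hpf : p.f = U 1 * V 1 * W 1 / (U 0 * V 0 * W 0) := rfl
  have hpg : p.g = U 2 * V 2 * W 2 / (U 0 * V 0 * W 0) := rfl
  clear_value p
  -- The word is cut into four blocks ending in `3`. Within a block `f` and `g` change only at this
  -- last letter, which acts first on points.
  obtain ⟨p₁, hp₁⟩ : ∃ x, x = ([2, 4, 6, 3] : List (Fin 7)).foldr simpleReflection p := ⟨_, rfl⟩
  obtain ⟨p₂, hp₂⟩ : ∃ x, x = ([2, 4, 6, 0, 1, 5, 3] : List (Fin 7)).foldr simpleReflection p₁ := ⟨_, rfl⟩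
  obtain ⟨p₃, hp₃⟩ : ∃ x, x = ([2, 4, 6, 3] : List (Fin 7)).foldr simpleReflection p₂ := ⟨_, rfl⟩
  obtain ⟨⟨c0, d0⟩, ⟨c1, d1⟩, ⟨c2, d2⟩, c3, d3⟩ :=
    reflectsClass_along_word hs m n hA hB hr ha hb hpα hp₁ hp₂ hp₃
  have q3 : r ^ 3 ≠ 0 := pow_ne_zero _ hr0
  have q6 : r ^ 6 ≠ 0 := pow_ne_zero _ hr0
  obtain ⟨r0, f0, g0⟩ := simpleReflection_three_ratio (p := p) (U := U) (X := X)
    (Q := fun i => V i * W i) (γ := fun i => bilinearCoeff r m n 0 i) (κ := a * b) (h := r ^ 3 / b)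
    hU0 hX0 (fun i => mul_ne_zero (hV0 i) (hW0 i)) (mul_ne_zero ha0 hb0) (div_ne_zero q3 hb0) h1
    (fun i => by
      simp only [hU, hX, hV, hW]
      exact (bilinear_U hr0 hq m n i ha0 hb0).trans (mul_assoc _ _ _))
    d0 c0.1 c0.2.1 c0.2.2
    (by rw [hpf, mul_assoc, mul_assoc]) (by rw [hpg, mul_assoc, mul_assoc])
  -- With `U` already replaced by `X`, the family `V` first moves to `(q⁻¹ a, b)`. It reaches `(a,
  -- q⁻¹ b)` only in the fourth reflection, after `W` has been translated.
  obtain ⟨r1, f1, g1⟩ := simpleReflection_three_ratio (p := p₁) (U := V) (X := V₂)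
    (Q := fun i => W i * X i) (γ := fun i => bilinearCoeff r m n 1 i) (κ := a * b) (h := r ^ 3 / a)
    hV0 hV₂0 (fun i => mul_ne_zero (hW0 i) (hX0 i)) (mul_ne_zero ha0 hb0) (div_ne_zero q3 ha0) h2
    (fun i => by
      simp only [hX, hV, hV₂, hW]
      exact (bilinear_V_fst hr0 hq m n i ha0 hb0).trans (mul_assoc _ _ _))
    d1 c1.1 c1.2.1 c1.2.2
    (by rw [hp₁, (fg_word_short p).1, f0]; ring) (by rw [hp₁, (fg_word_short p).2, g0]; ring)
  obtain ⟨r2, f2, g2⟩ := simpleReflection_three_ratio (p := p₂) (U := W) (X := W₁)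
    (Q := fun i => X i * V₂ i) (γ := fun i => bilinearCoeff r m n 2 i) (κ := a * b) (h := r ^ 6 / b)
    hW0 hW₁0 (fun i => mul_ne_zero (hX0 i) (hV₂0 i)) (mul_ne_zero ha0 hb0) (div_ne_zero q6 hb0) h3
    (fun i => by
      simp only [hX, hV₂, hW, hW₁]
      exact (bilinear_W_snd hr0 hq m n i ha0 hb0).trans (mul_assoc _ _ _))
    d2 c2.1 c2.2.1 c2.2.2
    (by rw [hp₂, (fg_word_long p₁).1, f1]; ring) (by rw [hp₂, (fg_word_long p₁).2, g1]; ring)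
  obtain ⟨r3, f3, g3⟩ := simpleReflection_three_ratio (p := p₃) (U := V₂) (X := V₁)
    (Q := fun i => W₁ i * X i) (γ := fun i => bilinearCoeff r m n 1 i) (κ := 1 / a) (h := r ^ 3 / b)
    hV₂0 hV₁0 (fun i => mul_ne_zero (hW₁0 i) (hX0 i)) (div_ne_zero one_ne_zero ha0)
    (div_ne_zero q3 hb0) h4
    (fun i => by
      simp only [hX, hV₂, hV₁, hW₁]
      exact (bilinear_V_diag hr0 hq m n i ha0 hb0).trans (mul_assoc _ _ _))
    d3 c3.1 c3.2.1 c3.2.2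
    (by rw [hp₃, (fg_word_short p₂).1, f2]; ring) (by rw [hp₃, (fg_word_short p₂).2, g2]; ring)
  have hw1 : RegularWord ([2, 4, 6, 0, 1, 5, 3] ++ [2, 4, 6, 3]) p :=
    regularWord_append _ _ p (regularWord_short r0) (by rw [← hp₁]; exact regularWord_long r1)
  have hw2 : RegularWord ([2, 4, 6, 3] ++ ([2, 4, 6, 0, 1, 5, 3] ++ [2, 4, 6, 3])) p :=
    regularWord_append _ _ p hw1
      (by rw [List.foldr_append, ← hp₁, ← hp₂]; exact regularWord_short r2)
  have hreg : RegularWord ([2, 4, 6, 0, 1, 5, 3] ++ ([2, 4, 6, 3] ++ ([2, 4, 6, 0, 1, 5, 3] ++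
      [2, 4, 6, 3]))) p :=
    regularWord_append _ _ p hw2
      (by rw [List.foldr_append, List.foldr_append, ← hp₁, ← hp₂, ← hp₃]; exact regularWord_long r3)
  have hα : ∀ j, p.α j ≠ 0 := fun j => by
    rw [hpα, specialize_eq_monomials]
    exact mul_ne_zero (mul_ne_zero (zpow_ne_zero _ hA) (zpow_ne_zero _ hB)) (zpow_ne_zero _ hs)
  obtain ⟨_, _, hF, hG⟩ := pointHasValueAt_word hα _ hreg
  have hword : ([2, 4, 6, 0, 1, 5, 3] ++ ([2, 4, 6, 3] ++ ([2, 4, 6, 0, 1, 5, 3] ++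
      [2, 4, 6, 3])) : List (Fin 7)).foldr simpleReflection p
      = ([2, 4, 6, 0, 1, 5, 3] : List (Fin 7)).foldr simpleReflection p₃ := by
    rw [List.foldr_append, List.foldr_append, List.foldr_append, ← hp₁, ← hp₂, ← hp₃]
  rw [hword, (fg_word_long p₃).1, f3] at hF
  rw [hword, (fg_word_long p₃).2, g3] at hG
  have key : ∀ j, V₁ j * (W₁ j * X j) = X j * V₁ j * W₁ j := fun j => by ring
  simp only [key] at hF hG
  exact ⟨hF, hG⟩

/-! ### Laurent polynomials in two variables as functions -/

/-- The restriction of `φ` to `(ℂ^×)²` is a Laurent polynomial. -/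
def IsLaurent (φ : ℂ → ℂ → ℂ) : Prop :=
  ∃ (P : MvPolynomial (Fin 2) ℂ) (K : ℕ), ∀ a b : ℂ, a ≠ 0 → b ≠ 0 →
    φ a b * (a * b) ^ K = MvPolynomial.eval ![a, b] P

namespace IsLaurent

variable {φ ψ : ℂ → ℂ → ℂ}

theorem const (c : ℂ) : IsLaurent fun _ _ => c :=
  ⟨MvPolynomial.C c, 0, fun a b _ _ => by simp⟩

theorem fst : IsLaurent fun a _ => a :=
  ⟨MvPolynomial.X 0, 0, fun a b _ _ => by simp⟩

theorem snd : IsLaurent fun _ b => b :=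
  ⟨MvPolynomial.X 1, 0, fun a b _ _ => by simp⟩

theorem fst_inv : IsLaurent fun a _ => a⁻¹ :=
  ⟨MvPolynomial.X 1, 1, fun a b ha _ => by simp [ha]⟩

theorem snd_inv : IsLaurent fun _ b => b⁻¹ :=
  ⟨MvPolynomial.X 0, 1, fun a b _ hb => by simp; field_simp⟩

theorem add (hφ : IsLaurent φ) (hψ : IsLaurent ψ) : IsLaurent fun a b => φ a b + ψ a b := by
  obtain ⟨P, K, hP⟩ := hφ
  obtain ⟨Q, L, hQ⟩ := hψ
  refine ⟨P * (MvPolynomial.X 0 * MvPolynomial.X 1) ^ L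
    + Q * (MvPolynomial.X 0 * MvPolynomial.X 1) ^ K, K + L, fun a b ha hb => ?_⟩
  have h1 := hP a b ha hb
  have h2 := hQ a b ha hb
  simp only [map_add, map_mul, map_pow, MvPolynomial.eval_X, ← h1, ← h2, Matrix.cons_val]
  ring

theorem mul (hφ : IsLaurent φ) (hψ : IsLaurent ψ) : IsLaurent fun a b => φ a b * ψ a b := by
  obtain ⟨P, K, hP⟩ := hφ
  obtain ⟨Q, L, hQ⟩ := hψ
  refine ⟨P * Q, K + L, fun a b ha hb => ?_⟩
  rw [map_mul, ← hP a b ha hb, ← hQ a b ha hb]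
  ring

theorem sub (hφ : IsLaurent φ) (hψ : IsLaurent ψ) : IsLaurent fun a b => φ a b - ψ a b := by
  simpa [sub_eq_add_neg] using hφ.add ((const (-1)).mul hψ)

theorem pow (hφ : IsLaurent φ) (k : ℕ) : IsLaurent fun a b => φ a b ^ k := by
  induction k with
  | zero => simpa using const 1
  | succ k ih => simpa [pow_succ] using ih.mul hφ

theorem sum {ι : Type*} (s : Finset ι) {φ : ι → ℂ → ℂ → ℂ} (h : ∀ i ∈ s, IsLaurent (φ i)) :
    IsLaurent fun a b => ∑ i ∈ s, φ i a b := by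
  classical
  induction s using Finset.induction_on with
  | empty => simpa using const 0
  | insert i s hi ih =>
    simp only [Finset.sum_insert hi]
    exact (h i (by simp)).add (ih fun j hj => h j (by simp [hj]))

theorem prod {ι : Type*} (s : Finset ι) {φ : ι → ℂ → ℂ → ℂ} (h : ∀ i ∈ s, IsLaurent (φ i)) :
    IsLaurent fun a b => ∏ i ∈ s, φ i a b := by
  classical
  induction s using Finset.induction_on with
  | empty => simpa using const 1
  | insert i s hi ih =>
    simp only [Finset.prod_insert hi]
    exact (h i (by simp)).mul (ih fun j hj => h j (by simp [hj]))

theorem scale (hφ : IsLaurent φ) {c d : ℂ} (hc : c ≠ 0) (hd : d ≠ 0) :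
    IsLaurent fun a b => φ (c * a) (d * b) := by
  obtain ⟨P, K, hP⟩ := hφ
  refine ⟨MvPolynomial.C ((c * d) ^ K)⁻¹ * MvPolynomial.bind₁
    ![MvPolynomial.C c * MvPolynomial.X 0, MvPolynomial.C d * MvPolynomial.X 1] P, K,
    fun a b ha hb => ?_⟩
  have h := hP (c * a) (d * b) (mul_ne_zero hc ha) (mul_ne_zero hd hb)
  have hv : (fun i => MvPolynomial.eval ![a, b] ((![MvPolynomial.C c * MvPolynomial.X 0,
      MvPolynomial.C d * MvPolynomial.X 1] : Fin 2 → MvPolynomial (Fin 2) ℂ) i))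
      = ![c * a, d * b] := by
    funext i
    fin_cases i <;> simp
  rw [map_mul, MvPolynomial.eval_C, ← MvPolynomial.coe_aeval_eq_eval, RingHom.coe_coe,
    MvPolynomial.aeval_bind₁]
  simp only [MvPolynomial.aeval_eq_eval, hv, ← h]
  have : (c * d) ^ K ≠ 0 := pow_ne_zero _ (mul_ne_zero hc hd)
  field_simp
  ring

theorem schurP_apply {x : ℂ → ℂ → ℕ → ℂ} (hx : ∀ n, IsLaurent fun a b => x a b n) (k : ℤ) :
    IsLaurent fun a b => schurP (x a b) k := by
  rcases lt_or_ge k 0 with hk | hk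
  · simpa [schurP_of_neg _ hk] using const 0
  lift k to ℕ using hk
  induction k using Nat.strong_induction_on with
  | _ k ih =>
    rcases k with _ | k
    · simpa [schurP_zero] using const 1
    · have h : ∀ a b, schurP (x a b) ((k + 1 : ℕ) : ℤ) = ((k : ℂ) + 1)⁻¹ *
          ∑ ij ∈ Finset.HasAntidiagonal.antidiagonal k,
            schurP (x a b) ij.1 * (x a b (ij.2 + 1) * ((ij.2 : ℂ) + 1)) := fun a b => by
        rw [← schurP_succ, inv_mul_cancel_left₀ (Nat.cast_add_one_ne_zero k)]
        push_cast
        rfl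
      simp only [h]
      exact (const _).mul (sum _ fun ij hij => (ih ij.1 (Nat.lt_succ_of_le
        (Finset.HasAntidiagonal.antidiagonal.fst_le hij))).mul ((hx _).mul (const _)))

theorem R_apply (q : ℂ) (lam mu : List ℤ) : IsLaurent (R q lam mu) := by
  unfold R universalCharacter
  simp only [Matrix.det_apply, Matrix.of_apply, Units.smul_def, zsmul_eq_mul]
  refine sum _ fun σ _ => (const _).mul (prod _ fun i _ => ?_)
  have hx : ∀ n : ℕ, IsLaurent fun a b : ℂ =>
      ((a ^ n)⁻¹ + (b ^ n)⁻¹ + (a * b) ^ n) / (n * (1 - q ^ n)) := fun n => by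
    simp only [← inv_pow, div_eq_mul_inv _ ((n : ℂ) * (1 - q ^ n))]
    exact (((fst_inv.pow n).add (snd_inv.pow n)).add ((fst.mul snd).pow n)).mul (const _)
  have hy : ∀ n : ℕ, IsLaurent fun a b : ℂ =>
      (a ^ n + b ^ n + ((a * b) ^ n)⁻¹) / (n * (1 - (q ^ n)⁻¹)) := fun n => by
    simp only [div_eq_mul_inv _ ((n : ℂ) * (1 - (q ^ n)⁻¹)), mul_pow, mul_inv]
    simp only [← inv_pow]
    exact (((fst.pow n).add (snd.pow n)).add ((fst_inv.pow n).mul (snd_inv.pow n))).mul (const _)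
  split_ifs
  · exact schurP_apply hy _
  · exact schurP_apply hx _

end IsLaurent

/-- A Laurent polynomial on `(ℂ^×)²` which does not vanish identically. -/
def IsNonzeroLaurent (φ : ℂ → ℂ → ℂ) : Prop :=
  ∃ (P : MvPolynomial (Fin 2) ℂ) (K : ℕ), P ≠ 0 ∧ ∀ a b : ℂ, a ≠ 0 → b ≠ 0 →
    φ a b * (a * b) ^ K = MvPolynomial.eval ![a, b] P

theorem IsLaurent.isNonzeroLaurent {φ : ℂ → ℂ → ℂ} (h : IsLaurent φ) {a b : ℂ} (ha : a ≠ 0)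
    (hb : b ≠ 0) (hab : φ a b ≠ 0) : IsNonzeroLaurent φ := by
  obtain ⟨P, K, hP⟩ := h
  refine ⟨P, K, ?_, hP⟩
  rintro rfl
  have := hP a b ha hb
  simp [ha, hb, hab] at this

namespace IsNonzeroLaurent

variable {φ ψ : ℂ → ℂ → ℂ}

theorem mul (hφ : IsNonzeroLaurent φ) (hψ : IsNonzeroLaurent ψ) :
    IsNonzeroLaurent fun a b => φ a b * ψ a b := by
  obtain ⟨P, K, hP0, hP⟩ := hφ
  obtain ⟨Q, L, hQ0, hQ⟩ := hψ
  refine ⟨P * Q, K + L, mul_ne_zero hP0 hQ0, fun a b ha hb => ?_⟩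
  rw [map_mul, ← hP a b ha hb, ← hQ a b ha hb]
  ring

theorem prod {ι : Type*} (s : Finset ι) {φ : ι → ℂ → ℂ → ℂ}
    (h : ∀ i ∈ s, IsNonzeroLaurent (φ i)) : IsNonzeroLaurent fun a b => ∏ i ∈ s, φ i a b := by
  classical
  induction s using Finset.induction_on with
  | empty => simpa using (IsLaurent.const 1).isNonzeroLaurent one_ne_zero one_ne_zero one_ne_zero
  | insert i s hi ih =>
    simp only [Finset.prod_insert hi]
    exact (h i (by simp)).mul (ih fun j hj => h j (by simp [hj]))

theorem latticeTau_scale {q : ℂ} (hq0 : q ≠ 0) (hq : ∀ k : ℕ, 0 < k → q ^ k ≠ 1) (m n : ZMod 3 → ℤ)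
    (c i : ZMod 3) {t u : ℂ} (ht : t ≠ 0) (hu : u ≠ 0) :
    IsNonzeroLaurent fun a b => latticeTau q m n c i (t * a) (u * b) := by
  obtain ⟨a, b, ha, hb, hab⟩ := exists_R_ne_zero hq0 hq (raise m (i + c)) (raise n (-i + c))
  refine ((IsLaurent.R_apply q (core (raise m (i + c))) (core (raise n (-i + c)))).scale ht
    hu).isNonzeroLaurent (mul_ne_zero (inv_ne_zero ht) ha) (mul_ne_zero (inv_ne_zero hu) hb) ?_
  rwa [mul_inv_cancel_left₀ ht, mul_inv_cancel_left₀ hu]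

end IsNonzeroLaurent

/-! ### The solution at generic parameters -/

/-- Where this function does not vanish, all the tau functions and all the factors that occur in
the four reflections `s₃` of the word of `ℓ` are nonzero. -/
noncomputable def genericity (r : ℂ) (m n : ZMod 3 → ℤ) (a b : ℂ) : ℂ :=
  (∏ i, latticeTau (r ^ 3) m n 0 i a b) * (∏ i, latticeTau (r ^ 3) m n 0 i a ((r ^ 3)⁻¹ * b)) *
  (∏ i, latticeTau (r ^ 3) m n 1 i (r * a) (r ^ (-2 : ℤ) * b)) *
  (∏ i, latticeTau (r ^ 3) m n 1 i (r * a) (r ^ (-2 : ℤ) * ((r ^ 3)⁻¹ * b))) *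
  (∏ i, latticeTau (r ^ 3) m n 1 i (r ^ (-2 : ℤ) * a) (r ^ (-2 : ℤ) * b)) *
  (∏ i, latticeTau (r ^ 3) m n 2 i (r⁻¹ * a) (r⁻¹ * b)) *
  (∏ i, latticeTau (r ^ 3) m n 2 i (r⁻¹ * a) (r⁻¹ * ((r ^ 3)⁻¹ * b))) *
  ((a * b) ^ 3 - (r ^ 3 / b) ^ 3) * ((a * b) ^ 3 - (r ^ 3 / a) ^ 3) *
  ((a * b) ^ 3 - (r ^ 6 / b) ^ 3) * ((1 / a) ^ 3 - (r ^ 3 / b) ^ 3)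

theorem isNonzeroLaurent_genericity {r : ℂ} (hr : r ≠ 0)
    (hq : ∀ k : ℕ, 0 < k → (r ^ 3) ^ k ≠ 1) (m n : ZMod 3 → ℤ) :
    IsNonzeroLaurent (genericity r m n) := by
  have hq0 : r ^ 3 ≠ 0 := pow_ne_zero 3 hr
  have hi : r⁻¹ ≠ 0 := inv_ne_zero hr
  have h2 : r ^ (-2 : ℤ) ≠ 0 := zpow_ne_zero _ hr
  have hqi : (r ^ 3)⁻¹ ≠ 0 := inv_ne_zero hq0
  have hτ : ∀ (c : ZMod 3) {t u : ℂ}, t ≠ 0 → u ≠ 0 → IsNonzeroLaurent fun a b =>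
      ∏ i, latticeTau (r ^ 3) m n c i (t * a) (u * b) := fun c t u ht hu =>
    IsNonzeroLaurent.prod _ fun i _ => IsNonzeroLaurent.latticeTau_scale hq0 hq m n c i ht hu
  have e1 := hτ 0 one_ne_zero one_ne_zero
  have e2 := hτ 0 one_ne_zero hqi
  have e3 := hτ 1 hr h2
  have e4 := hτ 1 hr (mul_ne_zero h2 hqi)
  have e5 := hτ 1 h2 h2
  have e6 := hτ 2 hi hi
  have e7 := hτ 2 hi (mul_ne_zero hi hqi)
  simp only [one_mul, mul_assoc] at e1 e2 e4 e7
  have hab : IsLaurent fun a b => (a * b) ^ 3 := (IsLaurent.fst.mul IsLaurent.snd).pow 3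
  have hc : ∀ c : ℂ, IsLaurent fun _ b => (c / b) ^ 3 := fun c => by
    simp only [div_eq_mul_inv]
    exact ((IsLaurent.const c).mul IsLaurent.snd_inv).pow 3
  have hd : ∀ c : ℂ, IsLaurent fun a _ => (c / a) ^ 3 := fun c => by
    simp only [div_eq_mul_inv]
    exact ((IsLaurent.const c).mul IsLaurent.fst_inv).pow 3
  -- A ratio `2` between the two cubed quantities gives the nonzero value `8c³ - c³`; the next two
  -- factors are tested in the same spirit.
  have e8 : ∀ c : ℂ, c ≠ 0 → IsNonzeroLaurent fun a b => (a * b) ^ 3 - (c / b) ^ 3 := fun c h =>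
    (hab.sub (hc c)).isNonzeroLaurent (a := 2 * c) (b := 1) (by simpa using h) one_ne_zero (by
      rw [show (2 * c * 1) ^ 3 - (c / 1) ^ 3 = 7 * c ^ 3 by ring]
      simpa using h)
  have e9 : IsNonzeroLaurent fun a b => (a * b) ^ 3 - (r ^ 3 / a) ^ 3 :=
    (hab.sub (hd _)).isNonzeroLaurent (a := 1) (b := 2 * r ^ 3) one_ne_zero (by simpa using hr) (by
      rw [show (1 * (2 * r ^ 3)) ^ 3 - (r ^ 3 / 1) ^ 3 = 7 * r ^ 9 by ring]
      simpa using hr)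
  have e10 : IsNonzeroLaurent fun a b => (1 / a) ^ 3 - (r ^ 3 / b) ^ 3 :=
    ((hd 1).sub (hc _)).isNonzeroLaurent (a := 1) (b := 2 * r ^ 3) one_ne_zero (by simpa using hr)
      (by
        rw [show r ^ 3 / (2 * r ^ 3) = 1 / 2 by field_simp]
        norm_num)
  exact ((((((((((e1.mul e2).mul e3).mul e4).mul e5).mul e6).mul e7).mul (e8 _ hq0)).mul e9).mul
    (e8 _ (pow_ne_zero 6 hr))).mul e10)

theorem isNonzeroLaurent_UVW {r : ℂ} (hr : r ≠ 0) (hq : ∀ k : ℕ, 0 < k → (r ^ 3) ^ k ≠ 1)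
    (m n : ZMod 3 → ℤ) (i : ZMod 3) : IsNonzeroLaurent (UVW (r ^ 3) r m n i) := by
  have hq0 : r ^ 3 ≠ 0 := pow_ne_zero 3 hr
  have e1 := IsNonzeroLaurent.latticeTau_scale hq0 hq m n 0 i one_ne_zero one_ne_zero
  simp only [one_mul, ← U_eq_latticeTau] at e1
  exact (e1.mul (IsNonzeroLaurent.latticeTau_scale hq0 hq m n 1 i hr (zpow_ne_zero (-2) hr))).mul
    (IsNonzeroLaurent.latticeTau_scale hq0 hq m n 2 i (inv_ne_zero hr) (inv_ne_zero hr))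

theorem UVW_ne_zero_of_genericity {r : ℂ} {m n : ZMod 3 → ℤ} {a b : ℂ}
    (h : genericity r m n a b ≠ 0) (i : ZMod 3) :
    UVW (r ^ 3) r m n i a b ≠ 0 ∧ UVW (r ^ 3) r m n i a ((r ^ 3)⁻¹ * b) ≠ 0 := by
  simp only [genericity, mul_ne_zero_iff, Finset.prod_ne_zero_iff, Finset.mem_univ,
    forall_true_left] at h
  obtain ⟨⟨⟨⟨⟨⟨⟨⟨⟨⟨hU, hX⟩, hV⟩, hV₁⟩, _⟩, hW⟩, hW₁⟩, _⟩, _⟩, _⟩, _⟩ := h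
  simp only [UVW, U_eq_latticeTau, V_eq_latticeTau, W_eq_latticeTau]
  exact ⟨mul_ne_zero (mul_ne_zero (hU i) (hV i)) (hW i),
    mul_ne_zero (mul_ne_zero (hX i) (hV₁ i)) (hW₁ i)⟩

theorem specialize_prod (m n : ZMod 3 → ℤ) {s A B : ℂ} (hs : s ≠ 0) (hA : A ≠ 0) (hB : B ≠ 0) :
    specialize m n s A B 0 * specialize m n s A B 1 * specialize m n s A B 2 ^ 2 *
      specialize m n s A B 3 ^ 3 * specialize m n s A B 4 ^ 2 * specialize m n s A B 5 *
      specialize m n s A B 6 ^ 2 = s ^ 3 := by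
  have h3 : (3 : ZMod 3) = 0 := rfl
  have hm : m 0 = size m - m 1 - m 2 := by rw [size, h3]; ring
  have hn : n 0 = size n - n 1 - n 2 := by rw [size, h3]; ring
  -- In the total exponent the contributions of `m` and `n` cancel. The remaining `-6` combines with
  -- `s ^ 9` from the cube of `α₃`.
  have key : s ^ (size m + size n - 3 * m 3 - 3 * n 1) * s ^ (size m + size n - 3 * m 1 - 3 * n 3) *
      (s ^ (size m + size n - 1 - 3 * m 3 - 3 * n 2)) ^ 2 *
      (s ^ (size m + size n - 1 - 3 * m 1 - 3 * n 1)) ^ 2 *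
      s ^ (size m + size n - 3 * m 2 - 3 * n 2) *
      (s ^ (size m + size n - 1 - 3 * m 2 - 3 * n 3)) ^ 2 = s ^ (-6 : ℤ) := by
    simp only [sq, ← zpow_add₀ hs]
    congr 1
    rw [h3, hm, hn]
    ring
  have h6 : s ^ (-6 : ℤ) * s ^ 9 = s ^ 3 := by
    rw [← zpow_natCast, ← zpow_natCast, ← zpow_add₀ hs]
    norm_num
  rw [← h6, ← key]
  simp only [specialize, Matrix.cons_val]
  field_simp

theorem specialize_qShift (m n : ZMod 3 → ℤ) {r : ℂ} (hr : r ≠ 0) (s A B : ℂ) :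
    specialize m n s A (r⁻¹ * B) = qShift r (specialize m n s A B) := by
  funext j
  fin_cases j <;> simp [specialize, qShift] <;> field_simp

theorem solvesQPE6At_of_genericity {s : ℂ} (hs : s ≠ 0)
    (hq : ∀ k : ℕ, 0 < k → ((s ^ 3) ^ 3) ^ k ≠ 1) (m n : ZMod 3 → ℤ) {A B : ℂ} (hA : A ≠ 0)
    (hB : B ≠ 0) (h : genericity (s ^ 3) m n (A ^ 3) (B ^ 3) ≠ 0) :
    SolvesQPE6At (s ^ 3) (fun t : ℂ × ℂ => specialize m n s t.1 t.2)
      (fun t => fSol ((s ^ 3) ^ 3) (s ^ 3) m n (t.1 ^ 3) (t.2 ^ 3))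
      (fun t => gSol ((s ^ 3) ^ 3) (s ^ 3) m n (t.1 ^ 3) (t.2 ^ 3))
      (A, B) (A, (s ^ 3)⁻¹ * B) := by
  have h3 : (3 : ZMod 3) = 0 := rfl
  have hB3 : ((s ^ 3)⁻¹ * B) ^ 3 = ((s ^ 3) ^ 3)⁻¹ * B ^ 3 := by rw [mul_pow, inv_pow]
  simp only [genericity, mul_ne_zero_iff, Finset.prod_ne_zero_iff, Finset.mem_univ,
    forall_true_left] at h
  obtain ⟨⟨⟨⟨⟨⟨⟨⟨⟨⟨hU, hX⟩, hV⟩, hV₁⟩, hV₂⟩, hW⟩, hW₁⟩, h₁⟩, h₂⟩, h₃⟩, h₄⟩ := h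
  have hFG := hasValueAt_ell hs hq m n hA hB rfl rfl rfl rfl rfl rfl rfl rfl rfl rfl rfl
    hU hX hV hV₁ hV₂ hW hW₁ h₁ h₂ h₃ h₄
  refine ⟨specialize_prod m n hs hA hB, specialize_qShift m n (pow_ne_zero 3 hs) s A B, ?_, ?_⟩
  · simp only [fSol, gSol, UVW, U_eq_latticeTau, V_eq_latticeTau, W_eq_latticeTau, h3, hB3]
    exact hFG.1
  · simp only [fSol, gSol, UVW, U_eq_latticeTau, V_eq_latticeTau, W_eq_latticeTau, h3, hB3]
    exact hFG.2

/-- The numerator polynomial of the genericity function is included in the denominator `D`, so that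
`D ≠ 0` already excludes every degenerate parameter. -/
theorem exists_eq_div {r : ℂ} (hr : r ≠ 0) (hq : ∀ k : ℕ, 0 < k → (r ^ 3) ^ k ≠ 1)
    (m n : ZMod 3 → ℤ) :
    ∃ Nf Ng D : MvPolynomial (Fin 2) ℂ, D ≠ 0 ∧
      ∀ a b : ℂ, a ≠ 0 → b ≠ 0 → MvPolynomial.eval ![a, b] D ≠ 0 →
        genericity r m n a b ≠ 0 ∧
        fSol (r ^ 3) r m n a b = MvPolynomial.eval ![a, b] Nf / MvPolynomial.eval ![a, b] D ∧
        gSol (r ^ 3) r m n a b = MvPolynomial.eval ![a, b] Ng / MvPolynomial.eval ![a, b] D := by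
  obtain ⟨Q, L, hQ0, hQ⟩ := isNonzeroLaurent_genericity hr hq m n
  obtain ⟨P₁, K₁, -, hP₁⟩ := isNonzeroLaurent_UVW hr hq m n 1
  obtain ⟨P₂, K₂, -, hP₂⟩ := isNonzeroLaurent_UVW hr hq m n 2
  obtain ⟨P₃, K₃, hP₃0, hP₃⟩ := isNonzeroLaurent_UVW hr hq m n 3
  let x : MvPolynomial (Fin 2) ℂ := MvPolynomial.X 0 * MvPolynomial.X 1
  have hx : x ≠ 0 := mul_ne_zero (MvPolynomial.X_ne_zero _) (MvPolynomial.X_ne_zero _)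
  -- The powers of `x = ab` clear the Laurent denominators of `f` and `g` simultaneously, so both
  -- have the same denominator.
  refine ⟨P₁ * Q * x ^ (K₃ + K₂), P₂ * Q * x ^ (K₃ + K₁), P₃ * Q * x ^ (K₁ + K₂),
    mul_ne_zero (mul_ne_zero hP₃0 hQ0) (pow_ne_zero _ hx), fun a b ha hb hD => ?_⟩
  have hab : a * b ≠ 0 := mul_ne_zero ha hb
  have hxe : MvPolynomial.eval ![a, b] x = a * b := by simp [x]
  simp only [map_mul, map_pow, hxe, ← hQ a b ha hb, ← hP₁ a b ha hb, ← hP₂ a b ha hb,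
    ← hP₃ a b ha hb, fSol, gSol, ne_eq, mul_eq_zero, not_or] at hD ⊢
  obtain ⟨⟨⟨h1, -⟩, h2, -⟩, -⟩ := hD
  refine ⟨h2, ?_, ?_⟩
  · rw [div_eq_div_iff h1 (by simp [h1, h2, ha, hb])]
    ring
  · rw [div_eq_div_iff h1 (by simp [h1, h2, ha, hb])]
    ring

end QPE6

open QPE6 in
theorem mainTheorem2 (q r s : ℂ) (hr : r ^ 3 = q) (hs : s ^ 3 = r) (hq0 : q ≠ 0)
    (hq : ∀ k : ℕ, 0 < k → q ^ k ≠ 1) (m n : ZMod 3 → ℤ) :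
    SolvesBilinear q
      (fun i => r ^ (3 * (n (-i) - m (i + 1)) + (size m - size n)))
      (fun i => r ^ (3 * (n (-i + 1) - m (i + 2)) + (size m - size n)))
      (fun i => r ^ (3 * (n (-i + 2) - m i) + (size m - size n)))
      (U q m n) (V q r m n) (W q r m n) ∧
    ∃ Nf Ng D : MvPolynomial (Fin 2) ℂ, D ≠ 0 ∧
      ∀ a b : ℂ, a ≠ 0 → b ≠ 0 → MvPolynomial.eval ![a, b] D ≠ 0 →
        UVW q r m n 3 a b ≠ 0 ∧ UVW q r m n 3 a (q⁻¹ * b) ≠ 0 ∧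
        fSol q r m n a b = MvPolynomial.eval ![a, b] Nf / MvPolynomial.eval ![a, b] D ∧
        gSol q r m n a b = MvPolynomial.eval ![a, b] Ng / MvPolynomial.eval ![a, b] D ∧
        ∀ A B : ℂ, A ^ 3 = a → B ^ 3 = b →
          SolvesQPE6At r (fun t : ℂ × ℂ => specialize m n s t.1 t.2)
            (fun t => fSol q r m n (t.1 ^ 3) (t.2 ^ 3))
            (fun t => gSol q r m n (t.1 ^ 3) (t.2 ^ 3))
            (A, B) (A, r⁻¹ * B) := by
  subst hs hr
  have hs0 : s ≠ 0 := by
    rintro rfl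
    simp at hq0
  have hr0 : s ^ 3 ≠ 0 := pow_ne_zero 3 hs0
  refine ⟨solvesBilinear hr0 hq m n, ?_⟩
  obtain ⟨Nf, Ng, D, hD0, hD⟩ := exists_eq_div hr0 hq m n
  refine ⟨Nf, Ng, D, hD0, fun a b ha hb hab => ?_⟩
  obtain ⟨hgen, hf, hg⟩ := hD a b ha hb hab
  obtain ⟨h1, h2⟩ := UVW_ne_zero_of_genericity hgen 3
  refine ⟨h1, h2, hf, hg, ?_⟩
  rintro A B rfl rfl
  exact solvesQPE6At_of_genericity hs0 hq m n (by rintro rfl; simp at ha)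
    (by rintro rfl; simp at hb) hgen
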